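/- Let $\Omega,\Omega'\subset\mathbb R^3$ be smooth bounded domains that are axisymmetric (invariant under all rotations about the $z$-axis), with $\inf_{(x,y,z)\in\Omega}\sqrt{x^2+y^2}>0$, and put $\Omega_0=\{(r,z): r>0,\ (r,0,z)\in\Omega\}$. A map $u:\Omega\to\mathbb R^3$ is called axisymmetric if there is $v=(v_1,v_2):\Omega_0\to\mathbb R^2$ with $v_1\ge 0$ a.e. and, a.e. in $\Omega$, $$u(r\cos\theta,r\sin\theta,z)=v_1(r,z)\,e_r+v_2(r,z)\,e_z,\qquad e_r=(\cos\theta,\sin\theta,0),\ e_z=(0,0,1);$$ $v$ is then called a profile of $u$. Let $g:\overline\Omega\to\overline{\Omega'}$ be an axisymmetric $C^1$-diffeomorphism and $M>0$. Let $H:(0,\infty)\to[0,\infty)$ be convex and $C^1$ with $\lim_{t\to\infty}H(t)/t=\lim_{t\to0^+}H(t)=+\infty$. Assume that there are $s,c_1,c_2,d_0>0$ with $$c_1t^{-s-k}\le(-1)^kH^{(k)}(t)\le c_2t^{-s-k}\quad(k=0,1,\ 0<t<d_0),$$ and $\tau,c_3,c_4,d_1>0$ with $c_3t^{\tau+1}\le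 H'(t)\le c_4t^{\tau+1}$ for $t\ge d_1$. Let $\mathcal A_{nc}^{axi}$ be the set of axisymmetric $u\in W^{1,2}\cap L^\infty(\Omega,\mathbb R^3)$ such that $u=g$ on $\partial\Omega$ in the sense of traces, $\|u\|_\infty\le M$, $\det Du>0$ a.e., $\det Du\in L^1(\Omega)$, $u$ is injective outside a null set, and $\mathcal E(u)=0$, where $$\mathcal E(u)=\sup_f\int_\Omega\langle\operatorname{cof}Du,D_xf(x,u(x))\rangle+\det Du\,\operatorname{div}_yf(x,u(x))\,dx,$$ the supremum being over $f\in C_c^\infty(\Omega\times\mathbb R^3,\mathbb R^3)$ with $\|f\|_\infty\le1$. Let $E(u)=\int_\Omega|Du|^2+H(\det Du)\,dx\in[0,\infty]$. (a) Let $u$ be a minimizer of $E$ in $\mathcal A_{nc}^{axi}$, with $E(u)<\infty$, and let $v$ be a profile of $u$. Then $v\in W^{1,2}(\Omega_0,\mathbb R^2)$ and, with $\delta=\frac{v_1}{r}\det Dv$, $$\frac1r\partial_r\Big(r\big[|\partial_rv|^2-|\partial_zv|^2-\tfrac{v_1^2}{r^2}+H'(\delta)\delta-H(\delta)\big]\Big)+\partial_z(2\,\partial_rv\cdot\partial_zv)=\frac1r\Big[-|Dv|^2+\tfrac{v_1^2}{r^2}+H'(\delta)\delta-H(\delta)\Big],$$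 $$\frac1r\partial_r(2r\,\partial_rv\cdot\partial_zv)+\partial_z\Big[|\partial_zv|^2-|\partial_rv|^2-\tfrac{v_1^2}{r^2}+H'(\delta)\delta-H(\delta)\Big]=0$$ in the sense of distributions in $\Omega_0$, and $$\operatorname{Div}\big(2Du^TDu+[H'(\det Du)\det Du-|Du|^2-H(\det Du)]I\big)=0$$ in the sense of distributions in $\Omega$; the functions to which the derivatives apply, and the right-hand side, are locally integrable. (b) For every $u\in\mathcal A_{nc}^{axi}$ with $E(u)<\infty$ and every profile $v$ of $u$, the two equations for $v$ in $\Omega_0$ hold if and only if the last equation for $u$ holds in $\Omega$. -/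

import Mathlib

open MeasureTheory Filter Topology
open scoped ContDiff

noncomputable section

namespace NeoHookean

/-- `ℝⁿ` with its Euclidean norm and Lebesgue measure. -/
abbrev Eu (n : ℕ) : Type := EuclideanSpace ℝ (Fin n)

/-- The `j`-th vector of the canonical basis of `ℝⁿ`. -/
def basisVec {n : ℕ} (j : Fin n) : Eu n := EuclideanSpace.single j 1

/-- `φ ∈ C_c^∞(U; F)`. -/
def IsTest {E F : Type*} [NormedAddCommGroup E] [NormedSpace ℝ E]
    [NormedAddCommGroup F] [NormedSpace ℝ F] (U : Set E) (φ : E → F) : Prop :=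
  ContDiff ℝ ∞ φ ∧ HasCompactSupport φ ∧ tsupport φ ⊆ U

/-- The partial derivative `∂_j φ (x)` of a (differentiable) scalar function. -/
def pd {n : ℕ} (j : Fin n) (φ : Eu n → ℝ) (x : Eu n) : ℝ := fderiv ℝ φ x (basisVec j)

/-- The classical Jacobian matrix `(∂_j φ_i (x))_{ij}`. -/
def jacobian {m n : ℕ} (φ : Eu m → Eu n) (x : Eu m) : Matrix (Fin n) (Fin m) ℝ :=
  Matrix.of fun i j => fderiv ℝ φ x (basisVec j) i

/-- The squared Frobenius norm `|A|² = tr (Aᵀ A)`. -/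
def frobSq {m n : ℕ} (A : Matrix (Fin n) (Fin m) ℝ) : ℝ := ∑ i, ∑ j, A i j ^ 2

/-- The cofactor matrix, normalized by `Aᵀ * cof A = (det A) I`. -/
def cof {n : ℕ} (A : Matrix (Fin n) (Fin n) ℝ) : Matrix (Fin n) (Fin n) ℝ := A.adjugate.transpose

/-! ### Sobolev spaces -/

/-- `F = (∂_j u_i)_{ij}` is a weak gradient of `u` on the open set `U`. -/
def IsWeakGrad {m n : ℕ} (U : Set (Eu m)) (u : Eu m → Eu n)
    (F : Eu m → Matrix (Fin n) (Fin m) ℝ) : Prop :=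
  (∀ i, LocallyIntegrableOn (fun x => u x i) U) ∧
  (∀ i j, LocallyIntegrableOn (fun x => F x i j) U) ∧
  ∀ i j, ∀ φ : Eu m → ℝ, IsTest U φ →
    ∫ x in U, u x i * pd j φ x = - ∫ x in U, F x i j * φ x

open Classical in
/-- The weak gradient of `u` on `U` (it is unique up to null sets); `0` if there is none. -/
def weakGrad {m n : ℕ} (U : Set (Eu m)) (u : Eu m → Eu n) : Eu m → Matrix (Fin n) (Fin m) ℝ :=
  if h : ∃ F, IsWeakGrad U u F then h.choose else fun _ => 0

theorem weakGrad_spec {m n : ℕ} {U : Set (Eu m)} {u : Eu m → Eu n}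
    (h : ∃ F, IsWeakGrad U u F) : IsWeakGrad U u (weakGrad U u) := by
  unfold weakGrad
  rw [dif_pos h]
  exact h.choose_spec

/-- `u ∈ W^{1,2}(U; ℝⁿ)`. -/
def MemW12 {m n : ℕ} (U : Set (Eu m)) (u : Eu m → Eu n) : Prop :=
  MemLp u 2 (volume.restrict U) ∧
  ∃ F, IsWeakGrad U u F ∧ ∀ i j, MemLp (fun x => F x i j) 2 (volume.restrict U)

/-- `u ∈ W_0^{1,2}(U; ℝⁿ)`, the closure of `C_c^∞(U; ℝⁿ)` in `W^{1,2}(U; ℝⁿ)`. -/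
def MemW120 {m n : ℕ} (U : Set (Eu m)) (u : Eu m → Eu n) : Prop :=
  MemW12 U u ∧ ∃ φ : ℕ → Eu m → Eu n, (∀ k, IsTest U (φ k)) ∧
    Tendsto (fun k => ∫⁻ x in U, ENNReal.ofReal (‖φ k x - u x‖ ^ 2)) atTop (𝓝 0) ∧
    Tendsto (fun k => ∫⁻ x in U, ENNReal.ofReal (frobSq (jacobian (φ k) x - weakGrad U u x)))
      atTop (𝓝 0)

/-! ### Domains and boundary data -/

/-- A bounded domain with smooth boundary: near each boundary point the domain is the
negativity set of a smooth function with non-vanishing differential. -/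
structure IsSmoothBoundedDomain {n : ℕ} (U : Set (Eu n)) : Prop where
  isOpen : IsOpen U
  isConnected : IsConnected U
  isBounded : Bornology.IsBounded U
  smooth_boundary : ∀ x ∈ frontier U, ∃ V : Set (Eu n), IsOpen V ∧ x ∈ V ∧
    ∃ ρ : Eu n → ℝ, ContDiffOn ℝ ∞ ρ V ∧ fderiv ℝ ρ x ≠ 0 ∧
      U ∩ V = {y | ρ y < 0} ∩ V ∧ frontier U ∩ V = {y | ρ y = 0} ∩ V

/-- The rotation of angle `θ` about the `z` axis. -/
def rotZ (θ : ℝ) (x : Eu 3) : Eu 3 :=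
  !₂[Real.cos θ * x 0 - Real.sin θ * x 1, Real.sin θ * x 0 + Real.cos θ * x 1, x 2]

/-- A set that is symmetric about the `z` axis. -/
def IsAxisymmetricSet (U : Set (Eu 3)) : Prop := ∀ θ : ℝ, ∀ x ∈ U, rotZ θ x ∈ U

/-- The distance `r = √(x² + y²)` to the `z` axis. -/
def cylRadius (x : Eu 3) : ℝ := Real.sqrt (x 0 ^ 2 + x 1 ^ 2)

/-- `g` restricts to a `C¹` diffeomorphism from the closure of `U` onto the closure of `U'`. -/
def IsC1DiffeoClosure {n : ℕ} (U U' : Set (Eu n)) (g : Eu n → Eu n) : Prop :=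
  ContDiffOn ℝ 1 g (closure U) ∧ Set.BijOn g (closure U) (closure U') ∧
  ∃ h : Eu n → Eu n, ContDiffOn ℝ 1 h (closure U') ∧ Set.InvOn h g (closure U) (closure U')

/-! ### Axisymmetric maps -/

/-- The meridian section in the coordinates `(r, z)`, `r > 0`. -/
def meridian (Ω : Set (Eu 3)) : Set (Eu 2) := {X | 0 < X 0 ∧ !₂[X 0, 0, X 1] ∈ Ω}

/-- The map `v₁(r, z) e_r + v₂(r, z) e_z` in Cartesian coordinates, where off the axis
`e_r = (x / r, y / r, 0)`. -/
def axiLift (v : Eu 2 → Eu 2) (x : Eu 3) : Eu 3 :=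
  let w : Eu 2 := v !₂[cylRadius x, x 2]
  !₂[w 0 * (x 0 / cylRadius x), w 0 * (x 1 / cylRadius x), w 1]

/-- `u = v₁ e_r + v₂ e_z` (a.e. in `Ω`), with `v₁ ≥ 0` a.e. -/
def IsProfile (Ω : Set (Eu 3)) (u : Eu 3 → Eu 3) (v : Eu 2 → Eu 2) : Prop :=
  (∀ᵐ x ∂(volume.restrict Ω), u x = axiLift v x) ∧
  ∀ᵐ X ∂(volume.restrict (meridian Ω)), 0 ≤ v X 0

/-- `u` is axisymmetric on `Ω`. -/
def IsAxisymmetricMap (Ω : Set (Eu 3)) (u : Eu 3 → Eu 3) : Prop := ∃ v, IsProfile Ω u v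

/-! ### Surface energy, stored energy, admissible classes -/

/-- `∫_Ω ⟨cof Du(x), D_x f(x, u(x))⟩ + det Du(x) div_y f(x, u(x)) dx`. -/
def surfaceFunctional (Ω : Set (Eu 3)) (u : Eu 3 → Eu 3) (f : Eu 3 × Eu 3 → Eu 3) : ℝ :=
  ∫ x in Ω,
    ((∑ i, ∑ j, cof (weakGrad Ω u x) i j * fderiv ℝ f (x, u x) (basisVec j, 0) i) +
      (weakGrad Ω u x).det * ∑ i, fderiv ℝ f (x, u x) (0, basisVec i) i)

/-- The surface energy: the supremum of the surface functional over the fields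
`f ∈ C_c^∞(Ω × ℝ³; ℝ³)` with `‖f‖_∞ ≤ 1`. -/
def surfaceEnergy (Ω : Set (Eu 3)) (u : Eu 3 → Eu 3) : EReal :=
  ⨆ f : {f : Eu 3 × Eu 3 → Eu 3 // IsTest (Ω ×ˢ Set.univ) f ∧ ∀ p, ‖f p‖ ≤ 1},
    (surfaceFunctional Ω u f.1 : EReal)

/-- The neo-Hookean energy `E(u) = ∫_Ω |Du|² + H(det Du)`, with values in `[0, ∞]`. -/
def energy (H : ℝ → ℝ) (Ω : Set (Eu 3)) (u : Eu 3 → Eu 3) : ENNReal :=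
  ∫⁻ x in Ω, ENNReal.ofReal (frobSq (weakGrad Ω u x) + H (weakGrad Ω u x).det)

/-- `u` is one-to-one a.e. in `U`: it is injective on the complement of a null set. -/
def InjectiveAE {n : ℕ} (U : Set (Eu n)) (u : Eu n → Eu n) : Prop :=
  ∃ N : Set (Eu n), volume N = 0 ∧ Set.InjOn u (U \ N)

/-- The class `𝒜`. On a smooth bounded domain, equality of the traces of `u` and `g` on the
boundary is membership of `u - g` in `W_0^{1,2}`. -/
structure Admissible (Ω : Set (Eu 3)) (g : Eu 3 → Eu 3) (M : ℝ) (u : Eu 3 → Eu 3) : Prop where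
  memW12 : MemW12 Ω u
  trace_eq : MemW120 Ω (fun x => u x - g x)
  bound : ∀ᵐ x ∂(volume.restrict Ω), ‖u x‖ ≤ M
  det_pos : ∀ᵐ x ∂(volume.restrict Ω), 0 < (weakGrad Ω u x).det
  injective : InjectiveAE Ω u

/-- The class `𝒜_nc^axi` of axisymmetric admissible maps without surface energy; the surface
energy is defined for maps with `det Du ∈ L¹(Ω)`. -/
structure AdmissibleNcAxi (Ω : Set (Eu 3)) (g : Eu 3 → Eu 3) (M : ℝ) (u : Eu 3 → Eu 3) : Prop
    extends Admissible Ω g M u where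
  det_integrable : IntegrableOn (fun x => (weakGrad Ω u x).det) Ω
  surfaceEnergy_eq_zero : surfaceEnergy Ω u = 0
  axisymmetric : IsAxisymmetricMap Ω u

/-- `u` minimizes `E` in `𝒜_nc^axi` (and the minimum is finite). -/
structure IsMinimizer (H : ℝ → ℝ) (Ω : Set (Eu 3)) (g : Eu 3 → Eu 3) (M : ℝ)
    (u : Eu 3 → Eu 3) : Prop where
  mem : AdmissibleNcAxi Ω g M u
  energy_lt_top : energy H Ω u < ⊤
  le : ∀ w, AdmissibleNcAxi Ω g M w → energy H Ω u ≤ energy H Ω w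

/-- The hypotheses on `H` on `(0, ∞)`: nonnegative, convex, `C¹`, superlinear at `∞`, infinite
limit at `0`, and power growth of `H` and `H'` near `0` and of `H'` near `∞`. -/
structure IsStoredEnergy (H : ℝ → ℝ) : Prop where
  nonneg : ∀ t, 0 < t → 0 ≤ H t
  convex : ConvexOn ℝ (Set.Ioi 0) H
  contDiffOn : ContDiffOn ℝ 1 H (Set.Ioi 0)
  superlinear : Tendsto (fun t => H t / t) atTop atTop
  blowup : Tendsto H (𝓝[>] 0) atTop
  growth_zero : ∃ s c₁ c₂ d₀ : ℝ, 0 < s ∧ 0 < c₁ ∧ 0 < c₂ ∧ 0 < d₀ ∧ ∀ t, 0 < t → t < d₀ →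
    (c₁ * t ^ (-s) ≤ H t ∧ H t ≤ c₂ * t ^ (-s)) ∧
    (c₁ * t ^ (-s - 1) ≤ -deriv H t ∧ -deriv H t ≤ c₂ * t ^ (-s - 1))
  growth_infty : ∃ τ c₃ c₄ d₁ : ℝ, 0 < τ ∧ 0 < c₃ ∧ 0 < c₄ ∧ 0 < d₁ ∧ ∀ t, d₁ ≤ t →
    c₃ * t ^ (τ + 1) ≤ deriv H t ∧ deriv H t ≤ c₄ * t ^ (τ + 1)

/-! ### The equations -/

/-- The energy-momentum tensor `2 Duᵀ Du + [H'(det Du) det Du - |Du|² - H(det Du)] I`. -/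
def energyMomentum (H : ℝ → ℝ) (Ω : Set (Eu 3)) (u : Eu 3 → Eu 3) (x : Eu 3) :
    Matrix (Fin 3) (Fin 3) ℝ :=
  let F := weakGrad Ω u x
  (2 : ℝ) • (F.transpose * F) +
    (deriv H F.det * F.det - frobSq F - H F.det) • (1 : Matrix (Fin 3) (Fin 3) ℝ)

/-- `Div T = 0` in the sense of distributions in `U`, for a locally integrable matrix field:
`∑_j ∂_j T_{ij} = 0` for each `i`. -/
def DistribDivFree {n : ℕ} (U : Set (Eu n)) (T : Eu n → Matrix (Fin n) (Fin n) ℝ) : Prop :=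
  (∀ i j, LocallyIntegrableOn (fun x => T x i j) U) ∧
  ∀ i, ∀ φ : Eu n → ℝ, IsTest U φ → -∑ j, ∫ x in U, T x i j * pd j φ x = 0

section Reduced

variable (H : ℝ → ℝ) (Ω : Set (Eu 3)) (v : Eu 2 → Eu 2) (X : Eu 2)

/-- `|∂_r v|²`. -/
def drSq : ℝ := ∑ i, weakGrad (meridian Ω) v X i 0 ^ 2

/-- `|∂_z v|²`. -/
def dzSq : ℝ := ∑ i, weakGrad (meridian Ω) v X i 1 ^ 2

/-- `∂_r v · ∂_z v`. -/
def drDotDz : ℝ := ∑ i, weakGrad (meridian Ω) v X i 0 * weakGrad (meridian Ω) v X i 1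

/-- `(v₁ / r) det Dv`. -/
def redDet : ℝ := v X 0 / X 0 * (weakGrad (meridian Ω) v X).det

/-- `H'(δ) δ - H(δ)` with `δ = (v₁ / r) det Dv`. -/
def redPressure : ℝ := deriv H (redDet Ω v X) * redDet Ω v X - H (redDet Ω v X)

/-- `|∂_r v|² - |∂_z v|² - v₁² / r² + H'(δ) δ - H(δ)`. -/
def coeffRR : ℝ := drSq Ω v X - dzSq Ω v X - v X 0 ^ 2 / X 0 ^ 2 + redPressure H Ω v X

/-- `|∂_z v|² - |∂_r v|² - v₁² / r² + H'(δ) δ - H(δ)`. -/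
def coeffZZ : ℝ := dzSq Ω v X - drSq Ω v X - v X 0 ^ 2 / X 0 ^ 2 + redPressure H Ω v X

/-- `-|Dv|² + v₁² / r² + H'(δ) δ - H(δ)`. -/
def coeffTT : ℝ := -(drSq Ω v X + dzSq Ω v X) + v X 0 ^ 2 / X 0 ^ 2 + redPressure H Ω v X

end Reduced

/-- For `A, B, C` locally integrable in an open subset `U` of the half-plane `{r > 0}`,
`(1 / r) ∂_r (r A) + ∂_z B = (1 / r) C` in the sense of distributions in `U`. -/
def DistribEq (U : Set (Eu 2)) (A B C : Eu 2 → ℝ) : Prop :=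
  LocallyIntegrableOn A U ∧ LocallyIntegrableOn B U ∧ LocallyIntegrableOn C U ∧
  ∀ ψ : Eu 2 → ℝ, IsTest U ψ →
    -(∫ X in U, (X 0 * A X) * pd 0 (fun Y => 1 / Y 0 * ψ Y) X) - ∫ X in U, B X * pd 1 ψ X =
      ∫ X in U, 1 / X 0 * C X * ψ X

/-- The two equations for the profile `v` in the variables `(r, z)`. -/
def ReducedEquations (H : ℝ → ℝ) (Ω : Set (Eu 3)) (v : Eu 2 → Eu 2) : Prop :=
  DistribEq (meridian Ω) (coeffRR H Ω v) (fun X => 2 * drDotDz Ω v X) (coeffTT H Ω v) ∧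
  DistribEq (meridian Ω) (fun X => 2 * drDotDz Ω v X) (coeffZZ H Ω v) (fun _ => 0)

end NeoHookean

end

open NeoHookean

/-!
A test field `ξ` on the meridian domain lifts to an axisymmetric test field `X` on `Ω`, and
`ψ_t := id + t X` is, for small `t`, a diffeomorphism of `Ω` whose inverse keeps the competitor
`u ∘ ψ_t⁻¹` axisymmetric, injective and without surface energy: the supremum defining `ℰ` is
invariant under substituting `ψ_t` in the test functions. Hence a minimizer is stationary under
these inner variations. The derivative of the energy at `t = 0` is minus the pairing of the
energy-momentum tensor with `DX`; it may be taken under the integral because the power growth of `H`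
gives `|H'(t)| t ≤ K (H(t) + 1)`, so that, by Gronwall's inequality, `H (a)` and `H'(a) a` are
controlled by `1 + H (t)` for `a` comparable to `t`.

The energy-momentum tensor of an axisymmetric `u` is block diagonal in the frame `e_r, e_θ, e_z`,
with a meridian block and an azimuthal entry that depend only on `(r, z)`. Cylindrical coordinates
therefore turn the pairing with `DX` into the weak form of the two equations for the profile, tested
with `ξ`. Conversely, testing `Div T = 0` with an arbitrary field amounts to testing with its
average over the rotations about the axis, and the azimuthal component of that average pairs to zero
with `T`; so stationarity along axisymmetric fields already implies `Div T = 0`.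
-/

noncomputable section

namespace NeoHookean

/-! ### Test functions and weak gradients -/

section TestFunctions

variable {E F : Type*} [NormedAddCommGroup E] [NormedSpace ℝ E]
  [NormedAddCommGroup F] [NormedSpace ℝ F] {U : Set E}

theorem IsTest.differentiable {φ : E → F} (h : IsTest U φ) : Differentiable ℝ φ :=
  h.1.differentiable (by simp)

theorem IsTest.smul_contDiffAt {φ : E → F} {p : E → ℝ} (h : IsTest U φ)
    (hp : ∀ x ∈ U, ContDiffAt ℝ ∞ p x) : IsTest U (fun x => p x • φ x) := by
  have hsub : tsupport (fun x => p x • φ x) ⊆ tsupport φ := tsupport_smul_subset_right p φ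
  refine ⟨contDiff_iff_contDiffAt.2 fun x => ?_, h.2.1.smul_left, hsub.trans h.2.2⟩
  by_cases hx : x ∈ tsupport φ
  · exact (hp x (h.2.2 hx)).smul h.1.contDiffAt
  · exact contDiffAt_const.congr_of_eventuallyEq
      (notMem_tsupport_iff_eventuallyEq.1 fun hx' => hx (hsub hx'))

theorem IsTest.add {φ ψ : E → F} (h : IsTest U φ) (hψ : IsTest U ψ) :
    IsTest U (fun x => φ x + ψ x) :=
  ⟨h.1.add hψ.1, h.2.1.add hψ.2.1, (tsupport_add φ ψ).trans (Set.union_subset h.2.2 hψ.2.2)⟩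

theorem IsTest.fderiv_apply {φ : E → F} (h : IsTest U φ) (w : E) :
    IsTest U (fun x => fderiv ℝ φ x w) :=
  ⟨(h.1.fderiv_right (m := ∞) (by simp)).clm_apply contDiff_const, h.2.1.fderiv_apply ℝ w,
    (tsupport_fderiv_apply_subset ℝ w).trans h.2.2⟩

theorem IsTest.clm_comp {G : Type*} [NormedAddCommGroup G] [NormedSpace ℝ G] {φ : E → F}
    (h : IsTest U φ) (L : F →L[ℝ] G) : IsTest U (fun x => L (φ x)) :=
  ⟨L.contDiff.comp h.1, h.2.1.comp_left L.map_zero,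
    (closure_mono (Function.support_comp_subset L.map_zero φ)).trans h.2.2⟩

theorem IsTest.eq_zero_of_notMem {φ : E → F} (h : IsTest U φ) {x : E} (hx : x ∉ U) : φ x = 0 :=
  image_eq_zero_of_notMem_tsupport fun hx' => hx (h.2.2 hx')

theorem IsTest.exists_norm_le {φ : E → F} (h : IsTest U φ) : ∃ C, ∀ x, ‖φ x‖ ≤ C :=
  h.2.1.exists_bound_of_continuous h.1.continuous

theorem IsTest.coord {n : ℕ} {φ : E → Eu n} (h : IsTest U φ) (i : Fin n) :
    IsTest U (fun x => φ x i) :=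
  h.clm_comp (EuclideanSpace.proj i)

theorem fderiv_coord {n : ℕ} {φ : E → Eu n} {x : E} (h : DifferentiableAt ℝ φ x) (i : Fin n)
    (w : E) : fderiv ℝ (fun y => φ y i) x w = fderiv ℝ φ x w i := by
  have hcomp := (EuclideanSpace.proj (𝕜 := ℝ) i).hasFDerivAt.comp x h.hasFDerivAt
  exact DFunLike.congr_fun hcomp.fderiv w

theorem integrable_mul_isTest [MeasurableSpace E] [BorelSpace E]
    {μ : Measure E} {f φ : E → ℝ} (hf : LocallyIntegrableOn f U μ) (hφ : IsTest U φ) :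
    Integrable (fun x => f x * φ x) (μ.restrict U) := by
  have hK : IsCompact (tsupport φ) := hφ.2.1
  have hint : IntegrableOn (fun x => f x * φ x) (tsupport φ) μ :=
    (hf.integrableOn_compact_subset hφ.2.2 hK).mul_continuousOn hφ.1.continuous.continuousOn hK
  refine ((integrableOn_iff_integrable_of_support_subset fun x hx => ?_).1 hint).integrableOn
  exact subset_tsupport _ (right_ne_zero_of_mul hx)

end TestFunctions

theorem IsTest.partialDeriv {n : ℕ} {U : Set (Eu n)} {φ : Eu n → ℝ} (h : IsTest U φ)
    (j : Fin n) : IsTest U (pd j φ) :=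
  h.fderiv_apply _

section WeakGrad

variable {m n : ℕ} {U : Set (Eu m)} {u w : Eu m → Eu n} {F G : Eu m → Matrix (Fin n) (Fin m) ℝ}

theorem ae_eq_of_integral_mul_isTest_eq (hU : IsOpen U) {f g : Eu m → ℝ}
    (hf : LocallyIntegrableOn f U) (hg : LocallyIntegrableOn g U)
    (h : ∀ φ : Eu m → ℝ, IsTest U φ → ∫ x in U, f x * φ x = ∫ x in U, g x * φ x) :
    ∀ᵐ x ∂(volume.restrict U), f x = g x := by
  have hzero : ∀ᵐ x ∂volume, x ∈ U → f x - g x = 0 := by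
    refine hU.ae_eq_zero_of_integral_contDiff_smul_eq_zero (hf.sub hg) fun φ hc hs hsub => ?_
    have hφ : IsTest U φ := ⟨hc, hs, hsub⟩
    calc ∫ x, φ x • (f x - g x) = ∫ x in U, φ x • (f x - g x) := by
          refine (setIntegral_eq_integral_of_forall_compl_eq_zero fun x hx => ?_).symm
          rw [hφ.eq_zero_of_notMem hx, zero_smul]
      _ = ∫ x in U, (f x * φ x - g x * φ x) :=
          integral_congr_ae <| .of_forall fun x => by simp only [smul_eq_mul]; ring
      _ = 0 := by
          rw [integral_sub (integrable_mul_isTest hf hφ)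
            (integrable_mul_isTest hg hφ), h φ hφ, sub_self]
  rw [ae_restrict_iff' hU.measurableSet]
  filter_upwards [hzero] with x hx hxU using sub_eq_zero.1 (hx hxU)

/-- `g = ∂_j f` weakly on the open set `U`; `IsWeakGrad` is this condition on all entries. -/
def HasWeakPd (U : Set (Eu m)) (j : Fin m) (f g : Eu m → ℝ) : Prop :=
  LocallyIntegrableOn f U ∧ LocallyIntegrableOn g U ∧
    ∀ φ : Eu m → ℝ, IsTest U φ → ∫ x in U, f x * pd j φ x = -∫ x in U, g x * φ x

section HasWeakPd

variable {j : Fin m} {f f' g g' : Eu m → ℝ}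

theorem HasWeakPd.integral_eq_zero (h : HasWeakPd U j f g) {φ : Eu m → ℝ} (hφ : IsTest U φ) :
    ∫ x in U, (f x * pd j φ x + g x * φ x) = 0 := by
  rw [integral_add (integrable_mul_isTest h.1 (hφ.partialDeriv j))
    (integrable_mul_isTest h.2.1 hφ), h.2.2 φ hφ, neg_add_cancel]

theorem hasWeakPd_of_integral_eq_zero (hf : LocallyIntegrableOn f U)
    (hg : LocallyIntegrableOn g U)
    (h : ∀ φ : Eu m → ℝ, IsTest U φ → ∫ x in U, (f x * pd j φ x + g x * φ x) = 0) :
    HasWeakPd U j f g := by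
  refine ⟨hf, hg, fun φ hφ => eq_neg_of_add_eq_zero_left ?_⟩
  rw [← h φ hφ, integral_add (integrable_mul_isTest hf (hφ.partialDeriv j))
    (integrable_mul_isTest hg hφ)]

theorem HasWeakPd.ae_eq (hU : IsOpen U) (h : HasWeakPd U j f g) (h' : HasWeakPd U j f g') :
    ∀ᵐ x ∂(volume.restrict U), g x = g' x :=
  ae_eq_of_integral_mul_isTest_eq hU h.2.1 h'.2.1 fun φ hφ =>
    neg_injective ((h.2.2 φ hφ).symm.trans (h'.2.2 φ hφ))

theorem HasWeakPd.congr_ae (h : HasWeakPd U j f g) (hf : f =ᵐ[volume.restrict U] f')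
    (hg : g =ᵐ[volume.restrict U] g') : HasWeakPd U j f' g' := by
  refine ⟨h.1.congr hf, h.2.1.congr hg, fun φ hφ => ?_⟩
  calc ∫ x in U, f' x * pd j φ x = ∫ x in U, f x * pd j φ x :=
        integral_congr_ae <| hf.mono fun x hx => by simp only [hx]
    _ = -∫ x in U, g x * φ x := h.2.2 φ hφ
    _ = -∫ x in U, g' x * φ x :=
        congrArg Neg.neg <| integral_congr_ae <| hg.mono fun x hx => by simp only [hx]

theorem hasWeakPd_zero : HasWeakPd U j (fun _ => 0) (fun _ => 0) :=
  ⟨locallyIntegrableOn_zero, locallyIntegrableOn_zero, fun φ _ => by simp⟩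

theorem HasWeakPd.add (h : HasWeakPd U j f g) (h' : HasWeakPd U j f' g') :
    HasWeakPd U j (fun x => f x + f' x) (fun x => g x + g' x) := by
  refine hasWeakPd_of_integral_eq_zero (h.1.add h'.1) (h.2.1.add h'.2.1) fun φ hφ => ?_
  have hint {a b : Eu m → ℝ} (hab : HasWeakPd U j a b) :
      Integrable (fun x => a x * pd j φ x + b x * φ x) (volume.restrict U) :=
    (integrable_mul_isTest hab.1 (hφ.partialDeriv j)).add (integrable_mul_isTest hab.2.1 hφ)
  rw [← add_zero (0 : ℝ)]
  nth_rw 1 [← h.integral_eq_zero hφ]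
  rw [← h'.integral_eq_zero hφ, ← integral_add (hint h) (hint h')]
  exact integral_congr_ae <| .of_forall fun x => by simp only []; ring

theorem HasWeakPd.sum {ι : Type*} {s : Finset ι} {f g : ι → Eu m → ℝ}
    (h : ∀ i ∈ s, HasWeakPd U j (f i) (g i)) :
    HasWeakPd U j (fun x => ∑ i ∈ s, f i x) (fun x => ∑ i ∈ s, g i x) := by
  classical
  induction s using Finset.induction_on with
  | empty => simpa only [Finset.sum_empty] using hasWeakPd_zero
  | insert a s ha ih =>
    simp only [Finset.sum_insert ha]
    exact (h a (Finset.mem_insert_self a s)).add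
      (ih fun i hi => h i (Finset.mem_insert_of_mem hi))

theorem pd_mul {p φ : Eu m → ℝ} {x : Eu m} (hp : DifferentiableAt ℝ p x)
    (hφ : DifferentiableAt ℝ φ x) (j : Fin m) :
    pd j (fun y => p y * φ y) x = p x * pd j φ x + pd j p x * φ x := by
  simp only [pd, fderiv_fun_mul hp hφ, add_apply, smul_apply, smul_eq_mul]
  ring

theorem HasWeakPd.contDiffAt_mul (hU : IsOpen U) (h : HasWeakPd U j f g) {p : Eu m → ℝ}
    (hp : ∀ x ∈ U, ContDiffAt ℝ ∞ p x) :
    HasWeakPd U j (fun x => p x * f x) (fun x => p x * g x + pd j p x * f x) := by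
  have hpc : ContinuousOn p U := fun x hx => (hp x hx).continuousAt.continuousWithinAt
  have hdc : ContinuousOn (pd j p) U := fun x hx =>
    (((hp x hx).fderiv_right (m := 0) (by simp)).clm_apply
      contDiffAt_const).continuousAt.continuousWithinAt
  have hmul {a b : Eu m → ℝ} (ha : ContinuousOn a U) (hb : LocallyIntegrableOn b U) :
      LocallyIntegrableOn (fun x => a x * b x) U := hb.continuousOn_mul ha hU.isLocallyClosed
  refine hasWeakPd_of_integral_eq_zero (hmul hpc h.1) ((hmul hpc h.2.1).add (hmul hdc h.1))
    fun φ hφ => ?_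
  rw [← h.integral_eq_zero (hφ.smul_contDiffAt hp)]
  refine setIntegral_congr_fun hU.measurableSet fun x hx => ?_
  simp only [smul_eq_mul,
    pd_mul ((hp x hx).differentiableAt (by simp)) (hφ.differentiable x)]
  ring

theorem hasWeakPd_pd (hf : ContDiff ℝ 1 f) : HasWeakPd U j f (pd j f) := by
  have hd : Continuous (pd j f) := (hf.continuous_fderiv one_ne_zero).clm_apply continuous_const
  have hloc {a : Eu m → ℝ} (ha : Continuous a) : LocallyIntegrableOn a U :=
    (ha.locallyIntegrable (μ := volume)).locallyIntegrableOn U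
  have hint {a φ : Eu m → ℝ} (ha : Continuous a) (hφ : IsTest U φ) :
      Integrable (fun x => a x * φ x) volume :=
    (ha.mul hφ.1.continuous).integrable_of_hasCompactSupport hφ.2.1.mul_left
  have hset {a φ : Eu m → ℝ} (hφ : IsTest U φ) : ∫ x in U, a x * φ x = ∫ x, a x * φ x :=
    setIntegral_eq_integral_of_forall_compl_eq_zero fun x hx => by
      rw [hφ.eq_zero_of_notMem hx, mul_zero]
  refine ⟨hloc hf.continuous, hloc hd, fun φ hφ => ?_⟩
  rw [hset (hφ.partialDeriv j), hset hφ]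
  exact integral_mul_fderiv_eq_neg_fderiv_mul_of_integrable (hint hd hφ)
    (hint hf.continuous (hφ.partialDeriv j)) (hint hf.continuous hφ)
    (fun x _ => hf.differentiable one_ne_zero x) fun x _ => hφ.differentiable x

end HasWeakPd

theorem IsWeakGrad.hasWeakPd (h : IsWeakGrad U u F) (i : Fin n) (j : Fin m) :
    HasWeakPd U j (fun x => u x i) (fun x => F x i j) :=
  ⟨h.1 i, h.2.1 i j, h.2.2 i j⟩

theorem isWeakGrad_of_hasWeakPd (hu : ∀ i, LocallyIntegrableOn (fun x => u x i) U)
    (h : ∀ i j, HasWeakPd U j (fun x => u x i) (fun x => F x i j)) : IsWeakGrad U u F :=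
  ⟨hu, fun i j => (h i j).2.1, fun i j => (h i j).2.2⟩

theorem IsWeakGrad.ae_eq (hU : IsOpen U) (hF : IsWeakGrad U u F) (hG : IsWeakGrad U u G) :
    ∀ᵐ x ∂(volume.restrict U), F x = G x := by
  have hentry : ∀ᵐ x ∂(volume.restrict U), ∀ i j, F x i j = G x i j :=
    ae_all_iff.2 fun i => ae_all_iff.2 fun j => (hF.hasWeakPd i j).ae_eq hU (hG.hasWeakPd i j)
  exact hentry.mono fun x hx => Matrix.ext hx

theorem IsWeakGrad.weakGrad_ae_eq (hU : IsOpen U) (hF : IsWeakGrad U u F) :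
    ∀ᵐ x ∂(volume.restrict U), weakGrad U u x = F x :=
  (weakGrad_spec ⟨F, hF⟩).ae_eq hU hF

theorem IsWeakGrad.congr_ae (hF : IsWeakGrad U u F)
    (h : ∀ᵐ x ∂(volume.restrict U), u x = w x) : IsWeakGrad U w F :=
  isWeakGrad_of_hasWeakPd (fun i => (hF.1 i).congr (h.mono fun x hx => by rw [hx])) fun i j =>
    (hF.hasWeakPd i j).congr_ae (h.mono fun x hx => by simp only [hx]) (ae_eq_refl _)

theorem IsWeakGrad.add (hF : IsWeakGrad U u F) (hG : IsWeakGrad U w G) :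
    IsWeakGrad U (fun x => u x + w x) (fun x => F x + G x) :=
  isWeakGrad_of_hasWeakPd (fun i => (hF.1 i).add (hG.1 i)) fun i j =>
    (hF.hasWeakPd i j).add (hG.hasWeakPd i j)

theorem MemW12.isWeakGrad (h : MemW12 U u) : IsWeakGrad U u (weakGrad U u) :=
  weakGrad_spec (h.2.imp fun _ hF => hF.1)

theorem MemW12.memLp_weakGrad (hU : IsOpen U) (h : MemW12 U u) (i : Fin n) (j : Fin m) :
    MemLp (fun x => weakGrad U u x i j) 2 (volume.restrict U) := by
  obtain ⟨-, F, hF, hF2⟩ := h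
  exact (hF2 i j).ae_eq ((hF.weakGrad_ae_eq hU).mono fun x hx => by simp only [hx])

theorem MemW12.add (hu : MemW12 U u) (hw : MemW12 U w) :
    MemW12 U (fun x => u x + w x) := by
  obtain ⟨hu2, F, hF, hF2⟩ := hu
  obtain ⟨hw2, G, hG, hG2⟩ := hw
  exact ⟨hu2.add hw2, _, hF.add hG, fun i j => (hF2 i j).add (hG2 i j)⟩

end WeakGrad

theorem frobSq_nonneg {m n : ℕ} (A : Matrix (Fin n) (Fin m) ℝ) : 0 ≤ frobSq A :=
  Finset.sum_nonneg fun _ _ => Finset.sum_nonneg fun _ _ => sq_nonneg _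

/-! ### Cylindrical coordinates -/

/-- The point of `ℝ³` with cylindrical coordinates `(r, θ, z)`, where `X = (r, z)`. -/
def cyl (X : Eu 2) (θ : ℝ) : Eu 3 := !₂[X 0 * Real.cos θ, X 0 * Real.sin θ, X 1]

/-- The coordinates `(r, z)` of a point of `ℝ³`. -/
def cylProj (x : Eu 3) : Eu 2 := !₂[cylRadius x, x 2]

@[simp] theorem cyl_zero (X : Eu 2) (θ : ℝ) : cyl X θ 0 = X 0 * Real.cos θ := rfl
@[simp] theorem cyl_one (X : Eu 2) (θ : ℝ) : cyl X θ 1 = X 0 * Real.sin θ := rfl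
@[simp] theorem cyl_two (X : Eu 2) (θ : ℝ) : cyl X θ 2 = X 1 := rfl
@[simp] theorem cylProj_zero (x : Eu 3) : cylProj x 0 = cylRadius x := rfl

theorem cylRadius_cyl {X : Eu 2} (h : 0 ≤ X 0) (θ : ℝ) : cylRadius (cyl X θ) = X 0 := by
  rw [cylRadius, cyl_zero, cyl_one, show (X 0 * Real.cos θ) ^ 2 + (X 0 * Real.sin θ) ^ 2 =
    X 0 ^ 2 by linear_combination X 0 ^ 2 * Real.cos_sq_add_sin_sq θ, Real.sqrt_sq h]

theorem cylProj_cyl {X : Eu 2} (h : 0 ≤ X 0) (θ : ℝ) : cylProj (cyl X θ) = X := by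
  ext i
  fin_cases i
  · exact cylRadius_cyl h θ
  · rfl

theorem exists_eq_cyl (x : Eu 3) : ∃ θ, x = cyl (cylProj x) θ := by
  have hnorm : ‖(⟨x 0, x 1⟩ : ℂ)‖ = cylRadius x := by
    rw [Complex.norm_def, Complex.normSq_mk, cylRadius, sq, sq]
  refine ⟨Complex.arg ⟨x 0, x 1⟩, ?_⟩
  ext i
  fin_cases i
  · simpa [hnorm] using (Complex.norm_mul_cos_arg ⟨x 0, x 1⟩).symm
  · simpa [hnorm] using (Complex.norm_mul_sin_arg ⟨x 0, x 1⟩).symm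
  · rfl

theorem rotZ_cyl (X : Eu 2) (θ η : ℝ) : rotZ η (cyl X θ) = cyl X (η + θ) := by
  ext i
  fin_cases i <;> simp [rotZ, Real.cos_add, Real.sin_add] <;> ring

theorem cyl_angle_zero (X : Eu 2) : cyl X 0 = !₂[X 0, 0, X 1] := by
  ext i
  fin_cases i <;> simp

theorem norm_cyl_angle_zero (X : Eu 2) : ‖cyl X 0‖ = ‖X‖ := by
  simp [EuclideanSpace.norm_eq, Fin.sum_univ_succ]

theorem cyl_mem_iff {Ω : Set (Eu 3)} (hΩ : IsAxisymmetricSet Ω) {X : Eu 2} (hX : 0 < X 0)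
    (θ : ℝ) : cyl X θ ∈ Ω ↔ X ∈ meridian Ω := by
  rw [meridian, Set.mem_ofPred_eq, ← cyl_angle_zero, and_iff_right hX]
  constructor <;> intro h
  · simpa only [rotZ_cyl, neg_add_cancel] using hΩ (-θ) _ h
  · simpa only [rotZ_cyl, add_zero] using hΩ θ _ h

theorem continuous_cylRadius : Continuous cylRadius := by
  unfold cylRadius
  fun_prop

theorem continuous_cylProj : Continuous cylProj := by
  refine (PiLp.continuous_toLp 2 _).comp (continuous_pi fun i => ?_)
  fin_cases i
  · exact continuous_cylRadius
  · exact (by fun_prop : Continuous fun x : Eu 3 => x 2)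

theorem contDiff_cyl : ContDiff ℝ ∞ (fun p : Eu 2 × ℝ => cyl p.1 p.2) := by
  have hcoord (k : Fin 2) : ContDiff ℝ ∞ (fun p : Eu 2 × ℝ => p.1 k) :=
    contDiff_euclidean.1 contDiff_fst k
  refine contDiff_euclidean.2 fun i => ?_
  fin_cases i
  · exact (hcoord 0).mul (Real.contDiff_cos.comp contDiff_snd)
  · exact (hcoord 0).mul (Real.contDiff_sin.comp contDiff_snd)
  · exact hcoord 1

theorem contDiff_cyl_left (θ : ℝ) : ContDiff ℝ ∞ fun X : Eu 2 => cyl X θ :=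
  contDiff_cyl.comp (contDiff_id.prodMk contDiff_const)

theorem measurable_cyl : Measurable (fun p : Eu 2 × ℝ => cyl p.1 p.2) :=
  contDiff_cyl.continuous.measurable

theorem isOpen_meridian {Ω : Set (Eu 3)} (hΩ : IsOpen Ω) : IsOpen (meridian Ω) := by
  have hpos : IsOpen {X : Eu 2 | 0 < X 0} := isOpen_lt continuous_const (by fun_prop)
  simp only [meridian, ← cyl_angle_zero]
  exact hpos.inter (hΩ.preimage (contDiff_cyl_left 0).continuous)

/-- Lebesgue measure on the interval of angles `(-π, π)`. -/
def angleMeasure : Measure ℝ := volume.restrict (Set.Ioo (-Real.pi) Real.pi)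

instance : IsFiniteMeasure angleMeasure := ⟨by simp [angleMeasure]⟩

theorem angleMeasure_real_univ : angleMeasure.real Set.univ = 2 * Real.pi := by
  simp only [angleMeasure, measureReal_restrict_apply_univ, Real.volume_real_Ioo_of_le
    (neg_le_self Real.pi_pos.le)]
  ring

theorem angleMeasure_ne_zero : angleMeasure ≠ 0 := fun h => by
  simpa [h, Real.pi_ne_zero] using angleMeasure_real_univ

theorem measurePreserving_prod_eu2 :
    MeasurePreserving (fun p : ℝ × ℝ => (!₂[p.1, p.2] : Eu 2)) := by
  have h := (PiLp.volume_preserving_toLp (Fin 2)).comp (volume_preserving_finTwoArrow ℝ).symm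
  refine (congrArg (fun f => MeasurePreserving f volume volume) ?_).mp h
  ext p i
  fin_cases i <;> rfl

theorem measurePreserving_prod_eu3 :
    MeasurePreserving (fun p : ℝ × ℝ × ℝ => (!₂[p.2.1, p.2.2, p.1] : Eu 3)) := by
  have hpair : MeasurePreserving (Prod.map id (MeasurableEquiv.finTwoArrow (α := ℝ)).symm)
      (volume : Measure (ℝ × ℝ × ℝ)) (volume : Measure (ℝ × (Fin 2 → ℝ))) :=
    (MeasurePreserving.id _).prod (volume_preserving_finTwoArrow ℝ).symm
  have h := ((PiLp.volume_preserving_toLp (Fin 3)).comp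
    (volume_preserving_piFinSuccAbove (fun _ : Fin 3 => ℝ) 2).symm).comp hpair
  refine (congrArg (fun f => MeasurePreserving f volume volume) ?_).mp h
  ext p i
  fin_cases i <;> rfl

theorem lintegral_polar {f : ℝ × ℝ → ENNReal} (hf : Measurable f) :
    ∫⁻ q, f q = ∫⁻ r in Set.Ioi (0 : ℝ),
      ∫⁻ θ, ENNReal.ofReal r * f (r * Real.cos θ, r * Real.sin θ) ∂angleMeasure := by
  rw [← lintegral_comp_polarCoord_symm, polarCoord_target, Measure.volume_eq_prod,
    ← Measure.prod_restrict, lintegral_prod]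
  · simp only [polarCoord_symm_apply, smul_eq_mul, angleMeasure]
  · exact (Measurable.mul (by fun_prop)
      (hf.comp continuous_polarCoord_symm.measurable)).aemeasurable

theorem setLIntegral_eu2 {g : Eu 2 → ENNReal} (hg : Measurable g) :
    ∫⁻ X in {X | 0 < X 0}, g X = ∫⁻ z : ℝ, ∫⁻ r in Set.Ioi (0 : ℝ), g !₂[r, z] := by
  have hpre : (fun p : ℝ × ℝ => (!₂[p.1, p.2] : Eu 2)) ⁻¹' {X | 0 < X 0} =
      Set.Ioi (0 : ℝ) ×ˢ Set.univ := by
    ext p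
    simp
  rw [← measurePreserving_prod_eu2.setLIntegral_comp_preimage
      (measurableSet_lt measurable_const (by fun_prop)) hg, hpre, Measure.volume_eq_prod,
    ← Measure.prod_restrict, Measure.restrict_univ, lintegral_prod_symm]
  exact (hg.comp measurePreserving_prod_eu2.measurable).aemeasurable

theorem lintegral_eu3 {f : Eu 3 → ENNReal} (hf : Measurable f) :
    ∫⁻ x, f x = ∫⁻ z : ℝ, ∫⁻ q : ℝ × ℝ, f !₂[q.1, q.2, z] := by
  rw [← measurePreserving_prod_eu3.lintegral_comp hf]
  exact lintegral_prod _ (hf.comp measurePreserving_prod_eu3.measurable).aemeasurable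

theorem lintegral_cyl {f : Eu 3 → ENNReal} (hf : Measurable f) :
    ∫⁻ X : Eu 2 in {X | 0 < X 0}, ∫⁻ θ, ENNReal.ofReal (X 0) * f (cyl X θ) ∂angleMeasure =
      ∫⁻ x, f x := by
  have hmeas : Measurable fun p : Eu 2 × ℝ => ENNReal.ofReal (p.1 0) * f (cyl p.1 p.2) :=
    Measurable.mul (by fun_prop) (hf.comp measurable_cyl)
  rw [lintegral_eu3 hf, setLIntegral_eu2 hmeas.lintegral_prod_right']
  refine lintegral_congr fun z => ?_
  have hz : Measurable fun q : ℝ × ℝ => f !₂[q.1, q.2, z] :=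
    hf.comp (measurePreserving_prod_eu3.measurable.comp (measurable_const.prodMk measurable_id))
  exact (lintegral_polar hz).symm

/-- A bounded axisymmetric open set at positive distance from the axis. -/
structure IsAxiDomain (Ω : Set (Eu 3)) : Prop where
  isOpen : IsOpen Ω
  isBounded : Bornology.IsBounded Ω
  axi : IsAxisymmetricSet Ω
  away : ∃ r₀ : ℝ, 0 < r₀ ∧ ∀ x ∈ Ω, r₀ ≤ cylRadius x

/-- The measure `dr dz dθ` on the product of the meridian section and the interval of angles;
the Jacobian `r` of the cylindrical coordinates is not included. -/
def cylMeasure (Ω : Set (Eu 3)) : Measure (Eu 2 × ℝ) :=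
  (volume.restrict (meridian Ω)).prod angleMeasure

theorem ae_cylMeasure_angle_mem (Ω : Set (Eu 3)) :
    ∀ᵐ p ∂(cylMeasure Ω), p.2 ∈ Set.Ioo (-Real.pi) Real.pi := by
  have h : ∀ᵐ θ ∂angleMeasure, θ ∈ Set.Ioo (-Real.pi) Real.pi := ae_restrict_mem measurableSet_Ioo
  exact Measure.quasiMeasurePreserving_snd.ae h

theorem integral_cylMeasure_eq_zero_of_forall_angle {Ω : Set (Eu 3)} {f : Eu 2 × ℝ → ℝ}
    (hf : Integrable f (cylMeasure Ω)) (h : ∀ θ, ∫ X in meridian Ω, f (X, θ) = 0) :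
    ∫ p, f p ∂(cylMeasure Ω) = 0 := by
  rw [cylMeasure, integral_prod_symm f hf]
  simp only [h, integral_zero]

namespace IsAxiDomain

variable {Ω : Set (Eu 3)} (D : IsAxiDomain Ω)
include D

theorem isOpen_meridian : IsOpen (meridian Ω) := NeoHookean.isOpen_meridian D.isOpen

theorem isFiniteMeasure_restrict : IsFiniteMeasure (volume.restrict Ω) :=
  MeasureTheory.isFiniteMeasure_restrict.2 D.isBounded.measure_lt_top.ne

theorem cylRadius_pos {x : Eu 3} (hx : x ∈ Ω) : 0 < cylRadius x := by
  obtain ⟨r₀, hr₀, h⟩ := D.away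
  exact hr₀.trans_le (h x hx)

theorem cyl_mem {X : Eu 2} (hX : X ∈ meridian Ω) (θ : ℝ) : cyl X θ ∈ Ω :=
  (cyl_mem_iff D.axi hX.1 θ).2 hX

theorem cylProj_mem_iff {x : Eu 3} : cylProj x ∈ meridian Ω ↔ x ∈ Ω := by
  obtain ⟨θ, hθ⟩ := exists_eq_cyl x
  refine ⟨fun hx => hθ ▸ D.cyl_mem hx θ, fun hx => ?_⟩
  exact (cyl_mem_iff D.axi (D.cylRadius_pos hx) θ).1 (hθ ▸ hx)

theorem exists_radius_le : ∃ r₀, 0 < r₀ ∧ ∀ X ∈ meridian Ω, r₀ ≤ X 0 := by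
  obtain ⟨r₀, hr₀, h⟩ := D.away
  exact ⟨r₀, hr₀, fun X hX => (h _ (D.cyl_mem hX 0)).trans_eq (cylRadius_cyl hX.1.le 0)⟩

theorem isBounded_meridian : Bornology.IsBounded (meridian Ω) := by
  obtain ⟨C, hC⟩ := D.isBounded.exists_norm_le
  exact isBounded_iff_forall_norm_le.2
    ⟨C, fun X hX => (norm_cyl_angle_zero X).symm.trans_le (hC _ (D.cyl_mem hX 0))⟩

theorem ae_cylMeasure_mem : ∀ᵐ p ∂(cylMeasure Ω), p.1 ∈ meridian Ω :=
  Measure.quasiMeasurePreserving_fst.ae (ae_restrict_mem D.isOpen_meridian.measurableSet)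

theorem map_cylMeasure :
    Measure.map (fun p : Eu 2 × ℝ => cyl p.1 p.2)
      ((cylMeasure Ω).withDensity fun p => ENNReal.ofReal (p.1 0)) = volume.restrict Ω := by
  refine Measure.ext_of_lintegral _ fun f hf => ?_
  have hcyl : Measurable fun p : Eu 2 × ℝ => f (cyl p.1 p.2) := hf.comp measurable_cyl
  have hjac : Measurable fun p : Eu 2 × ℝ => ENNReal.ofReal (p.1 0) := by fun_prop
  have hind {X : Eu 2} (hX : 0 < X 0) (θ : ℝ) : Ω.indicator f (cyl X θ) =
      (meridian Ω).indicator (fun Y => f (cyl Y θ)) X := by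
    classical simp only [Set.indicator_apply, cyl_mem_iff D.axi hX θ]
  have hsub : meridian Ω ⊆ {X : Eu 2 | 0 < X 0} := fun X hX => hX.1
  have hmer := D.isOpen_meridian.measurableSet
  calc ∫⁻ x, f x ∂(Measure.map _ ((cylMeasure Ω).withDensity _))
      = ∫⁻ X in meridian Ω,
          ∫⁻ θ, ENNReal.ofReal (X 0) * f (cyl X θ) ∂angleMeasure := by
        rw [lintegral_map hf measurable_cyl,
          lintegral_withDensity_eq_lintegral_mul _ hjac hcyl, cylMeasure,
          lintegral_prod _ (hjac.mul hcyl).aemeasurable]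
        rfl
    _ = ∫⁻ X in {X | 0 < X 0},
          ∫⁻ θ, ENNReal.ofReal (X 0) * Ω.indicator f (cyl X θ) ∂angleMeasure := by
        rw [← Set.inter_eq_left.2 hsub,
          ← Measure.restrict_restrict hmer, ← lintegral_indicator hmer]
        refine setLIntegral_congr_fun (measurableSet_lt measurable_const (by fun_prop))
          fun X hX => ?_
        simp only [hind hX]
        by_cases h : X ∈ meridian Ω <;> simp [h]
    _ = ∫⁻ x in Ω, f x := by
        rw [lintegral_cyl (hf.indicator D.isOpen.measurableSet),
          lintegral_indicator D.isOpen.measurableSet]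

theorem quasiMeasurePreserving_cylProj :
    Measure.QuasiMeasurePreserving cylProj (volume.restrict Ω)
      (volume.restrict (meridian Ω)) := by
  refine ⟨continuous_cylProj.measurable, Measure.AbsolutelyContinuous.mk fun s hs hs0 => ?_⟩
  rw [Measure.map_apply continuous_cylProj.measurable hs, ← D.map_cylMeasure,
    Measure.map_apply measurable_cyl (continuous_cylProj.measurable hs)]
  refine withDensity_absolutelyContinuous _ _ (measure_eq_zero_iff_ae_notMem.2 ?_)
  have hfst : ∀ᵐ p ∂(cylMeasure Ω), p.1 ∉ s :=
    Measure.quasiMeasurePreserving_fst.ae (measure_eq_zero_iff_ae_notMem.1 hs0)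
  filter_upwards [hfst, D.ae_cylMeasure_mem] with p hps hp
  rwa [Set.mem_preimage, Set.mem_preimage, cylProj_cyl hp.1.le]

theorem integrableOn_iff_cyl {f : Eu 3 → ℝ} (hf : AEStronglyMeasurable f (volume.restrict Ω)) :
    IntegrableOn f Ω ↔
      Integrable (fun p : Eu 2 × ℝ => p.1 0 * f (cyl p.1 p.2)) (cylMeasure Ω) := by
  rw [← D.map_cylMeasure] at hf
  rw [IntegrableOn, ← D.map_cylMeasure, integrable_map_measure hf measurable_cyl.aemeasurable,
    integrable_withDensity_iff_integrable_smul' (by fun_prop) (by simp)]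
  refine integrable_congr ?_
  filter_upwards [D.ae_cylMeasure_mem] with p hp
  simp only [ENNReal.toReal_ofReal hp.1.le, Function.comp_apply, smul_eq_mul]

theorem integral_eq_cyl {f : Eu 3 → ℝ} (hf : AEStronglyMeasurable f (volume.restrict Ω)) :
    ∫ x in Ω, f x = ∫ p, p.1 0 * f (cyl p.1 p.2) ∂(cylMeasure Ω) := by
  rw [← D.map_cylMeasure] at hf
  rw [← D.map_cylMeasure, integral_map measurable_cyl.aemeasurable hf,
    integral_withDensity_eq_integral_toReal_smul (by fun_prop) (by simp)]
  refine integral_congr_ae ?_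
  filter_upwards [D.ae_cylMeasure_mem] with p hp
  simp only [ENNReal.toReal_ofReal hp.1.le, smul_eq_mul]

theorem integrable_mul_continuous {h : Eu 2 → ℝ} (hh : IntegrableOn h (meridian Ω))
    {b : Eu 2 × ℝ → ℝ} (hb : Continuous b) :
    Integrable (fun p => h p.1 * b p) (cylMeasure Ω) := by
  have hK : IsCompact (closure (meridian Ω) ×ˢ Set.Icc (-Real.pi) Real.pi) :=
    D.isBounded_meridian.isCompact_closure.prod isCompact_Icc
  obtain ⟨C, hC⟩ := hK.exists_bound_of_continuousOn hb.continuousOn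
  have hfst : Integrable (fun p : Eu 2 × ℝ => h p.1) (cylMeasure Ω) := hh.comp_fst angleMeasure
  refine hfst.mul_bdd (c := C) hb.aestronglyMeasurable ?_
  filter_upwards [D.ae_cylMeasure_mem, ae_cylMeasure_angle_mem Ω] with p hp hθ
  exact hC p ⟨subset_closure hp, Set.Ioo_subset_Icc_self hθ⟩

theorem integrableOn_of_cyl {f : Eu 3 → ℝ} (hf : AEStronglyMeasurable f (volume.restrict Ω))
    {g : Eu 2 × ℝ → ℝ} (hg : Integrable g (cylMeasure Ω))
    (h : ∀ X ∈ meridian Ω, ∀ θ, X 0 * f (cyl X θ) = g (X, θ)) : IntegrableOn f Ω := by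
  rw [D.integrableOn_iff_cyl hf]
  refine hg.congr ?_
  filter_upwards [D.ae_cylMeasure_mem] with p hp using (h p.1 hp p.2).symm

theorem integrable_comp_cyl {f : Eu 3 → ℝ} (hf : IntegrableOn f Ω) :
    Integrable (fun p : Eu 2 × ℝ => f (cyl p.1 p.2)) (cylMeasure Ω) := by
  obtain ⟨r₀, hr₀, hr⟩ := D.exists_radius_le
  have hint : Integrable (fun p : Eu 2 × ℝ => (p.1 0 * f (cyl p.1 p.2)) * (p.1 0)⁻¹)
      (cylMeasure Ω) := by
    refine ((D.integrableOn_iff_cyl hf.aestronglyMeasurable).1 hf).mul_bdd (c := r₀⁻¹)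
      (by fun_prop) ?_
    filter_upwards [D.ae_cylMeasure_mem] with p hp
    rw [Real.norm_eq_abs, abs_of_nonneg (inv_nonneg.2 hp.1.le)]
    exact inv_anti₀ hr₀ (hr _ hp)
  refine hint.congr ?_
  filter_upwards [D.ae_cylMeasure_mem] with p hp
  have := hp.1.ne'
  field_simp

theorem aestronglyMeasurable_comp_cylProj {h : Eu 2 → ℝ}
    (hh : AEStronglyMeasurable h (volume.restrict (meridian Ω))) :
    AEStronglyMeasurable (fun x => h (cylProj x)) (volume.restrict Ω) :=
  hh.comp_quasiMeasurePreserving D.quasiMeasurePreserving_cylProj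

theorem integral_cylMeasure_eq_zero_of_forall_meridian {f : Eu 2 × ℝ → ℝ}
    (hf : Integrable f (cylMeasure Ω))
    (h : ∀ X ∈ meridian Ω, ∫ θ, f (X, θ) ∂angleMeasure = 0) : ∫ p, f p ∂(cylMeasure Ω) = 0 := by
  rw [cylMeasure, integral_prod f hf, setIntegral_congr_fun D.isOpen_meridian.measurableSet h,
    integral_zero]

end IsAxiDomain

/-! ### The cylindrical frame -/

/-- The orthonormal frame `(e_r, e_z, e_θ)` at the angle `θ`, as the rows of a matrix. The two
meridian directions come first, so that `X k` is the coordinate along the row `k.castSucc`. -/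
def frame (θ : ℝ) : Matrix (Fin 3) (Fin 3) ℝ :=
  !![Real.cos θ, Real.sin θ, 0; 0, 0, 1; -Real.sin θ, Real.cos θ, 0]

/-- The frame `(e_r, e_z, e_θ)` as a matrix field, defined off the axis. -/
def frameAt (x : Eu 3) : Matrix (Fin 3) (Fin 3) ℝ :=
  !![x 0 / cylRadius x, x 1 / cylRadius x, 0; 0, 0, 1; -(x 1 / cylRadius x), x 0 / cylRadius x, 0]

theorem frame_mul_transpose (θ : ℝ) : frame θ * (frame θ).transpose = 1 := by
  ext i j
  fin_cases i <;> fin_cases j <;>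
    simp [frame, Matrix.mul_apply, Fin.sum_univ_three, ← sq, mul_comm]

theorem transpose_mul_frame (θ : ℝ) : (frame θ).transpose * frame θ = 1 :=
  mul_eq_one_comm.1 (frame_mul_transpose θ)

theorem frameAt_cyl {X : Eu 2} (hX : 0 < X 0) (θ : ℝ) : frameAt (cyl X θ) = frame θ := by
  simp [frameAt, frame, cylRadius_cyl hX.le, mul_div_cancel_left₀ _ hX.ne']

theorem exists_frameAt_eq_frame {x : Eu 3} (hx : 0 < cylRadius x) :
    ∃ θ, x = cyl (cylProj x) θ ∧ frameAt x = frame θ := by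
  obtain ⟨θ, hθ⟩ := exists_eq_cyl x
  exact ⟨θ, hθ, by rw [hθ, frameAt_cyl hx]⟩

theorem abs_frame_le_one (θ : ℝ) (a i : Fin 3) : |frame θ a i| ≤ 1 := by
  fin_cases a <;> fin_cases i <;> simp [frame, Real.abs_cos_le_one, Real.abs_sin_le_one]

theorem continuous_frame (a i : Fin 3) : Continuous fun θ => frame θ a i := by
  fin_cases a <;> fin_cases i <;>
    first
    | exact continuous_const
    | exact Real.continuous_cos
    | exact Real.continuous_sin
    | exact Real.continuous_sin.neg

theorem frame_neg_pi (a i : Fin 3) : frame (-Real.pi) a i = frame Real.pi a i := by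
  fin_cases a <;> fin_cases i <;> simp [frame]

theorem hasDerivAt_frame_radial (θ : ℝ) (i : Fin 3) :
    HasDerivAt (fun η => frame η 0 i) (frame θ 2 i) θ := by
  fin_cases i
  · exact Real.hasDerivAt_cos θ
  · exact Real.hasDerivAt_sin θ
  · exact hasDerivAt_const θ 0

theorem hasDerivAt_frame_angular (θ : ℝ) (i : Fin 3) :
    HasDerivAt (fun η => frame η 2 i) (-frame θ 0 i) θ := by
  fin_cases i
  · exact (Real.hasDerivAt_sin θ).neg
  · exact Real.hasDerivAt_cos θ
  · exact (hasDerivAt_const θ 0).congr_deriv neg_zero.symm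

theorem contDiffAt_cylRadius {x : Eu 3} (hx : 0 < cylRadius x) : ContDiffAt ℝ ∞ cylRadius x := by
  have hpos : x 0 ^ 2 + x 1 ^ 2 ≠ 0 := (Real.sqrt_pos.1 hx).ne'
  exact ContDiffAt.sqrt (by fun_prop) hpos

theorem contDiffAt_cylProj {x : Eu 3} (hx : 0 < cylRadius x) : ContDiffAt ℝ ∞ cylProj x := by
  refine contDiffAt_euclidean.2 fun k => ?_
  fin_cases k
  · exact contDiffAt_cylRadius hx
  · exact (by fun_prop : ContDiffAt ℝ ∞ (fun y : Eu 3 => y 2) x)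

theorem contDiffAt_frameAt {x : Eu 3} (hx : 0 < cylRadius x) (a i : Fin 3) :
    ContDiffAt ℝ ∞ (fun y => frameAt y a i) x := by
  have hdiv (k : Fin 3) : ContDiffAt ℝ ∞ (fun y : Eu 3 => y k / cylRadius y) x :=
    ContDiffAt.div (by fun_prop) (contDiffAt_cylRadius hx) hx.ne'
  fin_cases a <;> fin_cases i <;>
    first
    | exact hdiv 0
    | exact hdiv 1
    | exact (hdiv 1).neg
    | exact contDiffAt_const

theorem cyl_apply (X : Eu 2) (θ : ℝ) (i : Fin 3) :
    cyl X θ i = ∑ k : Fin 2, X k * frame θ k.castSucc i := by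
  fin_cases i <;> simp [frame, Fin.sum_univ_two]

/-! ### Differentiation in cylindrical coordinates -/

theorem fderiv_eq_sum_pd {n : ℕ} (φ : Eu n → ℝ) (x w : Eu n) :
    fderiv ℝ φ x w = ∑ j, w j * pd j φ x := by
  conv_lhs => rw [← (EuclideanSpace.basisFun (Fin n) ℝ).sum_repr w]
  simp [pd, basisVec]

theorem pd_sum_mul_coord {n : ℕ} (c : Fin n → ℝ) (k : Fin n) (x : Eu n) :
    pd k (fun y : Eu n => ∑ i, y i * c i) x = c k := by
  have hlin : (fun y : Eu n => ∑ i, y i * c i) =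
      ⇑(∑ i, c i • (EuclideanSpace.proj i : Eu n →L[ℝ] ℝ)) := by
    ext y
    simp [mul_comm]
  rw [pd, hlin, ContinuousLinearMap.fderiv]
  simp [basisVec]

theorem pd_comp_cyl {φ : Eu 3 → ℝ} {X : Eu 2} {θ : ℝ} (h : DifferentiableAt ℝ φ (cyl X θ))
    (k : Fin 2) :
    pd k (fun Y => φ (cyl Y θ)) X = ∑ j, frame θ k.castSucc j * pd j φ (cyl X θ) := by
  have hc : DifferentiableAt ℝ (fun Y : Eu 2 => cyl Y θ) X :=
    (contDiff_cyl_left θ).contDiffAt.differentiableAt (by simp)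
  rw [pd, ← Function.comp_def φ, fderiv_comp X h hc, ContinuousLinearMap.comp_apply,
    fderiv_eq_sum_pd]
  refine Finset.sum_congr rfl fun j _ => ?_
  rw [← fderiv_coord hc, ← pd]
  simp only [cyl_apply, pd_sum_mul_coord]

theorem hasDerivAt_comp_cyl {φ : Eu 3 → ℝ} {X : Eu 2} {θ : ℝ}
    (h : DifferentiableAt ℝ φ (cyl X θ)) :
    HasDerivAt (fun η => φ (cyl X η)) (X 0 * ∑ j, frame θ 2 j * pd j φ (cyl X θ)) θ := by
  have hcoord : HasDerivAt (fun η j => cyl X η j) (fun j => X 0 * frame θ 2 j) θ := by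
    refine hasDerivAt_pi.2 fun j => ?_
    fin_cases j
    · exact (Real.hasDerivAt_cos θ).const_mul (X 0)
    · exact (Real.hasDerivAt_sin θ).const_mul (X 0)
    · exact (hasDerivAt_const θ (X 1)).congr_deriv (mul_zero _).symm
  have hcyl : HasDerivAt (cyl X) (WithLp.toLp 2 fun j => X 0 * frame θ 2 j) θ :=
    (PiLp.hasFDerivAt_toLp (𝕜 := ℝ) (E := fun _ : Fin 3 => ℝ) 2 _).comp_hasDerivAt θ hcoord
  refine (h.hasFDerivAt.comp_hasDerivAt θ hcyl).congr_deriv ?_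
  simp only [fderiv_eq_sum_pd, Finset.mul_sum, mul_assoc]

theorem pd_cyl {φ : Eu 3 → ℝ} {X : Eu 2} {θ : ℝ} (hX : X 0 ≠ 0)
    (h : DifferentiableAt ℝ φ (cyl X θ)) (j : Fin 3) :
    pd j φ (cyl X θ) = ∑ k : Fin 2, frame θ k.castSucc j * pd k (fun Y => φ (cyl Y θ)) X +
      frame θ 2 j * (deriv (fun η => φ (cyl X η)) θ / X 0) := by
  have hgrad (f : Fin 3 → ℝ) :
      f j = ∑ a, frame θ a j * ∑ i, frame θ a i * f i := by
    conv_lhs => rw [← Matrix.one_mulVec f, ← transpose_mul_frame θ, ← Matrix.mulVec_mulVec]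
    rfl
  rw [hgrad fun i => pd i φ (cyl X θ), Fin.sum_univ_castSucc, (hasDerivAt_comp_cyl h).deriv,
    mul_div_cancel_left₀ _ hX]
  simp only [pd_comp_cyl h]
  rfl

theorem pd_cyl_of_eventuallyEq {φ : Eu 3 → ℝ} {ψ : Eu 2 → ℝ} {f : ℝ → ℝ} {X : Eu 2} {θ d : ℝ}
    (hX : X 0 ≠ 0) (h : DifferentiableAt ℝ φ (cyl X θ)) (hψ : ∀ᶠ Y in 𝓝 X, φ (cyl Y θ) = ψ Y)
    (hf : ∀ η, φ (cyl X η) = f η) (hd : HasDerivAt f d θ) (j : Fin 3) :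
    pd j φ (cyl X θ) = ∑ k : Fin 2, frame θ k.castSucc j * pd k ψ X + frame θ 2 j * (d / X 0) := by
  have hpd (k : Fin 2) : pd k (fun Y => φ (cyl Y θ)) X = pd k ψ X := by
    rw [pd, pd, Filter.EventuallyEq.fderiv_eq hψ]
  simp only [pd_cyl hX h, hpd, hf, hd.deriv]

theorem eventually_pos_coord {X : Eu 2} (hX : 0 < X 0) : ∀ᶠ Y : Eu 2 in 𝓝 X, 0 < Y 0 :=
  continuousAt_const.eventually_lt (by fun_prop) hX

theorem pd_comp_cylProj {ψ : Eu 2 → ℝ} {x : Eu 3} (hx : 0 < cylRadius x)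
    (h : DifferentiableAt ℝ ψ (cylProj x)) (j : Fin 3) :
    pd j (fun y => ψ (cylProj y)) x =
      ∑ k : Fin 2, frameAt x k.castSucc j * pd k ψ (cylProj x) := by
  obtain ⟨θ, hθ, hQ⟩ := exists_frameAt_eq_frame hx
  have hdiff : DifferentiableAt ℝ (fun y => ψ (cylProj y)) x :=
    h.comp x ((contDiffAt_cylProj hx).differentiableAt (by simp))
  rw [hQ]
  rw [hθ] at hdiff
  conv_lhs => rw [hθ]
  rw [pd_cyl_of_eventuallyEq (ψ := ψ) hx.ne' hdiff _
    (fun η => by rw [cylProj_cyl hx.le]) (hasDerivAt_const θ _), zero_div, mul_zero, add_zero]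
  exact (eventually_pos_coord hx).mono fun Y hY => by rw [cylProj_cyl hY.le]

theorem pd_frameAt_radial {x : Eu 3} (hx : 0 < cylRadius x) (i j : Fin 3) :
    pd j (fun y => frameAt y 0 i) x = frameAt x 2 i * frameAt x 2 j / cylRadius x := by
  obtain ⟨θ, hθ, hQ⟩ := exists_frameAt_eq_frame hx
  have hdiff := (contDiffAt_frameAt hx 0 i).differentiableAt (by simp)
  rw [hQ]
  rw [hθ] at hdiff
  conv_lhs => rw [hθ]
  rw [pd_cyl_of_eventuallyEq (ψ := fun _ => frame θ 0 i) hx.ne' hdiff _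
    (fun η => by rw [frameAt_cyl hx]) (hasDerivAt_frame_radial θ i)]
  · simp only [pd, fderiv_fun_const, Pi.zero_apply, zero_apply, mul_zero, Finset.sum_const_zero,
      zero_add, cylProj_zero]
    ring
  · exact (eventually_pos_coord hx).mono fun Y hY => by rw [frameAt_cyl hY]

theorem pd_frameAt_vertical (x : Eu 3) (i j : Fin 3) : pd j (fun y => frameAt y 1 i) x = 0 := by
  have hconst : (fun y => frameAt y 1 i) = fun _ => frame 0 1 i := by
    ext y
    fin_cases i <;> rfl
  simp only [pd, hconst, fderiv_fun_const, Pi.zero_apply, zero_apply]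

/-! ### Axisymmetric tensor fields -/

section AxiTensor

variable (Q : Matrix (Fin 3) (Fin 3) ℝ) (A B : Matrix (Fin 2) (Fin 2) ℝ) (p q c : ℝ)

/-- The block-diagonal matrix with the meridian block `A` and the entry `q` in the direction
`e_θ`. -/
def axiBlock : Matrix (Fin 3) (Fin 3) ℝ := !![A 0 0, A 0 1, 0; A 1 0, A 1 1, 0; 0, 0, q]

/-- The tensor whose matrix in the orthonormal frame given by the rows of `Q` is
`axiBlock A q`. -/
def axiTensor : Matrix (Fin 3) (Fin 3) ℝ := Q.transpose * axiBlock A q * Q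

theorem axiTensor_apply (i j : Fin 3) :
    axiTensor Q A q i j = ∑ k : Fin 2, ∑ l : Fin 2,
      Q k.castSucc i * (Q l.castSucc j * A k l) + Q 2 i * (Q 2 j * q) := by
  simp only [axiTensor, axiBlock, Matrix.mul_apply, Matrix.transpose_apply, Fin.sum_univ_three,
    Fin.sum_univ_two, Matrix.of_apply, Matrix.cons_val, Matrix.cons_val_zero, Matrix.cons_val_one,
    Fin.castSucc_zero, Fin.castSucc_one]
  ring

theorem sum_axiTensor_mul (i : Fin 3) (w : Fin 3 → ℝ) :
    ∑ j, axiTensor Q A q i j * w j = ∑ k : Fin 2, ∑ l : Fin 2,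
      A k l * (Q k.castSucc i * ∑ j, Q l.castSucc j * w j) + q * (Q 2 i * ∑ j, Q 2 j * w j) := by
  simp only [axiTensor_apply, Fin.sum_univ_three, Fin.sum_univ_two]
  ring

variable {Q}

theorem axiTensor_smul_one (hQ : Q.transpose * Q = 1) :
    axiTensor Q (c • 1) c = c • (1 : Matrix (Fin 3) (Fin 3) ℝ) := by
  have hblock : axiBlock (c • 1) c = c • (1 : Matrix (Fin 3) (Fin 3) ℝ) := by
    ext i j
    fin_cases i <;> fin_cases j <;> simp [axiBlock]
  rw [axiTensor, hblock, Matrix.mul_smul, mul_one, Matrix.smul_mul, hQ]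

theorem sum_axiTensor_mul_axiTensor (hQ : Q * Q.transpose = 1) :
    ∑ i, ∑ j, axiTensor Q A p i j * axiTensor Q B q i j =
      ∑ k, ∑ l, A k l * B k l + p * q := by
  have hentry (M N : Matrix (Fin 3) (Fin 3) ℝ) :
      ∑ i, ∑ j, M i j * N i j = (M * N.transpose).trace := by
    simp only [Matrix.trace, Matrix.diag_apply, Matrix.mul_apply, Matrix.transpose_apply]
  have hconj : axiTensor Q A p * (axiTensor Q B q).transpose =
      Q.transpose * (axiBlock A p * (axiBlock B q).transpose * Q) := by
    simp only [axiTensor, Matrix.transpose_mul, Matrix.transpose_transpose, Matrix.mul_assoc]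
    rw [← Matrix.mul_assoc Q, hQ, Matrix.one_mul]
  rw [hentry, hconj, Matrix.trace_mul_comm, Matrix.mul_assoc, hQ, Matrix.mul_one, ← hentry]
  simp [axiBlock, Fin.sum_univ_succ, add_assoc]

end AxiTensor

/-- The axisymmetric tensor field on `ℝ³` whose components in the frame `(e_r, e_z, e_θ)` at a
point of cylindrical coordinates `(X, θ)` are those of `axiBlock (A X) (q X)`. -/
def axiField (A : Eu 2 → Matrix (Fin 2) (Fin 2) ℝ) (q : Eu 2 → ℝ) (x : Eu 3) :
    Matrix (Fin 3) (Fin 3) ℝ :=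
  axiTensor (frameAt x) (A (cylProj x)) (q (cylProj x))

theorem axiField_cyl (A : Eu 2 → Matrix (Fin 2) (Fin 2) ℝ) (q : Eu 2 → ℝ) {X : Eu 2}
    (hX : 0 < X 0) (θ : ℝ) : axiField A q (cyl X θ) = axiTensor (frame θ) (A X) (q X) := by
  rw [axiField, frameAt_cyl hX, cylProj_cyl hX.le]

theorem axiLift_apply (v : Eu 2 → Eu 2) (x : Eu 3) (i : Fin 3) :
    axiLift v x i = ∑ k : Fin 2, frameAt x k.castSucc i * v (cylProj x) k := by
  fin_cases i <;> simp [axiLift, frameAt, cylProj, Fin.sum_univ_two, mul_comm]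

theorem axiLift_cyl_apply (v : Eu 2 → Eu 2) {X : Eu 2} (hX : 0 < X 0) (θ : ℝ) (i : Fin 3) :
    axiLift v (cyl X θ) i = ∑ k : Fin 2, frame θ k.castSucc i * v X k := by
  rw [axiLift_apply, frameAt_cyl hX, cylProj_cyl hX.le]

theorem frame_mul_axiLift (v : Eu 2 → Eu 2) {x : Eu 3} (hx : 0 < cylRadius x) (k : Fin 2) :
    ∑ i, frameAt x k.castSucc i * axiLift v x i = v (cylProj x) k := by
  obtain ⟨θ, -, hQ⟩ := exists_frameAt_eq_frame hx
  have horth (l : Fin 2) : ∑ i, frame θ k.castSucc i * frame θ l.castSucc i =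
      if l = k then 1 else 0 := by
    have h := congrFun₂ (frame_mul_transpose θ) k.castSucc l.castSucc
    rw [Matrix.mul_apply, Matrix.one_apply] at h
    simpa only [Matrix.transpose_apply, Fin.castSucc_inj, eq_comm] using h
  calc ∑ i, frameAt x k.castSucc i * axiLift v x i
      = ∑ l : Fin 2, (∑ i, frame θ k.castSucc i * frame θ l.castSucc i) * v (cylProj x) l := by
        simp only [axiLift_apply, hQ, Finset.mul_sum, Finset.sum_mul, mul_assoc]
        exact Finset.sum_comm
    _ = v (cylProj x) k := by simp [horth]

theorem jacobian_apply {m n : ℕ} {φ : Eu m → Eu n} {x : Eu m} (h : DifferentiableAt ℝ φ x)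
    (i : Fin n) (j : Fin m) : jacobian φ x i j = pd j (fun y => φ y i) x :=
  (fderiv_coord h i _).symm

theorem jacobian_axiLift {ξ : Eu 2 → Eu 2} {x : Eu 3} (hx : 0 < cylRadius x)
    (h : DifferentiableAt ℝ ξ (cylProj x)) :
    jacobian (axiLift ξ) x = axiField (jacobian ξ) (fun X => ξ X 0 / X 0) x := by
  have hQ (a i : Fin 3) : DifferentiableAt ℝ (fun y => frameAt y a i) x :=
    (contDiffAt_frameAt hx a i).differentiableAt (by simp)
  have hcoord := differentiableAt_euclidean.1 h
  have hcomp (k : Fin 2) : DifferentiableAt ℝ (fun y => ξ (cylProj y) k) x :=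
    (hcoord k).comp x ((contDiffAt_cylProj hx).differentiableAt (by simp))
  have hterm (i : Fin 3) (k : Fin 2) :
      DifferentiableAt ℝ (fun y => frameAt y k.castSucc i * ξ (cylProj y) k) x :=
    (hQ _ i).mul (hcomp k)
  have hlift : DifferentiableAt ℝ (axiLift ξ) x := by
    refine differentiableAt_euclidean.2 fun i => ?_
    simp only [axiLift_apply]
    exact DifferentiableAt.fun_sum fun k _ => hterm i k
  ext i j
  rw [jacobian_apply hlift]
  simp only [axiLift_apply, axiField, axiTensor_apply, jacobian_apply h]
  rw [pd, fderiv_fun_sum fun k _ => hterm i k, sum_apply]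
  simp only [← pd.eq_def, pd_mul (hQ _ i) (hcomp _), pd_comp_cylProj hx (hcoord _),
    Fin.sum_univ_two, Fin.castSucc_zero, Fin.castSucc_one, pd_frameAt_radial hx,
    pd_frameAt_vertical, cylProj_zero]
  ring

/-! ### Testing with axisymmetric fields -/

theorem isTest_of_support_subset {E F : Type*} [NormedAddCommGroup E] [NormedSpace ℝ E]
    [NormedAddCommGroup F] [NormedSpace ℝ F] {U K : Set E} {φ : E → F} (hφ : ContDiff ℝ ∞ φ)
    (hK : IsCompact K) (hKU : K ⊆ U) (hsupp : Function.support φ ⊆ K) : IsTest U φ :=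
  ⟨hφ, .of_support_subset_isCompact hK hsupp, (closure_minimal hsupp hK.isClosed).trans hKU⟩

theorem isTest_euclidean {m n : ℕ} {U : Set (Eu m)} {φ : Eu m → Eu n}
    (h : ∀ i, IsTest U fun x => φ x i) : IsTest U φ := by
  refine isTest_of_support_subset (contDiff_euclidean.2 fun i => (h i).1)
    (isCompact_iUnion fun i => (h i).2.1) (Set.iUnion_subset fun i => (h i).2.2) fun x hx => ?_
  obtain ⟨i, hi⟩ : ∃ i, φ x i ≠ 0 := by
    by_contra! hzero
    exact hx (PiLp.ext hzero)
  exact Set.mem_iUnion.2 ⟨i, subset_tsupport (fun y => φ y i) hi⟩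

namespace IsAxiDomain

variable {Ω : Set (Eu 3)} (D : IsAxiDomain Ω)
include D

theorem isTest_comp_cylProj {ψ : Eu 2 → ℝ} (hψ : IsTest (meridian Ω) ψ) :
    IsTest Ω (fun x => ψ (cylProj x)) := by
  have hpre : cylProj ⁻¹' tsupport ψ ⊆ Ω := fun x hx => D.cylProj_mem_iff.1 (hψ.2.2 hx)
  have hclosed : IsClosed (cylProj ⁻¹' tsupport ψ) :=
    (isClosed_tsupport ψ).preimage continuous_cylProj
  refine isTest_of_support_subset (contDiff_iff_contDiffAt.2 fun x => ?_)
    (Metric.isCompact_of_isClosed_isBounded hclosed (D.isBounded.subset hpre)) hpre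
    fun x hx => subset_tsupport ψ hx
  by_cases hx : cylProj x ∈ tsupport ψ
  · exact hψ.1.contDiffAt.comp x (contDiffAt_cylProj (D.cylRadius_pos (hpre hx)))
  · refine contDiffAt_const (c := 0) |>.congr_of_eventuallyEq ?_
    filter_upwards [hclosed.isOpen_compl.mem_nhds hx] with y hy
    exact image_eq_zero_of_notMem_tsupport hy

theorem isTest_axiLift {ξ : Eu 2 → Eu 2} (hξ : IsTest (meridian Ω) ξ) :
    IsTest Ω (axiLift ξ) := by
  refine isTest_euclidean fun i => ?_
  have hterm (k : Fin 2) : IsTest Ω fun x => frameAt x k.castSucc i * ξ (cylProj x) k :=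
    (D.isTest_comp_cylProj (hξ.coord k)).smul_contDiffAt fun x hx =>
      contDiffAt_frameAt (D.cylRadius_pos hx) k.castSucc i
  simp only [axiLift_apply, Fin.sum_univ_two]
  exact (hterm 0).add (hterm 1)

end IsAxiDomain

/-- The restriction of `φ` to the half-plane of angle `θ`, extended by zero to `{r ≤ 0}`. -/
def slice (φ : Eu 3 → ℝ) (θ : ℝ) (X : Eu 2) : ℝ := if 0 < X 0 then φ (cyl X θ) else 0

theorem slice_eq {φ : Eu 3 → ℝ} {θ : ℝ} {X : Eu 2} (hX : 0 < X 0) :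
    slice φ θ X = φ (cyl X θ) := if_pos hX

theorem slice_eventuallyEq (φ : Eu 3 → ℝ) (θ : ℝ) {X : Eu 2} (hX : 0 < X 0) :
    slice φ θ =ᶠ[𝓝 X] fun Y => φ (cyl Y θ) :=
  (eventually_pos_coord hX).mono fun _ hY => slice_eq hY

theorem pd_slice {φ : Eu 3 → ℝ} (h : Differentiable ℝ φ) (θ : ℝ) {X : Eu 2} (hX : 0 < X 0)
    (k : Fin 2) : pd k (slice φ θ) X = ∑ j, frame θ k.castSucc j * pd j φ (cyl X θ) := by
  rw [← pd_comp_cyl (h _), pd, pd, (slice_eventuallyEq φ θ hX).fderiv_eq]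

namespace IsAxiDomain

variable {Ω : Set (Eu 3)} (D : IsAxiDomain Ω)
include D

theorem isTest_slice {φ : Eu 3 → ℝ} (hφ : IsTest Ω φ) (θ : ℝ) :
    IsTest (meridian Ω) (slice φ θ) := by
  obtain ⟨r₀, hr₀, hr⟩ := D.exists_radius_le
  have hcyl : Continuous fun X : Eu 2 => cyl X θ := (contDiff_cyl_left θ).continuous
  have hcoord : Continuous fun X : Eu 2 => X 0 := by fun_prop
  set K : Set (Eu 2) := {X | r₀ ≤ X 0} ∩ (fun X => cyl X θ) ⁻¹' tsupport φ
  have hKm : K ⊆ meridian Ω := fun X hX =>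
    (cyl_mem_iff D.axi (hr₀.trans_le hX.1) θ).1 (hφ.2.2 hX.2)
  have hK : IsClosed K :=
    (isClosed_le continuous_const hcoord).inter ((isClosed_tsupport φ).preimage hcyl)
  have hsupp : Function.support (slice φ θ) ⊆ K := by
    intro X hX
    have hpos : 0 < X 0 := by
      by_contra hneg
      exact hX (if_neg hneg)
    have hmem : cyl X θ ∈ tsupport φ := by
      rw [Function.mem_support, slice_eq hpos] at hX
      exact subset_tsupport φ hX
    exact ⟨hr X ((cyl_mem_iff D.axi hpos θ).1 (hφ.2.2 hmem)), hmem⟩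
  refine isTest_of_support_subset (contDiff_iff_contDiffAt.2 fun X => ?_)
    (Metric.isCompact_of_isClosed_isBounded hK (D.isBounded_meridian.subset hKm)) hKm hsupp
  by_cases hX : X ∈ K
  · exact (hφ.1.comp (contDiff_cyl_left θ)).contDiffAt.congr_of_eventuallyEq
      (slice_eventuallyEq φ θ (hr₀.trans_le hX.1))
  · refine contDiffAt_const (c := 0) |>.congr_of_eventuallyEq ?_
    filter_upwards [hK.isOpen_compl.mem_nhds hX] with Y hY
    exact Function.notMem_support.1 fun hY' => hY (hsupp hY')

end IsAxiDomain

/-! ### The divergence of an axisymmetric tensor field -/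

/-- The average over the angle of the components along `e_r` and `e_z` of a vector field `g`. -/
def meridianAverage (g : Eu 3 → Fin 3 → ℝ) (X : Eu 2) (k : Fin 2) : ℝ :=
  (2 * Real.pi)⁻¹ * ∫ θ, ∑ i, frame θ k.castSucc i * g (cyl X θ) i ∂angleMeasure

namespace IsAxiDomain

variable {Ω : Set (Eu 3)} (D : IsAxiDomain Ω)
include D

theorem memLp_frameAt_mul {f : Eu 3 → ℝ} {p : ENNReal} (hf : MemLp f p (volume.restrict Ω))
    (a i : Fin 3) : MemLp (fun x => frameAt x a i * f x) p (volume.restrict Ω) := by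
  have hcont : ContinuousOn (fun x => frameAt x a i) Ω := fun x hx =>
    (contDiffAt_frameAt (D.cylRadius_pos hx) a i).continuousAt.continuousWithinAt
  refine hf.of_le ((hcont.aestronglyMeasurable D.isOpen.measurableSet).mul hf.1) ?_
  refine (ae_restrict_mem D.isOpen.measurableSet).mono fun x hx => ?_
  obtain ⟨θ, -, hθ⟩ := exists_frameAt_eq_frame (D.cylRadius_pos hx)
  rw [hθ, norm_mul]
  exact mul_le_of_le_one_left (norm_nonneg _) (abs_frame_le_one θ a i)

theorem integrable_frameAt_mul {f : Eu 3 → ℝ} (hf : IntegrableOn f Ω) (a i : Fin 3) :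
    IntegrableOn (fun x => frameAt x a i * f x) Ω :=
  memLp_one_iff_integrable.1 (D.memLp_frameAt_mul (memLp_one_iff_integrable.2 hf) a i)

theorem integrableOn_comp_cylProj {h : Eu 2 → ℝ} (hh : IntegrableOn h (meridian Ω)) :
    IntegrableOn (fun x => h (cylProj x)) Ω := by
  refine D.integrableOn_of_cyl (D.aestronglyMeasurable_comp_cylProj hh.aestronglyMeasurable)
    (D.integrable_mul_continuous hh (b := fun p => p.1 0) (by fun_prop)) fun X hX θ => ?_
  rw [cylProj_cyl hX.1.le, mul_comm]

theorem integral_comp_cylProj {h : Eu 2 → ℝ}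
    (hh : AEStronglyMeasurable h (volume.restrict (meridian Ω))) :
    ∫ x in Ω, h (cylProj x) = 2 * Real.pi * ∫ X in meridian Ω, X 0 * h X := by
  rw [D.integral_eq_cyl (D.aestronglyMeasurable_comp_cylProj hh), ← angleMeasure_real_univ,
    ← smul_eq_mul (angleMeasure.real Set.univ), ← integral_fun_fst]
  refine integral_congr_ae (D.ae_cylMeasure_mem.mono fun p hp => ?_)
  simp only [cylProj_cyl hp.1.le]

variable {A : Eu 2 → Matrix (Fin 2) (Fin 2) ℝ} {q : Eu 2 → ℝ}

theorem integrableOn_axiField (hA : ∀ k l, IntegrableOn (fun X => A X k l) (meridian Ω))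
    (hq : IntegrableOn q (meridian Ω)) (i j : Fin 3) :
    IntegrableOn (fun x => axiField A q x i j) Ω := by
  have hterm {h : Eu 2 → ℝ} (hh : IntegrableOn h (meridian Ω)) (a b : Fin 3) :
      IntegrableOn (fun x => frameAt x a i * (frameAt x b j * h (cylProj x))) Ω :=
    D.integrable_frameAt_mul (D.integrable_frameAt_mul (D.integrableOn_comp_cylProj hh) b j) a i
  simp only [axiField, axiTensor_apply]
  exact (integrable_finsetSum _ fun k _ => integrable_finsetSum _ fun l _ =>
    hterm (hA k l) _ _).add (hterm hq _ _)

theorem integrableOn_axiLift {v : Eu 2 → Eu 2}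
    (hv : ∀ k, IntegrableOn (fun X => v X k) (meridian Ω)) (i : Fin 3) :
    IntegrableOn (fun x => axiLift v x i) Ω := by
  simp only [axiLift_apply]
  exact integrable_finsetSum _ fun k _ =>
    D.integrable_frameAt_mul (D.integrableOn_comp_cylProj (hv k)) _ i

theorem integral_axiField_mul_jacobian_axiLift
    (hA : ∀ k l, IntegrableOn (fun X => A X k l) (meridian Ω))
    (hq : IntegrableOn q (meridian Ω)) {ξ : Eu 2 → Eu 2} (hξ : IsTest (meridian Ω) ξ) :
    ∫ x in Ω, ∑ i, ∑ j, axiField A q x i j * jacobian (axiLift ξ) x i j =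
      2 * Real.pi * ∫ X in meridian Ω,
        (X 0 * ∑ k, ∑ l, A X k l * jacobian ξ X k l + q X * ξ X 0) := by
  have hmer := D.isOpen_meridian.measurableSet
  have hdξ (k l : Fin 2) : Continuous fun X => jacobian ξ X k l := by
    simp only [jacobian_apply (hξ.differentiable _)]
    exact ((hξ.coord k).partialDeriv l).1.continuous
  have hquot : AEStronglyMeasurable (fun X => ξ X 0 / X 0) (volume.restrict (meridian Ω)) :=
    (ContinuousOn.div (hξ.coord 0).1.continuous.continuousOn (by fun_prop)
      fun X hX => hX.1.ne').aestronglyMeasurable hmer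
  have hmeas : AEStronglyMeasurable
      (fun X => ∑ k, ∑ l, A X k l * jacobian ξ X k l + q X * (ξ X 0 / X 0))
      (volume.restrict (meridian Ω)) :=
    (Finset.aestronglyMeasurable_fun_sum _ fun k _ => Finset.aestronglyMeasurable_fun_sum _
      fun l _ => (hA k l).aestronglyMeasurable.mul (hdξ k l).aestronglyMeasurable).add
      (hq.aestronglyMeasurable.mul hquot)
  rw [setIntegral_congr_fun hmer (g := fun X => X 0 *
    (∑ k, ∑ l, A X k l * jacobian ξ X k l + q X * (ξ X 0 / X 0))) fun X hX => ?_,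
    ← D.integral_comp_cylProj hmeas]
  · refine setIntegral_congr_fun D.isOpen.measurableSet fun x hx => ?_
    have hpos := D.cylRadius_pos hx
    obtain ⟨θ, -, hθ⟩ := exists_frameAt_eq_frame hpos
    simp only [jacobian_axiLift hpos (hξ.differentiable _), axiField,
      sum_axiTensor_mul_axiTensor _ _ _ _ (hθ ▸ frame_mul_transpose θ)]
  · have := hX.1.ne'
    simp only [mul_add]
    field_simp

theorem integrable_frame_mul_comp_cyl {g : Eu 3 → Fin 3 → ℝ}
    (hg : ∀ i, IntegrableOn (fun x => g x i) Ω) (a : Fin 3) :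
    Integrable (fun p : Eu 2 × ℝ => ∑ i, frame p.2 a i * g (cyl p.1 p.2) i) (cylMeasure Ω) := by
  refine (D.integrable_comp_cyl (f := fun x => ∑ i, frameAt x a i * g x i)
    (integrable_finsetSum _ fun i _ => D.integrable_frameAt_mul (hg i) a i)).congr ?_
  filter_upwards [D.ae_cylMeasure_mem] with p hp
  rw [frameAt_cyl hp.1]

theorem integrableOn_meridianAverage {g : Eu 3 → Fin 3 → ℝ}
    (hg : ∀ i, IntegrableOn (fun x => g x i) Ω) (k : Fin 2) :
    IntegrableOn (fun X => meridianAverage g X k) (meridian Ω) :=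
  (D.integrable_frame_mul_comp_cyl hg k.castSucc).integral_prod_left.const_mul _

theorem integral_mul_axiLift {g : Eu 3 → Fin 3 → ℝ} (hg : ∀ i, IntegrableOn (fun x => g x i) Ω)
    {ξ : Eu 2 → Eu 2} (hξ : IsTest (meridian Ω) ξ) :
    ∫ x in Ω, ∑ i, g x i * axiLift ξ x i =
      2 * Real.pi * ∫ X in meridian Ω, X 0 * ∑ k, meridianAverage g X k * ξ X k := by
  have hterm : IntegrableOn (fun x => ∑ i, g x i * axiLift ξ x i) Ω :=
    integrable_finsetSum _ fun i _ =>
      integrable_mul_isTest (hg i).locallyIntegrableOn ((D.isTest_axiLift hξ).coord i)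
  have hangle : ∀ᵐ X ∂(volume.restrict (meridian Ω)), ∀ k : Fin 2,
      Integrable (fun θ => ∑ i, frame θ k.castSucc i * g (cyl X θ) i) angleMeasure :=
    ae_all_iff.2 fun k => (D.integrable_frame_mul_comp_cyl hg k.castSucc).prod_right_ae
  have hpolar (X : Eu 2) (hX : X ∈ meridian Ω) (θ : ℝ) :
      X 0 * ∑ i, g (cyl X θ) i * axiLift ξ (cyl X θ) i =
        ∑ k : Fin 2, X 0 * ξ X k * ∑ i, frame θ k.castSucc i * g (cyl X θ) i := by
    simp only [axiLift_cyl_apply ξ hX.1, Fin.sum_univ_three, Fin.sum_univ_two]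
    ring
  rw [D.integral_eq_cyl hterm.aestronglyMeasurable, cylMeasure,
    integral_prod _ ((D.integrableOn_iff_cyl hterm.aestronglyMeasurable).1 hterm),
    ← integral_const_mul]
  refine integral_congr_ae ?_
  filter_upwards [hangle, ae_restrict_mem D.isOpen_meridian.measurableSet] with X hint hX
  simp only [hpolar X hX]
  rw [integral_finsetSum _ fun k _ => (hint k).const_mul _]
  have := Real.pi_ne_zero
  simp only [integral_const_mul, meridianAverage, Fin.sum_univ_two]
  field_simp

end IsAxiDomain

/-- The density, in cylindrical coordinates, of the part of
`∑ j, axiField A q x i j * pd j φ x + axiLift G x i * φ x` that involves only the components of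
`φ e_i` along `e_r` and `e_z`; the rest is `angularTerm`. -/
def meridianTerm (A : Eu 2 → Matrix (Fin 2) (Fin 2) ℝ) (q : Eu 2 → ℝ) (G : Eu 2 → Eu 2)
    (φ : Eu 3 → ℝ) (i : Fin 3) (p : Eu 2 × ℝ) : ℝ :=
  ∑ k : Fin 2, ∑ l : Fin 2, A p.1 k l *
      (p.1 0 * (frame p.2 k.castSucc i * ∑ j, frame p.2 l.castSucc j * pd j φ (cyl p.1 p.2))) +
    q p.1 * (frame p.2 0 i * φ (cyl p.1 p.2)) +
    ∑ k : Fin 2, G p.1 k * (p.1 0 * (frame p.2 k.castSucc i * φ (cyl p.1 p.2)))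

/-- The complement of `meridianTerm`: the product of `q` and the derivative in the angle of the
component of `φ e_i` along `e_θ`. -/
def angularTerm (q : Eu 2 → ℝ) (φ : Eu 3 → ℝ) (i : Fin 3) (p : Eu 2 × ℝ) : ℝ :=
  q p.1 * (p.1 0 * (frame p.2 2 i * ∑ j, frame p.2 2 j * pd j φ (cyl p.1 p.2)) -
    frame p.2 0 i * φ (cyl p.1 p.2))

theorem integral_angle_deriv_eq_zero {φ : Eu 3 → ℝ} (h : ContDiff ℝ 1 φ) (X : Eu 2)
    (i : Fin 3) :
    ∫ θ, (X 0 * (frame θ 2 i * ∑ j, frame θ 2 j * pd j φ (cyl X θ)) -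
      frame θ 0 i * φ (cyl X θ)) ∂angleMeasure = 0 := by
  have hderiv (θ : ℝ) : HasDerivAt (fun η => frame η 2 i * φ (cyl X η))
      (X 0 * (frame θ 2 i * ∑ j, frame θ 2 j * pd j φ (cyl X θ)) - frame θ 0 i * φ (cyl X θ)) θ :=
    ((hasDerivAt_frame_angular θ i).mul
      (hasDerivAt_comp_cyl (h.differentiable one_ne_zero _))).congr_deriv (by ring)
  have hcyl : Continuous (cyl X) := contDiff_cyl.continuous.comp (.prodMk_right X)
  have hpd (j : Fin 3) : Continuous (pd j φ) :=
    (h.continuous_fderiv one_ne_zero).clm_apply continuous_const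
  have hcont : Continuous fun θ => X 0 * (frame θ 2 i * ∑ j, frame θ 2 j * pd j φ (cyl X θ)) -
      frame θ 0 i * φ (cyl X θ) := by
    have hφ := h.continuous
    have hframe := continuous_frame
    fun_prop
  have hperiod : cyl X (-Real.pi) = cyl X Real.pi := by simp [cyl]
  rw [angleMeasure, ← integral_Ioc_eq_integral_Ioo,
    ← intervalIntegral.integral_of_le (by linarith [Real.pi_pos]),
    intervalIntegral.integral_eq_sub_of_hasDerivAt (fun θ _ => hderiv θ)
      (hcont.intervalIntegrable _ _), frame_neg_pi, hperiod, sub_self]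

namespace IsAxiDomain

variable {Ω : Set (Eu 3)} (D : IsAxiDomain Ω) {A : Eu 2 → Matrix (Fin 2) (Fin 2) ℝ}
  {q : Eu 2 → ℝ} {G : Eu 2 → Eu 2} {φ : Eu 3 → ℝ}
include D

theorem integrable_angularTerm (hq : IntegrableOn q (meridian Ω)) (hφ : ContDiff ℝ 1 φ)
    (i : Fin 3) : Integrable (angularTerm q φ i) (cylMeasure Ω) := by
  have hframe := continuous_frame
  have hcyl := contDiff_cyl.continuous
  have hφc := hφ.continuous
  have hpd (j : Fin 3) : Continuous (pd j φ) :=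
    (hφ.continuous_fderiv one_ne_zero).clm_apply continuous_const
  exact D.integrable_mul_continuous hq (by fun_prop)

theorem integral_angularTerm (hq : IntegrableOn q (meridian Ω)) (hφ : ContDiff ℝ 1 φ)
    (i : Fin 3) : ∫ p, angularTerm q φ i p ∂(cylMeasure Ω) = 0 := by
  refine D.integral_cylMeasure_eq_zero_of_forall_meridian
    (D.integrable_angularTerm hq hφ i) fun X _ => ?_
  simp only [angularTerm]
  rw [integral_const_mul, integral_angle_deriv_eq_zero hφ, mul_zero]

theorem integrable_meridianTerm (hA : ∀ k l, IntegrableOn (fun X => A X k l) (meridian Ω))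
    (hq : IntegrableOn q (meridian Ω)) (hG : ∀ k, IntegrableOn (fun X => G X k) (meridian Ω))
    (hφ : ContDiff ℝ 1 φ) (i : Fin 3) : Integrable (meridianTerm A q G φ i) (cylMeasure Ω) := by
  have hframe := continuous_frame
  have hcyl := contDiff_cyl.continuous
  have hφc := hφ.continuous
  have hpd (j : Fin 3) : Continuous (pd j φ) :=
    (hφ.continuous_fderiv one_ne_zero).clm_apply continuous_const
  refine ((integrable_finsetSum _ fun k _ => integrable_finsetSum _ fun l _ =>
    D.integrable_mul_continuous (hA k l) ?_).add
    (D.integrable_mul_continuous hq ?_)).add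
    (integrable_finsetSum _ fun k _ => D.integrable_mul_continuous (hG k) ?_) <;> fun_prop

theorem integral_meridianTerm (hA : ∀ k l, IntegrableOn (fun X => A X k l) (meridian Ω))
    (hq : IntegrableOn q (meridian Ω)) (hG : ∀ k, IntegrableOn (fun X => G X k) (meridian Ω))
    (h : ∀ ξ : Eu 2 → Eu 2, IsTest (meridian Ω) ξ →
      ∫ X in meridian Ω, (X 0 * ∑ k, ∑ l, A X k l * jacobian ξ X k l + q X * ξ X 0 +
        X 0 * ∑ k, G X k * ξ X k) = 0)
    (i : Fin 3) (hφ : IsTest Ω φ) : ∫ p, meridianTerm A q G φ i p ∂(cylMeasure Ω) = 0 := by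
  refine integral_cylMeasure_eq_zero_of_forall_angle
    (D.integrable_meridianTerm hA hq hG (hφ.1.of_le (by simp)) i) fun θ => ?_
  set e : Eu 2 := WithLp.toLp 2 fun k => frame θ k.castSucc i
  have hξ : IsTest (meridian Ω) fun X => slice φ θ X • e :=
    (D.isTest_slice hφ θ).clm_comp (ContinuousLinearMap.toSpanSingleton ℝ e)
  rw [← h _ hξ]
  refine setIntegral_congr_fun D.isOpen_meridian.measurableSet fun X hX => ?_
  have hjac (k l : Fin 2) : jacobian (fun Y => slice φ θ Y • e) X k l =
      pd l (slice φ θ) X * frame θ k.castSucc i := by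
    rw [jacobian, Matrix.of_apply, fderiv_smul_const ((D.isTest_slice hφ θ).differentiable X)]
    rfl
  simp only [meridianTerm, hjac, pd_slice hφ.differentiable θ hX.1, PiLp.smul_apply,
    slice_eq hX.1, smul_eq_mul, Fin.sum_univ_two, e, Fin.castSucc_zero]
  ring

theorem integral_axiField_mul_pd_eq_zero
    (hA : ∀ k l, IntegrableOn (fun X => A X k l) (meridian Ω))
    (hq : IntegrableOn q (meridian Ω)) (hG : ∀ k, IntegrableOn (fun X => G X k) (meridian Ω))
    (h : ∀ ξ : Eu 2 → Eu 2, IsTest (meridian Ω) ξ →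
      ∫ X in meridian Ω, (X 0 * ∑ k, ∑ l, A X k l * jacobian ξ X k l + q X * ξ X 0 +
        X 0 * ∑ k, G X k * ξ X k) = 0)
    (i : Fin 3) (hφ : IsTest Ω φ) :
    ∫ x in Ω, (∑ j, axiField A q x i j * pd j φ x + axiLift G x i * φ x) = 0 := by
  have hφ1 : ContDiff ℝ 1 φ := hφ.1.of_le (by simp)
  have hmeas : AEStronglyMeasurable
      (fun x => ∑ j, axiField A q x i j * pd j φ x + axiLift G x i * φ x)
      (volume.restrict Ω) :=
    (Finset.aestronglyMeasurable_fun_sum _ fun j _ =>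
      (D.integrableOn_axiField hA hq i j).aestronglyMeasurable.mul
        (hφ.partialDeriv j).1.continuous.aestronglyMeasurable).add
      ((D.integrableOn_axiLift hG i).aestronglyMeasurable.mul
        hφ.1.continuous.aestronglyMeasurable)
  calc ∫ x in Ω, (∑ j, axiField A q x i j * pd j φ x + axiLift G x i * φ x)
      = ∫ p, (meridianTerm A q G φ i p + angularTerm q φ i p) ∂(cylMeasure Ω) := by
        rw [D.integral_eq_cyl hmeas]
        refine integral_congr_ae (D.ae_cylMeasure_mem.mono fun p hp => ?_)
        simp only [axiField_cyl A q hp.1, sum_axiTensor_mul, axiLift_cyl_apply G hp.1,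
          meridianTerm, angularTerm, Fin.sum_univ_two]
        ring
    _ = 0 := by
        rw [integral_add (D.integrable_meridianTerm hA hq hG hφ1 i)
          (D.integrable_angularTerm hq hφ1 i), D.integral_meridianTerm hA hq hG h i hφ,
          D.integral_angularTerm hq hφ1 i, add_zero]

end IsAxiDomain

/-! ### The weak gradient of an axisymmetric map -/

theorem pd_coord_mul {n : ℕ} (i k : Fin n) {φ : Eu n → ℝ} {x : Eu n}
    (h : DifferentiableAt ℝ φ x) :
    pd k (fun y => y i * φ y) x = x i * pd k φ x + if i = k then φ x else 0 := by
  have hcoord : fderiv ℝ (fun y : Eu n => y i) x = EuclideanSpace.proj i :=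
    (EuclideanSpace.proj (𝕜 := ℝ) i).hasFDerivAt.fderiv
  rw [pd_mul (by fun_prop) h, pd, pd, hcoord]
  simp [basisVec]

theorem sum_pd_radius_mul {ξ : Eu 2 → Eu 2} {X : Eu 2} (h : DifferentiableAt ℝ ξ X) :
    ∑ k, pd k (fun Y => Y 0 * ξ Y k) X = X 0 * ∑ k, jacobian ξ X k k + ξ X 0 := by
  have hk := differentiableAt_euclidean.1 h
  simp only [pd_coord_mul 0 _ (hk _), jacobian_apply h, Fin.sum_univ_two]
  simp only [Fin.isValue, if_true, zero_ne_one, if_false]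
  ring

/-- The field `(ψ / r) e_k` on the half-plane: weighted by the Jacobian `r` of the cylindrical
coordinates, it restores the test function `ψ`. -/
def radialQuotient (ψ : Eu 2 → ℝ) (k : Fin 2) (X : Eu 2) : Eu 2 := ((X 0)⁻¹ * ψ X) • basisVec k

theorem radialQuotient_apply (ψ : Eu 2 → ℝ) (k l : Fin 2) (X : Eu 2) :
    radialQuotient ψ k X l = if l = k then (X 0)⁻¹ * ψ X else 0 := by
  simp [radialQuotient, basisVec]

theorem isTest_inv_radius_mul {Ω : Set (Eu 3)} {ψ : Eu 2 → ℝ} (hψ : IsTest (meridian Ω) ψ) :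
    IsTest (meridian Ω) (fun X => (X 0)⁻¹ * ψ X) :=
  hψ.smul_contDiffAt fun X hX => ContDiffAt.inv (by fun_prop) hX.1.ne'

theorem isTest_radialQuotient {Ω : Set (Eu 3)} {ψ : Eu 2 → ℝ} (hψ : IsTest (meridian Ω) ψ)
    (k : Fin 2) : IsTest (meridian Ω) (radialQuotient ψ k) :=
  (isTest_inv_radius_mul hψ).clm_comp (ContinuousLinearMap.toSpanSingleton ℝ (basisVec k))

theorem isTest_radius_mul {Ω : Set (Eu 3)} {ψ : Eu 2 → ℝ}
    (hψ : IsTest (meridian Ω) ψ) :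
    IsTest (meridian Ω) (fun X => X 0 * ψ X) :=
  hψ.smul_contDiffAt fun X _ => by fun_prop

theorem sum_pd_radius_mul_radialQuotient {Ω : Set (Eu 3)} {ψ : Eu 2 → ℝ} (k : Fin 2)
    {X : Eu 2} (hX : X ∈ meridian Ω) :
    ∑ l, pd l (fun Y => Y 0 * radialQuotient ψ k Y l) X = pd k ψ X := by
  have hterm (l : Fin 2) : pd l (fun Y => Y 0 * radialQuotient ψ k Y l) X =
      if l = k then pd l ψ X else 0 := by
    have heq : (fun Y => Y 0 * radialQuotient ψ k Y l) =ᶠ[𝓝 X]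
        fun Y => if l = k then ψ Y else 0 := by
      filter_upwards [eventually_pos_coord hX.1] with Y hY
      rw [radialQuotient_apply, mul_ite, mul_zero, mul_inv_cancel_left₀ hY.ne']
    rw [pd, heq.fderiv_eq]
    split_ifs with hl
    · rfl
    · simp
  simp only [hterm, Finset.sum_ite_eq', Finset.mem_univ, if_true]

theorem sum_smul_one_mul {n : ℕ} (c : ℝ) (B : Matrix (Fin n) (Fin n) ℝ) :
    ∑ i, ∑ j, (c • (1 : Matrix (Fin n) (Fin n) ℝ)) i j * B i j = c * ∑ i, B i i := by
  simp [Matrix.one_apply, Finset.mul_sum]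

namespace IsAxiDomain

variable {Ω : Set (Eu 3)} (D : IsAxiDomain Ω) {w : Eu 2 → ℝ}
include D

theorem axiField_smul_one {x : Eu 3} (hx : x ∈ Ω) :
    axiField (fun X => w X • 1) w x = w (cylProj x) • (1 : Matrix (Fin 3) (Fin 3) ℝ) := by
  obtain ⟨θ, -, hθ⟩ := exists_frameAt_eq_frame (D.cylRadius_pos hx)
  exact axiTensor_smul_one _ (hθ ▸ transpose_mul_frame θ)

theorem hasWeakPd_comp_cylProj {G : Eu 2 → Eu 2} (hw : IntegrableOn w (meridian Ω))
    (hG : ∀ k, IntegrableOn (fun X => G X k) (meridian Ω))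
    (h : ∀ k, HasWeakPd (meridian Ω) k w (fun X => G X k)) (j : Fin 3) :
    HasWeakPd Ω j (fun x => w (cylProj x)) (fun x => axiLift G x j) := by
  refine hasWeakPd_of_integral_eq_zero (D.integrableOn_comp_cylProj hw).locallyIntegrableOn
    (D.integrableOn_axiLift hG j).locallyIntegrableOn fun φ hφ => ?_
  have hA (k l : Fin 2) :
      IntegrableOn (fun X => (w X • (1 : Matrix (Fin 2) (Fin 2) ℝ)) k l) (meridian Ω) :=
    hw.mul_const _
  rw [← D.integral_axiField_mul_pd_eq_zero hA hw hG (fun ξ hξ => ?_) j hφ]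
  · refine setIntegral_congr_fun D.isOpen.measurableSet fun x hx => ?_
    simp only [D.axiField_smul_one hx, Matrix.smul_apply, Matrix.one_apply, smul_eq_mul, mul_ite,
      mul_one, mul_zero, ite_mul, zero_mul, Finset.sum_ite_eq, Finset.mem_univ, if_true]
  · have hrad (k : Fin 2) := isTest_radius_mul (hξ.coord k)
    have hint (k : Fin 2) : IntegrableOn
        (fun X => w X * pd k (fun Y => Y 0 * ξ Y k) X + G X k * (X 0 * ξ X k)) (meridian Ω) :=
      (integrable_mul_isTest (h k).1 ((hrad k).partialDeriv k)).add
        (integrable_mul_isTest (h k).2.1 (hrad k))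
    calc _ = ∫ X in meridian Ω,
          ∑ k, (w X * pd k (fun Y => Y 0 * ξ Y k) X + G X k * (X 0 * ξ X k)) := by
          refine integral_congr_ae (ae_of_all _ fun X => ?_)
          simp only [Finset.sum_add_distrib, ← Finset.mul_sum,
            sum_pd_radius_mul (hξ.differentiable X), sum_smul_one_mul]
          simp only [Fin.sum_univ_two]
          ring
      _ = 0 := by
          rw [integral_finsetSum _ fun k _ => hint k]
          exact Finset.sum_eq_zero fun k _ => (h k).integral_eq_zero (hrad k)

theorem integral_comp_cylProj_mul_div_axiLift_radialQuotient (hw : IntegrableOn w (meridian Ω))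
    {ψ : Eu 2 → ℝ} (hψ : IsTest (meridian Ω) ψ) (k : Fin 2) :
    ∫ x in Ω, ∑ i, w (cylProj x) * pd i (fun y => axiLift (radialQuotient ψ k) y i) x =
      2 * Real.pi * ∫ X in meridian Ω, w X * pd k ψ X := by
  have hξ := isTest_radialQuotient hψ k
  have hA (k l : Fin 2) :
      IntegrableOn (fun X => (w X • (1 : Matrix (Fin 2) (Fin 2) ℝ)) k l) (meridian Ω) :=
    hw.mul_const _
  calc _ = ∫ x in Ω, ∑ i, ∑ j, axiField (fun X => w X • 1) w x i j *
        jacobian (axiLift (radialQuotient ψ k)) x i j := by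
        refine setIntegral_congr_fun D.isOpen.measurableSet fun x hx => ?_
        simp only [D.axiField_smul_one hx, sum_smul_one_mul]
        simp only [Finset.mul_sum, jacobian_apply ((D.isTest_axiLift hξ).differentiable _)]
    _ = _ := by
        rw [D.integral_axiField_mul_jacobian_axiLift hA hw hξ]
        congr 1
        refine setIntegral_congr_fun D.isOpen_meridian.measurableSet fun X hX => ?_
        have hdivξ := sum_pd_radius_mul (hξ.differentiable X)
        rw [sum_pd_radius_mul_radialQuotient k hX] at hdivξ
        simp only [sum_smul_one_mul, hdivξ]
        ring

theorem integral_mul_axiLift_radialQuotient {g : Eu 3 → Fin 3 → ℝ}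
    (hg : ∀ i, IntegrableOn (fun x => g x i) Ω) {ψ : Eu 2 → ℝ} (hψ : IsTest (meridian Ω) ψ)
    (k : Fin 2) :
    ∫ x in Ω, ∑ i, g x i * axiLift (radialQuotient ψ k) x i =
      2 * Real.pi * ∫ X in meridian Ω, meridianAverage g X k * ψ X := by
  rw [D.integral_mul_axiLift hg (isTest_radialQuotient hψ k)]
  congr 1
  refine setIntegral_congr_fun D.isOpen_meridian.measurableSet fun X hX => ?_
  simp only [radialQuotient_apply, mul_ite, mul_zero, Finset.sum_ite_eq', Finset.mem_univ, if_true]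
  field_simp [hX.1.ne']

theorem hasWeakPd_of_comp_cylProj {g : Eu 3 → Fin 3 → ℝ} (hw : IntegrableOn w (meridian Ω))
    (hg : ∀ i, IntegrableOn (fun x => g x i) Ω)
    (h : ∀ i, HasWeakPd Ω i (fun x => w (cylProj x)) (fun x => g x i)) (k : Fin 2) :
    HasWeakPd (meridian Ω) k w (fun X => meridianAverage g X k) := by
  have havg := D.integrableOn_meridianAverage hg
  refine hasWeakPd_of_integral_eq_zero hw.locallyIntegrableOn
    (havg k).locallyIntegrableOn fun ψ hψ => ?_
  have hlift := D.isTest_axiLift (isTest_radialQuotient hψ k)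
  have hgrad (i : Fin 3) := integrable_mul_isTest (h i).1 ((hlift.coord i).partialDeriv i)
  have hzero (i : Fin 3) := integrable_mul_isTest (h i).2.1 (hlift.coord i)
  have hΩ : (∫ x in Ω, ∑ i, w (cylProj x) *
        pd i (fun y => axiLift (radialQuotient ψ k) y i) x) +
      ∫ x in Ω, ∑ i, g x i * axiLift (radialQuotient ψ k) x i = 0 := by
    rw [integral_finsetSum _ fun i _ => hgrad i, integral_finsetSum _ fun i _ => hzero i,
      ← Finset.sum_add_distrib]
    refine Finset.sum_eq_zero fun i _ => ?_
    rw [← integral_add (hgrad i) (hzero i)]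
    exact (h i).integral_eq_zero (hlift.coord i)
  rw [D.integral_comp_cylProj_mul_div_axiLift_radialQuotient hw hψ,
    D.integral_mul_axiLift_radialQuotient hg hψ, ← mul_add,
    ← integral_add (integrable_mul_isTest hw.locallyIntegrableOn (hψ.partialDeriv k))
      (integrable_mul_isTest (havg k).locallyIntegrableOn hψ)] at hΩ
  exact (mul_eq_zero.1 hΩ).resolve_left Real.two_pi_pos.ne'

end IsAxiDomain

theorem conj_axiTensor {Q : Matrix (Fin 3) (Fin 3) ℝ} (hQ : Q * Q.transpose = 1)
    (A : Matrix (Fin 2) (Fin 2) ℝ) (q : ℝ) : Q * axiTensor Q A q * Q.transpose = axiBlock A q := by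
  calc Q * axiTensor Q A q * Q.transpose
      = Q * Q.transpose * axiBlock A q * (Q * Q.transpose) := by
        simp only [axiTensor, Matrix.mul_assoc]
    _ = axiBlock A q := by rw [hQ, Matrix.one_mul, Matrix.mul_one]

theorem axiBlock_castSucc (A : Matrix (Fin 2) (Fin 2) ℝ) (q : ℝ) (k l : Fin 2) :
    axiBlock A q k.castSucc l.castSucc = A k l := by
  fin_cases k <;> fin_cases l <;> rfl

theorem frame_mul_axiField (A : Eu 2 → Matrix (Fin 2) (Fin 2) ℝ) (q : Eu 2 → ℝ) {x : Eu 3}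
    (hx : 0 < cylRadius x) (a b : Fin 3) :
    ∑ j, frameAt x b j * ∑ i, frameAt x a i * axiField A q x i j =
      axiBlock (A (cylProj x)) (q (cylProj x)) a b := by
  obtain ⟨θ, -, hθ⟩ := exists_frameAt_eq_frame hx
  rw [← conj_axiTensor (hθ ▸ frame_mul_transpose θ) (A (cylProj x)), Matrix.mul_apply]
  simp only [axiField, Matrix.mul_apply, Matrix.transpose_apply, mul_comm]

theorem frame_angular_mul_axiLift (v : Eu 2 → Eu 2) {x : Eu 3} (hx : 0 < cylRadius x) :
    ∑ i, frameAt x 2 i * axiLift v x i = 0 := by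
  simp only [axiLift_apply, Fin.sum_univ_three, Fin.sum_univ_two]
  obtain ⟨θ, -, hQ⟩ := exists_frameAt_eq_frame hx
  simp only [hQ, frame]
  simp
  ring

namespace IsAxiDomain

variable {Ω : Set (Eu 3)} (D : IsAxiDomain Ω)
include D

theorem isFiniteMeasure_restrict_meridian : IsFiniteMeasure (volume.restrict (meridian Ω)) :=
  ⟨by rw [Measure.restrict_apply_univ]; exact D.isBounded_meridian.measure_lt_top⟩

theorem integrableOn_of_comp_cylProj {h : Eu 2 → ℝ}
    (hh : IntegrableOn (fun x => h (cylProj x)) Ω) : IntegrableOn h (meridian Ω) := by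
  refine Integrable.of_comp_fst (ν := angleMeasure) ((D.integrable_comp_cyl hh).congr ?_)
    angleMeasure_ne_zero
  filter_upwards [D.ae_cylMeasure_mem] with p hp
  rw [cylProj_cyl hp.1.le]

theorem memLp_two_of_comp_cylProj {h : Eu 2 → ℝ}
    (hh : MemLp (fun x => h (cylProj x)) 2 (volume.restrict Ω)) :
    MemLp h 2 (volume.restrict (meridian Ω)) := by
  have := D.isFiniteMeasure_restrict
  have hint : IntegrableOn h (meridian Ω) :=
    D.integrableOn_of_comp_cylProj (hh.integrable one_le_two)
  exact (memLp_two_iff_integrable_sq hint.aestronglyMeasurable).2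
    (D.integrableOn_of_comp_cylProj (h := fun X => h X ^ 2) hh.integrable_sq)

theorem memLp_frame_mul_weakGrad {u : Eu 3 → Eu 3} (hu : MemW12 Ω u) (k : Fin 2) (j : Fin 3) :
    MemLp (fun x => ∑ i, frameAt x k.castSucc i * weakGrad Ω u x i j) 2 (volume.restrict Ω) :=
  memLp_finsetSum _ fun i _ => D.memLp_frameAt_mul (hu.memLp_weakGrad D.isOpen i j) _ i

theorem integrable_frame_mul_weakGrad {u : Eu 3 → Eu 3} (hu : MemW12 Ω u) (k : Fin 2)
    (j : Fin 3) :
    IntegrableOn (fun x => ∑ i, frameAt x k.castSucc i * weakGrad Ω u x i j) Ω := by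
  have := D.isFiniteMeasure_restrict
  exact (D.memLp_frame_mul_weakGrad hu k j).integrable one_le_two

theorem isWeakGrad_axiLift {v : Eu 2 → Eu 2} {G : Eu 2 → Matrix (Fin 2) (Fin 2) ℝ}
    (hv : ∀ k, IntegrableOn (fun X => v X k) (meridian Ω))
    (hG : ∀ k l, IntegrableOn (fun X => G X k l) (meridian Ω))
    (h : IsWeakGrad (meridian Ω) v G) :
    IsWeakGrad Ω (axiLift v) (axiField G fun X => v X 0 / X 0) := by
  have hcomp (k : Fin 2) (j : Fin 3) := D.hasWeakPd_comp_cylProj (hv k)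
    (G := fun X => WithLp.toLp 2 (G X k)) (hG k) (h.hasWeakPd k) j
  refine isWeakGrad_of_hasWeakPd
    (fun i => (D.integrableOn_axiLift hv i).locallyIntegrableOn) fun i j => ?_
  have hsum := HasWeakPd.sum (s := Finset.univ) fun k _ => (hcomp k j).contDiffAt_mul D.isOpen
    fun x hx => contDiffAt_frameAt (D.cylRadius_pos hx) k.castSucc i
  refine hsum.congr_ae (ae_of_all _ fun x => (axiLift_apply v x i).symm) ?_
  filter_upwards [ae_restrict_mem D.isOpen.measurableSet] with x hx
  simp only [axiField, axiTensor_apply, axiLift_apply, Fin.sum_univ_two, Fin.castSucc_zero,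
    Fin.castSucc_one, pd_frameAt_radial (D.cylRadius_pos hx), pd_frameAt_vertical, cylProj_zero]
  ring

end IsAxiDomain

namespace IsProfile

variable {Ω : Set (Eu 3)} (D : IsAxiDomain Ω) {u : Eu 3 → Eu 3} {v : Eu 2 → Eu 2}
include D

theorem ae_comp_cylProj_eq (hv : IsProfile Ω u v) (k : Fin 2) :
    ∀ᵐ x ∂(volume.restrict Ω), ∑ i, frameAt x k.castSucc i * u x i = v (cylProj x) k := by
  filter_upwards [hv.1, ae_restrict_mem D.isOpen.measurableSet] with x hu hx
  rw [hu, frame_mul_axiLift v (D.cylRadius_pos hx)]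

theorem memLp (hv : IsProfile Ω u v) (hu : MemLp u 2 (volume.restrict Ω)) (k : Fin 2) :
    MemLp (fun X => v X k) 2 (volume.restrict (meridian Ω)) := by
  have hsum : MemLp (fun x => ∑ i, frameAt x k.castSucc i * u x i) 2 (volume.restrict Ω) :=
    memLp_finsetSum _ fun i _ => D.memLp_frameAt_mul (hu.eval_piLp i) _ i
  exact D.memLp_two_of_comp_cylProj (hsum.ae_eq (hv.ae_comp_cylProj_eq D k))

theorem hasWeakPd_comp_cylProj (hv : IsProfile Ω u v) {F : Eu 3 → Matrix (Fin 3) (Fin 3) ℝ}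
    (hF : IsWeakGrad Ω u F) (k : Fin 2) (j : Fin 3) :
    HasWeakPd Ω j (fun x => v (cylProj x) k) fun x => ∑ i, frameAt x k.castSucc i * F x i j := by
  have hsum := HasWeakPd.sum (s := Finset.univ) fun i _ =>
    (hF.hasWeakPd i j).contDiffAt_mul D.isOpen
      fun x hx => contDiffAt_frameAt (D.cylRadius_pos hx) k.castSucc i
  refine hsum.congr_ae (hv.ae_comp_cylProj_eq D k) ?_
  filter_upwards [hv.1, ae_restrict_mem D.isOpen.measurableSet] with x hu hx
  have hpos := D.cylRadius_pos hx
  have hortho : ∑ i, pd j (fun y => frameAt y k.castSucc i) x * u x i = 0 := by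
    fin_cases k
    · calc _ = frameAt x 2 j / cylRadius x * ∑ i, frameAt x 2 i * axiLift v x i := by
            simp only [Fin.zero_eta, Fin.castSucc_zero, pd_frameAt_radial hpos, hu,
              Finset.mul_sum]
            exact Finset.sum_congr rfl fun i _ => by ring
        _ = 0 := by rw [frame_angular_mul_axiLift v hpos, mul_zero]
    · simp [pd_frameAt_vertical]
  rw [Finset.sum_add_distrib, hortho, add_zero]

theorem isWeakGrad_meridianAverage (hv : IsProfile Ω u v) (hu : MemW12 Ω u) :
    IsWeakGrad (meridian Ω) v fun X => Matrix.of fun k l => meridianAverage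
      (fun x j => ∑ i, frameAt x k.castSucc i * weakGrad Ω u x i j) X l := by
  have := D.isFiniteMeasure_restrict
  have := D.isFiniteMeasure_restrict_meridian
  have hvint (k : Fin 2) : IntegrableOn (fun X => v X k) (meridian Ω) :=
    (hv.memLp D hu.1 k).integrable one_le_two
  exact isWeakGrad_of_hasWeakPd (fun k => (hvint k).locallyIntegrableOn) fun k l =>
    D.hasWeakPd_of_comp_cylProj (hvint k) (D.integrable_frame_mul_weakGrad hu k)
      (hv.hasWeakPd_comp_cylProj D hu.isWeakGrad k) l

theorem weakGrad_ae_eq_of_isWeakGrad (hv : IsProfile Ω u v) (hu : MemW12 Ω u)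
    {G : Eu 2 → Matrix (Fin 2) (Fin 2) ℝ} (hGint : ∀ k l, IntegrableOn (G · k l) (meridian Ω))
    (hG : IsWeakGrad (meridian Ω) v G) :
    ∀ᵐ x ∂(volume.restrict Ω), weakGrad Ω u x = axiField G (fun X => v X 0 / X 0) x := by
  have := D.isFiniteMeasure_restrict_meridian
  exact ((D.isWeakGrad_axiLift (fun k => (hv.memLp D hu.1 k).integrable one_le_two) hGint
    hG).congr_ae (hv.1.mono fun x hx => hx.symm)).weakGrad_ae_eq D.isOpen

theorem memW12 (hv : IsProfile Ω u v) (hu : MemW12 Ω u) : MemW12 (meridian Ω) v := by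
  set G : Eu 2 → Matrix (Fin 2) (Fin 2) ℝ := fun X => Matrix.of fun k l => meridianAverage
    (fun x j => ∑ i, frameAt x k.castSucc i * weakGrad Ω u x i j) X l
  have hG : IsWeakGrad (meridian Ω) v G := hv.isWeakGrad_meridianAverage D hu
  have hGint (k l : Fin 2) : IntegrableOn (fun X => G X k l) (meridian Ω) :=
    D.integrableOn_meridianAverage (D.integrable_frame_mul_weakGrad hu k) l
  refine ⟨memLp_piLp_iff.2 (hv.memLp D hu.1), G, hG,
    fun k l => D.memLp_two_of_comp_cylProj ?_⟩
  have hsum : MemLp (fun x => ∑ j, frameAt x l.castSucc j *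
      ∑ i, frameAt x k.castSucc i * weakGrad Ω u x i j) 2 (volume.restrict Ω) :=
    memLp_finsetSum _ fun j _ => D.memLp_frameAt_mul (D.memLp_frame_mul_weakGrad hu k j) _ j
  refine hsum.ae_eq ?_
  filter_upwards [hv.weakGrad_ae_eq_of_isWeakGrad D hu hGint hG,
    ae_restrict_mem D.isOpen.measurableSet] with x hx hxΩ
  rw [hx, frame_mul_axiField G _ (D.cylRadius_pos hxΩ), axiBlock_castSucc]

theorem weakGrad_ae_eq (hv : IsProfile Ω u v) (hu : MemW12 Ω u) :
    ∀ᵐ x ∂(volume.restrict Ω), weakGrad Ω u x =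
      axiField (weakGrad (meridian Ω) v) (fun X => v X 0 / X 0) x := by
  have := D.isFiniteMeasure_restrict_meridian
  have hvW := hv.memW12 D hu
  exact hv.weakGrad_ae_eq_of_isWeakGrad D hu
    (fun k l => (hvW.memLp_weakGrad D.isOpen_meridian k l).integrable one_le_two) hvW.isWeakGrad

end IsProfile

/-! ### Equivalence of the reduced and the full equations -/

/-- Stationarity of a tensor with respect to axisymmetric inner variations, the property that a
minimizer among axisymmetric maps yields directly. -/
def IsAxiStationary (Ω : Set (Eu 3)) (T : Eu 3 → Matrix (Fin 3) (Fin 3) ℝ) : Prop :=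
  ∀ ξ : Eu 2 → Eu 2, IsTest (meridian Ω) ξ →
    ∫ x in Ω, ∑ i, ∑ j, T x i j * jacobian (axiLift ξ) x i j = 0

section WeakForms

theorem radius_mul_inv_radius_mul {Ω : Set (Eu 3)} {ψ : Eu 2 → ℝ} (hψ : IsTest (meridian Ω) ψ) :
    (fun X => X 0 * ((X 0)⁻¹ * ψ X)) = ψ := by
  funext X
  by_cases hX : X ∈ meridian Ω
  · exact mul_inv_cancel_left₀ hX.1.ne' (ψ X)
  · simp [hψ.eq_zero_of_notMem hX]

theorem pd_one_div_radius_mul (η : Eu 2 → ℝ) {X : Eu 2} (hX : 0 < X 0) (k : Fin 2) :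
    pd k (fun Y => 1 / Y 0 * (Y 0 * η Y)) X = pd k η X := by
  have heq : (fun Y => 1 / Y 0 * (Y 0 * η Y)) =ᶠ[𝓝 X] η := by
    filter_upwards [eventually_pos_coord hX] with Y hY
    rw [one_div, inv_mul_cancel_left₀ hY.ne']
  rw [pd, pd, heq.fderiv_eq]

variable {Ω : Set (Eu 3)} (D : IsAxiDomain Ω) {a b c : Eu 2 → ℝ}
  (ha : IntegrableOn a (meridian Ω)) (hb : IntegrableOn b (meridian Ω))
  (hc : IntegrableOn c (meridian Ω))
include ha hb hc

theorem integrableOn_weakForm {η : Eu 2 → ℝ} (hη : IsTest (meridian Ω) η) :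
    IntegrableOn (fun X => X 0 * (a X * pd 0 η X + b X * pd 1 η X) + c X * η X)
      (meridian Ω) := by
  have hr (k : Fin 2) := isTest_radius_mul (hη.partialDeriv k)
  refine (((integrable_mul_isTest ha.locallyIntegrableOn (hr 0)).add
    (integrable_mul_isTest hb.locallyIntegrableOn (hr 1))).add
    (integrable_mul_isTest hc.locallyIntegrableOn hη)).congr <| .of_forall fun X => ?_
  simp only [Pi.add_apply]
  ring

include D

theorem integral_weakForm {η : Eu 2 → ℝ} (hη : IsTest (meridian Ω) η) :
    ∫ X in meridian Ω, (X 0 * (a X * pd 0 η X + b X * pd 1 η X) + c X * η X) =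
      (∫ X in meridian Ω, X 0 * a X * pd 0 (fun Y => 1 / Y 0 * (Y 0 * η Y)) X) +
        (∫ X in meridian Ω, b X * pd 1 (fun Y => Y 0 * η Y) X) +
        ∫ X in meridian Ω, 1 / X 0 * c X * (X 0 * η X) := by
  have hmer := D.isOpen_meridian.measurableSet
  have hr (k : Fin 2) := isTest_radius_mul (hη.partialDeriv k)
  have hsplit : ∫ X in meridian Ω, (X 0 * (a X * pd 0 η X + b X * pd 1 η X) + c X * η X) =
      (∫ X in meridian Ω, a X * (X 0 * pd 0 η X)) +
        (∫ X in meridian Ω, b X * (X 0 * pd 1 η X)) + ∫ X in meridian Ω, c X * η X := by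
    have h0 := integrable_mul_isTest ha.locallyIntegrableOn (hr 0)
    have h1 := integrable_mul_isTest hb.locallyIntegrableOn (hr 1)
    have h01 : IntegrableOn
        (fun X => a X * (X 0 * pd 0 η X) + b X * (X 0 * pd 1 η X)) (meridian Ω) := h0.add h1
    rw [← integral_add h0 h1, ← integral_add h01 (integrable_mul_isTest hc.locallyIntegrableOn hη)]
    exact integral_congr_ae <| .of_forall fun X => by simp only []; ring
  rw [hsplit]
  congr 1
  · congr 1 <;> refine setIntegral_congr_fun hmer fun X hX => ?_
    · simp only [pd_one_div_radius_mul η hX.1]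
      ring
    · simp only [pd_coord_mul 0 1 (hη.differentiable X), zero_ne_one, if_false, add_zero]
  · refine setIntegral_congr_fun hmer fun X hX => ?_
    have := hX.1.ne'
    field_simp

theorem distribEq_iff : DistribEq (meridian Ω) a b c ↔ ∀ η : Eu 2 → ℝ, IsTest (meridian Ω) η →
    ∫ X in meridian Ω, (X 0 * (a X * pd 0 η X + b X * pd 1 η X) + c X * η X) = 0 := by
  refine ⟨fun h η hη => ?_, fun h => ⟨ha.locallyIntegrableOn, hb.locallyIntegrableOn,
    hc.locallyIntegrableOn, fun ψ hψ => ?_⟩⟩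
  · rw [integral_weakForm D ha hb hc hη, ← h.2.2.2 _ (isTest_radius_mul hη)]
    ring
  · -- The substitution `ψ = r η` removes the singular weight `1 / r`.
    have hη := isTest_inv_radius_mul hψ
    have hzero := h _ hη
    rw [integral_weakForm D ha hb hc hη] at hzero
    simp only [congrFun (radius_mul_inv_radius_mul hψ)] at hzero
    linarith

end WeakForms

theorem jacobian_smul_const {m n : ℕ} {η : Eu m → ℝ} {x : Eu m} (h : DifferentiableAt ℝ η x)
    (c : Eu n) (i : Fin n) (j : Fin m) :
    jacobian (fun y => η y • c) x i j = pd j η x * c i := by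
  simp [jacobian, pd, fderiv_smul_const h]

namespace IsAxiDomain

variable {Ω : Set (Eu 3)} (D : IsAxiDomain Ω) {A : Eu 2 → Matrix (Fin 2) (Fin 2) ℝ}
  {q : Eu 2 → ℝ} (hA : ∀ k l, IntegrableOn (fun X => A X k l) (meridian Ω))
  (hq : IntegrableOn q (meridian Ω))
include D hA hq

theorem isAxiStationary_axiField_iff : IsAxiStationary Ω (axiField A q) ↔
    ∀ ξ : Eu 2 → Eu 2, IsTest (meridian Ω) ξ →
      ∫ X in meridian Ω, (X 0 * ∑ k, ∑ l, A X k l * jacobian ξ X k l + q X * ξ X 0) = 0 := by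
  refine forall₂_congr fun ξ hξ => ?_
  rw [D.integral_axiField_mul_jacobian_axiLift hA hq hξ, mul_eq_zero]
  exact or_iff_right (by positivity)

theorem isAxiStationary_axiField_of_distribEq
    (hr : DistribEq (meridian Ω) (fun X => A X 0 0) (fun X => A X 0 1) q)
    (hz : DistribEq (meridian Ω) (fun X => A X 1 0) (fun X => A X 1 1) fun _ => 0) :
    IsAxiStationary Ω (axiField A q) := by
  rw [D.isAxiStationary_axiField_iff hA hq]
  intro ξ hξ
  rw [distribEq_iff D (hA 0 0) (hA 0 1) hq] at hr
  rw [distribEq_iff D (hA 1 0) (hA 1 1) integrableOn_zero] at hz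
  rw [← add_zero (0 : ℝ)]
  nth_rw 1 [← hr _ (hξ.coord 0)]
  rw [← hz _ (hξ.coord 1),
    ← integral_add (integrableOn_weakForm (hA 0 0) (hA 0 1) hq (hξ.coord 0))
      (integrableOn_weakForm (hA 1 0) (hA 1 1) integrableOn_zero (hξ.coord 1))]
  refine integral_congr_ae <| .of_forall fun X => ?_
  simp only [Fin.sum_univ_two, jacobian_apply (hξ.differentiable X)]
  ring

theorem distribEq_of_isAxiStationary_axiField (h : IsAxiStationary Ω (axiField A q)) :
    DistribEq (meridian Ω) (fun X => A X 0 0) (fun X => A X 0 1) q ∧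
      DistribEq (meridian Ω) (fun X => A X 1 0) (fun X => A X 1 1) fun _ => 0 := by
  rw [D.isAxiStationary_axiField_iff hA hq] at h
  rw [distribEq_iff D (hA 0 0) (hA 0 1) hq, distribEq_iff D (hA 1 0) (hA 1 1) integrableOn_zero]
  have htest {η : Eu 2 → ℝ} (hη : IsTest (meridian Ω) η) (k : Fin 2) :
      IsTest (meridian Ω) fun X => η X • basisVec k :=
    hη.clm_comp (ContinuousLinearMap.toSpanSingleton ℝ (basisVec k))
  constructor <;> intro η hη
  · refine (integral_congr_ae <| .of_forall fun X => ?_).trans (h _ (htest hη 0))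
    simp [jacobian_smul_const (hη.differentiable X), basisVec]
  · refine (integral_congr_ae <| .of_forall fun X => ?_).trans (h _ (htest hη 1))
    simp [jacobian_smul_const (hη.differentiable X), basisVec]

theorem distribDivFree_axiField_of_isAxiStationary (h : IsAxiStationary Ω (axiField A q)) :
    DistribDivFree Ω (axiField A q) := by
  rw [D.isAxiStationary_axiField_iff hA hq] at h
  have hT (i j : Fin 3) : LocallyIntegrableOn (fun x => axiField A q x i j) Ω :=
    (D.integrableOn_axiField hA hq i j).locallyIntegrableOn
  refine ⟨hT, fun i φ hφ => ?_⟩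
  have hzero := D.integral_axiField_mul_pd_eq_zero (G := 0) hA hq (fun _ => integrableOn_zero)
    (fun ξ hξ => by simpa using h ξ hξ) i hφ
  rw [neg_eq_zero, ← integral_finsetSum _ fun j _ =>
    integrable_mul_isTest (hT i j) (hφ.partialDeriv j), ← hzero]
  simp [axiLift_apply]

end IsAxiDomain

theorem DistribDivFree.isAxiStationary {Ω : Set (Eu 3)} (D : IsAxiDomain Ω)
    {T : Eu 3 → Matrix (Fin 3) (Fin 3) ℝ} (h : DistribDivFree Ω T) : IsAxiStationary Ω T := by
  intro ξ hξ
  have hlift := D.isTest_axiLift hξ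
  have hint (i j : Fin 3) : IntegrableOn (fun x => T x i j * jacobian (axiLift ξ) x i j) Ω := by
    simp only [jacobian_apply (hlift.differentiable _)]
    exact integrable_mul_isTest (h.1 i j) ((hlift.coord i).partialDeriv j)
  rw [integral_finsetSum _ fun i _ => integrable_finsetSum _ fun j _ => hint i j]
  refine Finset.sum_eq_zero fun i _ => ?_
  rw [integral_finsetSum _ fun j _ => hint i j]
  simpa only [jacobian_apply (hlift.differentiable _), neg_eq_zero] using
    h.2 i _ (hlift.coord i)

/-! ### Growth of the stored energy -/

/-- A nonnegative `C¹` stored energy on `(0, ∞)` with `|t H'(t)| ≤ K (H(t) + 1)`, the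
one-dimensional form of Ball's growth condition for inner variations. -/
structure HasControlledGrowth (H : ℝ → ℝ) : Prop where
  nonneg : ∀ t, 0 < t → 0 ≤ H t
  contDiffOn : ContDiffOn ℝ 1 H (Set.Ioi 0)
  exists_bound : ∃ K, ∀ t, 0 < t → |deriv H t| * t ≤ K * (H t + 1)

namespace HasControlledGrowth

variable {H : ℝ → ℝ} (hH : HasControlledGrowth H)
include hH

theorem differentiableAt {t : ℝ} (ht : 0 < t) : DifferentiableAt ℝ H t :=
  (hH.contDiffOn.differentiableOn one_ne_zero).differentiableAt (Ioi_mem_nhds ht)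

theorem aestronglyMeasurable_comp {α : Type*} [MeasurableSpace α] {μ : Measure α} {f : α → ℝ}
    (hf : AEStronglyMeasurable f μ) (hpos : ∀ᵐ x ∂μ, 0 < f x) :
    AEStronglyMeasurable (fun x => H (f x)) μ := by
  classical
  have hmeas : Measurable ((Set.Ioi 0).piecewise H 0) :=
    hH.contDiffOn.continuousOn.measurable_piecewise continuousOn_const measurableSet_Ioi
  refine (hmeas.comp_aemeasurable hf.aemeasurable).aestronglyMeasurable.congr ?_
  filter_upwards [hpos] with x hx using Set.piecewise_eq_of_mem _ _ _ hx

/-- Gronwall: the hypothesis bounds the derivative of `log (H + 1)` as a function of `log t`. -/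
theorem exists_scaling_bound : ∃ K, ∀ t a, 0 < t → 0 < a →
    H a + 1 ≤ Real.exp (K * |Real.log a - Real.log t|) * (H t + 1) := by
  obtain ⟨K, hK⟩ := hH.exists_bound
  have hpos (s : ℝ) : 0 < H (Real.exp s) + 1 := by
    linarith [hH.nonneg _ (Real.exp_pos s)]
  have hderiv (s : ℝ) : HasDerivAt (fun s => Real.log (H (Real.exp s) + 1))
      (deriv H (Real.exp s) * Real.exp s / (H (Real.exp s) + 1)) s :=
    (((hH.differentiableAt (Real.exp_pos s)).hasDerivAt.comp s
      (Real.hasDerivAt_exp s)).add_const 1).log (hpos s).ne'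
  have hbound (s : ℝ) :
      ‖deriv H (Real.exp s) * Real.exp s / (H (Real.exp s) + 1)‖ ≤ K := by
    rw [Real.norm_eq_abs, abs_div, abs_mul, Real.abs_exp, abs_of_pos (hpos s),
      div_le_iff₀ (hpos s)]
    exact hK _ (Real.exp_pos s)
  refine ⟨K, fun t a ht ha => ?_⟩
  have hlip := convex_univ.norm_image_sub_le_of_norm_hasDerivWithin_le
    (fun s _ => (hderiv s).hasDerivWithinAt) (fun s _ => hbound s)
    (Set.mem_univ (Real.log t)) (Set.mem_univ (Real.log a))
  have hpos' {b : ℝ} (hb : 0 < b) : 0 < H b + 1 := by linarith [hH.nonneg b hb]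
  simp only [Real.exp_log ht, Real.exp_log ha, Real.norm_eq_abs] at hlip
  rw [← Real.log_le_log_iff (hpos' ha) (by have := hpos' ht; positivity),
    Real.log_mul (Real.exp_ne_zero _) (hpos' ht).ne', Real.log_exp]
  linarith [le_abs_self (Real.log (H a + 1) - Real.log (H t + 1))]

theorem exists_comparable_bound : ∃ C, 0 ≤ C ∧ ∀ t a, 0 < t → t / 2 ≤ a → a ≤ 2 * t →
    |deriv H a| * a ≤ C * (1 + H t) ∧ |H a| ≤ C * (1 + H t) := by
  obtain ⟨L, hL⟩ := hH.exists_scaling_bound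
  obtain ⟨K, hK⟩ := hH.exists_bound
  refine ⟨(|K| + 1) * Real.exp (|L| * Real.log 2), by positivity, fun t a ht hta hat => ?_⟩
  have ha : 0 < a := by linarith
  have hHa := hH.nonneg a ha
  have hHt := hH.nonneg t ht
  have hlog : |Real.log a - Real.log t| ≤ Real.log 2 := by
    have hlower := Real.log_le_log (by positivity) hta
    have hupper := Real.log_le_log ha hat
    rw [Real.log_div ht.ne' two_ne_zero] at hlower
    rw [Real.log_mul two_ne_zero ht.ne'] at hupper
    exact abs_le.2 ⟨by linarith, by linarith⟩
  have hscale : H a + 1 ≤ Real.exp (|L| * Real.log 2) * (1 + H t) := by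
    refine (hL t a ht ha).trans ?_
    rw [add_comm 1]
    gcongr
    exact le_abs_self L
  have hmul : (|K| + 1) * (H a + 1) ≤ (|K| + 1) * Real.exp (|L| * Real.log 2) * (1 + H t) := by
    rw [mul_assoc]
    gcongr
  constructor
  · nlinarith [hK a ha, le_abs_self K, abs_nonneg K]
  · rw [abs_of_nonneg hHa]
    nlinarith [abs_nonneg K]

end HasControlledGrowth

namespace IsStoredEnergy

variable {H : ℝ → ℝ} (hH : IsStoredEnergy H)
include hH

theorem exists_bound_near_zero : ∃ K d : ℝ, 0 < d ∧
    ∀ t, 0 < t → t < d → |deriv H t| * t ≤ K * H t := by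
  obtain ⟨s, c₁, c₂, d, -, hc₁, hc₂, hd, hgrowth⟩ := hH.growth_zero
  refine ⟨c₂ / c₁, d, hd, fun t ht htd => ?_⟩
  obtain ⟨⟨hlower, -⟩, hneg, hupper⟩ := hgrowth t ht htd
  have hderiv : |deriv H t| = -deriv H t :=
    abs_of_nonpos (by linarith [show 0 < c₁ * t ^ (-s - 1) by positivity])
  calc |deriv H t| * t ≤ c₂ * t ^ (-s - 1) * t := by rw [hderiv]; gcongr
    _ = c₂ / c₁ * (c₁ * t ^ (-s)) := by
      rw [Real.rpow_sub_one ht.ne']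
      field_simp
    _ ≤ c₂ / c₁ * H t := by gcongr

/-- Convexity at `t / 2` turns the growth of `H'` into a lower bound for `H`. -/
theorem half_mul_deriv_half_le {t : ℝ} (ht : 0 < t) : t / 2 * deriv H (t / 2) ≤ H t := by
  have hhalf : 0 < t / 2 := by positivity
  have hdiff : DifferentiableAt ℝ H (t / 2) :=
    (hH.contDiffOn.differentiableOn one_ne_zero).differentiableAt (Ioi_mem_nhds hhalf)
  have hslope := hH.convex.deriv_le_slope hhalf ht (by linarith) hdiff
  rw [slope_def_field, le_div_iff₀ (by linarith)] at hslope
  linarith [hH.nonneg _ hhalf]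

theorem exists_bound_near_infty : ∃ K d : ℝ, ∀ t, d < t → |deriv H t| * t ≤ K * H t := by
  obtain ⟨τ, c₃, c₄, d, -, hc₃, hc₄, hd, hgrowth⟩ := hH.growth_infty
  refine ⟨2 ^ (τ + 1) * 2 * c₄ / c₃, 2 * d, fun t htd => ?_⟩
  have ht : 0 < t := by linarith
  obtain ⟨hpos, hupper⟩ := hgrowth t (by linarith)
  have hlower : t / 2 * (c₃ * (t / 2) ^ (τ + 1)) ≤ H t :=
    (by gcongr; exact (hgrowth (t / 2) (by linarith)).1 :
      _ ≤ t / 2 * deriv H (t / 2)).trans (hH.half_mul_deriv_half_le ht)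
  have hderiv : |deriv H t| = deriv H t :=
    abs_of_nonneg (by linarith [show 0 < c₃ * t ^ (τ + 1) by positivity])
  calc |deriv H t| * t ≤ c₄ * t ^ (τ + 1) * t := by rw [hderiv]; gcongr
    _ = 2 ^ (τ + 1) * 2 * c₄ / c₃ * (t / 2 * (c₃ * (t / 2) ^ (τ + 1))) := by
      rw [Real.div_rpow ht.le zero_le_two]
      field_simp
    _ ≤ 2 ^ (τ + 1) * 2 * c₄ / c₃ * H t := by gcongr

theorem hasControlledGrowth : HasControlledGrowth H := by
  refine ⟨hH.nonneg, hH.contDiffOn, ?_⟩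
  obtain ⟨K₀, d₀, hd₀, hzero⟩ := hH.exists_bound_near_zero
  obtain ⟨K₁, d₁, hinfty⟩ := hH.exists_bound_near_infty
  have hcont : ContinuousOn (fun t => deriv H t * t) (Set.Icc d₀ d₁) :=
    ((hH.contDiffOn.continuousOn_deriv_of_isOpen isOpen_Ioi le_rfl).mono
      fun t ht => hd₀.trans_le ht.1).mul continuousOn_id
  obtain ⟨K₂, hmid⟩ := isCompact_Icc.exists_bound_of_continuousOn hcont
  refine ⟨|K₀| + |K₁| + |K₂|, fun t ht => ?_⟩
  have hHt := hH.nonneg t ht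
  have h₀ := abs_nonneg K₀
  have h₁ := abs_nonneg K₁
  have h₂ := abs_nonneg K₂
  rcases lt_or_ge t d₀ with htd | htd
  · nlinarith [hzero t ht htd, le_abs_self K₀]
  rcases lt_or_ge d₁ t with htd' | htd'
  · nlinarith [hinfty t htd', le_abs_self K₁]
  · have hbound := hmid t ⟨htd, htd'⟩
    rw [Real.norm_eq_abs, abs_mul, abs_of_pos ht] at hbound
    nlinarith [le_abs_self K₂]

end IsStoredEnergy

/-! ### The energy-momentum tensor -/

section AxiTensorAlgebra

variable {Q : Matrix (Fin 3) (Fin 3) ℝ} (A : Matrix (Fin 2) (Fin 2) ℝ) (q : ℝ)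

theorem det_axiTensor (hQ : Q * Q.transpose = 1) : (axiTensor Q A q).det = q * A.det := by
  have hdet : Q.transpose.det * Q.det = 1 := by
    rw [mul_comm, ← Matrix.det_mul, hQ, Matrix.det_one]
  rw [axiTensor, Matrix.det_mul, Matrix.det_mul, mul_right_comm, hdet, one_mul]
  simp [axiBlock, Matrix.det_fin_three, Matrix.det_fin_two]
  ring

theorem frobSq_axiTensor (hQ : Q * Q.transpose = 1) :
    frobSq (axiTensor Q A q) = frobSq A + q ^ 2 := by
  simpa only [frobSq, sq] using sum_axiTensor_mul_axiTensor A A q q hQ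

theorem transpose_axiTensor_mul_axiTensor (hQ : Q * Q.transpose = 1) :
    (axiTensor Q A q).transpose * axiTensor Q A q = axiTensor Q (A.transpose * A) (q ^ 2) := by
  have hblock : (axiBlock A q).transpose * axiBlock A q = axiBlock (A.transpose * A) (q ^ 2) := by
    ext i j
    fin_cases i <;> fin_cases j <;>
      simp [axiBlock, Matrix.mul_apply, Fin.sum_univ_three, Fin.sum_univ_two, sq]
  calc (axiTensor Q A q).transpose * axiTensor Q A q
      = Q.transpose * (axiBlock A q).transpose * (Q * Q.transpose) * axiBlock A q * Q := by
        simp only [axiTensor, Matrix.transpose_mul, Matrix.transpose_transpose, Matrix.mul_assoc]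
    _ = axiTensor Q (A.transpose * A) (q ^ 2) := by
        rw [hQ, Matrix.mul_one, axiTensor, ← hblock]
        simp only [Matrix.mul_assoc]

theorem smul_axiTensor_add_smul_one (hQ : Q.transpose * Q = 1) (a c : ℝ) :
    a • axiTensor Q A q + c • (1 : Matrix (Fin 3) (Fin 3) ℝ) =
      axiTensor Q (a • A + c • (1 : Matrix (Fin 2) (Fin 2) ℝ)) (a * q + c) := by
  rw [← axiTensor_smul_one c hQ]
  ext i j
  simp only [axiTensor_apply, Matrix.add_apply, Matrix.smul_apply, smul_eq_mul, Fin.sum_univ_two]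
  ring

end AxiTensorAlgebra

/-- The block of the energy-momentum tensor in the directions `e_r`, `e_z`; the remaining
diagonal entry is `coeffTT`. -/
def reducedTensor (H : ℝ → ℝ) (Ω : Set (Eu 3)) (v : Eu 2 → Eu 2) (X : Eu 2) :
    Matrix (Fin 2) (Fin 2) ℝ :=
  !![coeffRR H Ω v X, 2 * drDotDz Ω v X; 2 * drDotDz Ω v X, coeffZZ H Ω v X]

theorem IsProfile.energyMomentum_ae_eq {Ω : Set (Eu 3)} (D : IsAxiDomain Ω) {u : Eu 3 → Eu 3}
    {v : Eu 2 → Eu 2} (hv : IsProfile Ω u v) (hu : MemW12 Ω u) (H : ℝ → ℝ) :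
    energyMomentum H Ω u =ᵐ[volume.restrict Ω]
      axiField (reducedTensor H Ω v) (coeffTT H Ω v) := by
  filter_upwards [hv.weakGrad_ae_eq D hu, ae_restrict_mem D.isOpen.measurableSet] with x hx hxΩ
  obtain ⟨θ, -, hθ⟩ := exists_frameAt_eq_frame (D.cylRadius_pos hxΩ)
  have hQ := frame_mul_transpose θ
  simp only [energyMomentum, hx, axiField, hθ, det_axiTensor _ _ hQ, frobSq_axiTensor _ _ hQ,
    transpose_axiTensor_mul_axiTensor _ _ hQ,
    smul_axiTensor_add_smul_one _ _ (transpose_mul_frame θ)]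
  congr 1
  · ext k l
    fin_cases k <;> fin_cases l <;>
      simp [reducedTensor, coeffRR, coeffZZ, drDotDz, drSq, dzSq, redPressure, redDet, frobSq,
        Matrix.mul_apply] <;> ring
  · simp only [coeffTT, drSq, dzSq, redPressure, redDet, frobSq, Fin.sum_univ_two]
    ring

section Integrability

variable {n : ℕ} {U : Set (Eu n)} {u : Eu n → Eu n}

theorem integrableOn_frobSq_weakGrad (hU : IsOpen U) (hu : MemW12 U u) :
    IntegrableOn (fun x => frobSq (weakGrad U u x)) U :=
  integrable_finsetSum _ fun i _ => integrable_finsetSum _ fun j _ =>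
    (hu.memLp_weakGrad hU i j).integrable_sq

theorem aestronglyMeasurable_det {α : Type*} [MeasurableSpace α] {μ : Measure α}
    {F : α → Matrix (Fin n) (Fin n) ℝ}
    (hF : ∀ i j, AEStronglyMeasurable (fun x => F x i j) μ) :
    AEStronglyMeasurable (fun x => (F x).det) μ := by
  simp only [Matrix.det_apply']
  exact Finset.aestronglyMeasurable_fun_sum _ fun σ _ => aestronglyMeasurable_const.mul <|
    Finset.aestronglyMeasurable_fun_prod _ fun _ _ => hF _ _

theorem aestronglyMeasurable_det_weakGrad (hU : IsOpen U) (hu : MemW12 U u) :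
    AEStronglyMeasurable (fun x => (weakGrad U u x).det) (volume.restrict U) :=
  aestronglyMeasurable_det fun i j => (hu.memLp_weakGrad hU i j).aestronglyMeasurable

end Integrability

namespace HasControlledGrowth

variable {H : ℝ → ℝ} (hH : HasControlledGrowth H) {Ω : Set (Eu 3)} {u : Eu 3 → Eu 3}
  (hΩ : IsOpen Ω) (hu : MemW12 Ω u)
  (hdet : ∀ᵐ x ∂(volume.restrict Ω), 0 < (weakGrad Ω u x).det) (hE : energy H Ω u < ⊤)
include hH hΩ hu hdet hE

theorem integrableOn_storedEnergy : IntegrableOn (fun x => H (weakGrad Ω u x).det) Ω := by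
  refine ⟨hH.aestronglyMeasurable_comp (aestronglyMeasurable_det_weakGrad hΩ hu) hdet, ?_⟩
  rw [hasFiniteIntegral_iff_norm]
  refine (lintegral_mono_ae ?_).trans_lt hE
  filter_upwards [hdet] with x hx
  rw [Real.norm_of_nonneg (hH.nonneg _ hx)]
  exact ENNReal.ofReal_le_ofReal (by linarith [frobSq_nonneg (weakGrad Ω u x)])

variable [IsFiniteMeasure (volume.restrict Ω)]

theorem integrableOn_deriv_mul :
    IntegrableOn (fun x => deriv H (weakGrad Ω u x).det * (weakGrad Ω u x).det) Ω := by
  obtain ⟨K, hK⟩ := hH.exists_bound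
  have hmeas := aestronglyMeasurable_det_weakGrad hΩ hu
  have hbound : IntegrableOn (fun x => K * (H (weakGrad Ω u x).det + 1)) Ω :=
    ((hH.integrableOn_storedEnergy hΩ hu hdet hE).add (integrable_const 1)).const_mul K
  refine hbound.mono' (((measurable_deriv H).comp_aemeasurable
    hmeas.aemeasurable).aestronglyMeasurable.mul hmeas) ?_
  filter_upwards [hdet] with x hx
  rw [Real.norm_eq_abs, abs_mul, abs_of_pos hx]
  exact hK _ hx

theorem integrableOn_energyMomentum (i j : Fin 3) :
    IntegrableOn (fun x => energyMomentum H Ω u x i j) Ω := by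
  have hquad : IntegrableOn
      (fun x => 2 * ∑ k, weakGrad Ω u x k i * weakGrad Ω u x k j) Ω :=
    (integrable_finsetSum _ fun k _ => (hu.memLp_weakGrad hΩ k i).integrable_mul
      (hu.memLp_weakGrad hΩ k j)).const_mul 2
  have hscalar := ((hH.integrableOn_deriv_mul hΩ hu hdet hE).sub
    (integrableOn_frobSq_weakGrad hΩ hu)).sub (hH.integrableOn_storedEnergy hΩ hu hdet hE)
  exact hquad.add (hscalar.mul_const ((1 : Matrix (Fin 3) (Fin 3) ℝ) i j))

end HasControlledGrowth

theorem IsAxiDomain.integrableOn_of_axiField {Ω : Set (Eu 3)} (D : IsAxiDomain Ω)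
    {A : Eu 2 → Matrix (Fin 2) (Fin 2) ℝ} {q : Eu 2 → ℝ}
    (h : ∀ i j, IntegrableOn (fun x => axiField A q x i j) Ω) (a b : Fin 3) :
    IntegrableOn (fun X => axiBlock (A X) (q X) a b) (meridian Ω) := by
  have hconj : IntegrableOn
      (fun x => ∑ j, frameAt x b j * ∑ i, frameAt x a i * axiField A q x i j) Ω :=
    integrable_finsetSum _ fun j _ => D.integrable_frameAt_mul
      (integrable_finsetSum _ fun i _ => D.integrable_frameAt_mul (h i j) a i) b j
  exact D.integrableOn_of_comp_cylProj <|
    hconj.congr_fun (fun x hx => frame_mul_axiField A q (D.cylRadius_pos hx) a b)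
      D.isOpen.measurableSet

theorem DistribDivFree.congr_ae {n : ℕ} {U : Set (Eu n)} {T S : Eu n → Matrix (Fin n) (Fin n) ℝ}
    (h : DistribDivFree U T) (hTS : T =ᵐ[volume.restrict U] S) : DistribDivFree U S := by
  have hentry (i j : Fin n) : (fun x => T x i j) =ᵐ[volume.restrict U] fun x => S x i j :=
    hTS.mono fun x hx => by simp only [hx]
  refine ⟨fun i j => (h.1 i j).congr (hentry i j), fun i φ hφ => ?_⟩
  rw [← h.2 i φ hφ]
  refine congrArg Neg.neg <| Finset.sum_congr rfl fun j _ => integral_congr_ae ?_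
  filter_upwards [hTS] with x hx
  rw [hx]

theorem IsAxiStationary.congr_ae {Ω : Set (Eu 3)} {T S : Eu 3 → Matrix (Fin 3) (Fin 3) ℝ}
    (h : IsAxiStationary Ω T) (hTS : T =ᵐ[volume.restrict Ω] S) : IsAxiStationary Ω S := by
  intro ξ hξ
  rw [← h ξ hξ]
  refine integral_congr_ae ?_
  filter_upwards [hTS] with x hx
  rw [hx]

theorem reducedEquations_tfae {H : ℝ → ℝ} (hH : HasControlledGrowth H) {Ω : Set (Eu 3)}
    (D : IsAxiDomain Ω) {u : Eu 3 → Eu 3} (hu : MemW12 Ω u)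
    (hdet : ∀ᵐ x ∂(volume.restrict Ω), 0 < (weakGrad Ω u x).det) (hE : energy H Ω u < ⊤)
    {v : Eu 2 → Eu 2} (hv : IsProfile Ω u v) :
    List.TFAE [ReducedEquations H Ω v, DistribDivFree Ω (energyMomentum H Ω u),
      IsAxiStationary Ω (energyMomentum H Ω u)] := by
  have := D.isFiniteMeasure_restrict
  have hT := hv.energyMomentum_ae_eq D hu H
  have hblock := D.integrableOn_of_axiField (A := reducedTensor H Ω v) (q := coeffTT H Ω v)
    fun i j => (hH.integrableOn_energyMomentum D.isOpen hu hdet hE i j).congr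
      (hT.mono fun x hx => by simp only [hx])
  have hA (k l : Fin 2) : IntegrableOn (fun X => reducedTensor H Ω v X k l) (meridian Ω) := by
    simpa only [axiBlock_castSucc] using hblock k.castSucc l.castSucc
  have hq : IntegrableOn (coeffTT H Ω v) (meridian Ω) := hblock 2 2
  tfae_have 1 → 3 := fun h =>
    (D.isAxiStationary_axiField_of_distribEq hA hq h.1 h.2).congr_ae hT.symm
  tfae_have 3 → 1 := fun h => D.distribEq_of_isAxiStationary_axiField hA hq (h.congr_ae hT)
  tfae_have 3 → 2 := fun h =>
    (D.distribDivFree_axiField_of_isAxiStationary hA hq (h.congr_ae hT)).congr_ae hT.symm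
  tfae_have 2 → 3 := fun h => h.isAxiStationary D
  tfae_finish

/-! ### Inner variations of the domain -/

section Jacobian

variable {l m n : ℕ}

theorem det_fderiv (ψ : Eu n → Eu n) (x : Eu n) :
    (fderiv ℝ ψ x).det = (jacobian ψ x).det := by
  have hmatrix : LinearMap.toMatrix (EuclideanSpace.basisFun (Fin n) ℝ).toBasis
      (EuclideanSpace.basisFun (Fin n) ℝ).toBasis (fderiv ℝ ψ x : Eu n →ₗ[ℝ] Eu n) =
      jacobian ψ x := by
    ext i j
    simp [LinearMap.toMatrix_apply, jacobian, basisVec]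
  rw [← hmatrix, LinearMap.det_toMatrix]

theorem pd_comp {φ : Eu n → ℝ} {g : Eu m → Eu n} {x : Eu m}
    (hφ : DifferentiableAt ℝ φ (g x)) (hg : DifferentiableAt ℝ g x) (k : Fin m) :
    pd k (fun y => φ (g y)) x = ∑ j, pd j φ (g x) * jacobian g x j k := by
  have hcomp : fderiv ℝ (fun y => φ (g y)) x = (fderiv ℝ φ (g x)).comp (fderiv ℝ g x) :=
    fderiv_comp x hφ hg
  rw [pd, hcomp, ContinuousLinearMap.comp_apply, fderiv_eq_sum_pd]
  exact Finset.sum_congr rfl fun j _ => mul_comm _ _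

theorem jacobian_comp {f : Eu m → Eu n} {g : Eu l → Eu m} {x : Eu l}
    (hf : DifferentiableAt ℝ f (g x)) (hg : DifferentiableAt ℝ g x) :
    jacobian (fun y => f (g y)) x = jacobian f (g x) * jacobian g x := by
  ext i k
  rw [jacobian_apply (hf.fun_comp' x hg), Matrix.mul_apply,
    pd_comp (φ := fun z => f z i) (differentiableAt_euclidean.1 hf i) hg]
  simp only [jacobian_apply hf]

theorem jacobian_id (x : Eu n) : jacobian (fun y : Eu n => y) x = 1 := by
  ext i j
  simp [jacobian, basisVec, Matrix.one_apply]

theorem continuous_jacobian {h : Eu m → Eu n} (hh : ContDiff ℝ 1 h) :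
    Continuous (jacobian h) := by
  have hderiv (j : Fin m) : Continuous fun x => fderiv ℝ h x (basisVec j) :=
    (hh.continuous_fderiv one_ne_zero).clm_apply continuous_const
  exact continuous_pi fun i => continuous_pi fun j =>
    (PiLp.continuous_apply 2 (fun _ : Fin n => ℝ) i).comp (hderiv j)

theorem contDiff_jacobian {f : Eu m → Eu n} (hf : ContDiff ℝ ∞ f) (i : Fin n) (j : Fin m) :
    ContDiff ℝ ∞ (fun x => jacobian f x i j) :=
  contDiff_euclidean.1 ((hf.fderiv_right (m := ∞) (by simp)).clm_apply contDiff_const) i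

theorem contDiff_det_jacobian {ψ : Eu n → Eu n} (hψ : ContDiff ℝ ∞ ψ) :
    ContDiff ℝ ∞ (fun x => (jacobian ψ x).det) := by
  simp only [Matrix.det_apply']
  exact ContDiff.sum fun σ _ => contDiff_const.mul
    (contDiff_prod fun i _ => contDiff_jacobian hψ (σ i) i)

end Jacobian

/-- `ψ` is a diffeomorphism of `ℝⁿ` with inverse `χ` and positive Jacobian determinant that is the
identity outside a compact subset of `Ω`: the changes of variables in `Ω` that compete in an inner
variation. -/
structure IsInnerDiffeo {n : ℕ} (Ω : Set (Eu n)) (ψ χ : Eu n → Eu n) : Prop where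
  contDiff : ContDiff ℝ ∞ ψ
  contDiff_inv : ContDiff ℝ ∞ χ
  left_inv : ∀ x, χ (ψ x) = x
  right_inv : ∀ x, ψ (χ x) = x
  compact : ∃ K : Set (Eu n), IsCompact K ∧ K ⊆ Ω ∧ ∀ x ∉ K, ψ x = x
  det_pos : ∀ x, 0 < (jacobian ψ x).det

namespace IsInnerDiffeo

variable {n : ℕ} {Ω : Set (Eu n)} {ψ χ : Eu n → Eu n} (P : IsInnerDiffeo Ω ψ χ)
include P

theorem differentiable : Differentiable ℝ ψ := P.contDiff.differentiable (by simp)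

theorem differentiable_inv : Differentiable ℝ χ := P.contDiff_inv.differentiable (by simp)

theorem jacobian_mul (x : Eu n) : jacobian χ (ψ x) * jacobian ψ x = 1 := by
  rw [← jacobian_comp (P.differentiable_inv _) (P.differentiable _)]
  simp only [P.left_inv]
  exact jacobian_id x

theorem symm : IsInnerDiffeo Ω χ ψ where
  contDiff := P.contDiff_inv
  contDiff_inv := P.contDiff
  left_inv := P.right_inv
  right_inv := P.left_inv
  compact := P.compact.imp fun K h => ⟨h.1, h.2.1, fun x hx => by
    rw [← h.2.2 x hx, P.left_inv, h.2.2 x hx]⟩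
  det_pos y := by
    have hmul := congrArg Matrix.det (P.jacobian_mul (χ y))
    rw [P.right_inv, Matrix.det_mul, Matrix.det_one] at hmul
    exact pos_of_mul_pos_left (hmul ▸ one_pos) (P.det_pos (χ y)).le

theorem injective : Function.Injective ψ := Function.LeftInverse.injective P.left_inv

theorem mem_iff (x : Eu n) : ψ x ∈ Ω ↔ x ∈ Ω := by
  obtain ⟨K, -, hKΩ, hK⟩ := P.compact
  by_cases hx : x ∈ K
  · refine iff_of_true (by_contra fun hψx => ?_) (hKΩ hx)
    rw [P.injective (hK (ψ x) fun h => hψx (hKΩ h))] at hψx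
    exact hψx (hKΩ hx)
  · rw [hK x hx]

theorem image_eq : ψ '' Ω = Ω :=
  Set.Subset.antisymm (Set.image_subset_iff.2 fun x hx => (P.mem_iff x).2 hx)
    fun y hy => ⟨χ y, (P.symm.mem_iff y).2 hy, P.right_inv y⟩

theorem abs_det (x : Eu n) : |(fderiv ℝ ψ x).det| = (jacobian ψ x).det := by
  rw [det_fderiv, abs_of_pos (P.det_pos x)]

theorem hasFDerivWithinAt (s : Set (Eu n)) (x : Eu n) :
    HasFDerivWithinAt ψ (fderiv ℝ ψ x) s x :=
  (P.differentiable x).hasFDerivAt.hasFDerivWithinAt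

theorem integral_eq (hΩ : MeasurableSet Ω) (f : Eu n → ℝ) :
    ∫ y in Ω, f y = ∫ x in Ω, (jacobian ψ x).det * f (ψ x) := by
  have := integral_image_eq_integral_abs_det_fderiv_smul volume hΩ
    (fun x _ => P.hasFDerivWithinAt Ω x) P.injective.injOn f
  rw [P.image_eq] at this
  simpa only [P.abs_det, smul_eq_mul] using this

theorem lintegral_eq (hΩ : MeasurableSet Ω) (f : Eu n → ENNReal) :
    ∫⁻ y in Ω, f y = ∫⁻ x in Ω, ENNReal.ofReal (jacobian ψ x).det * f (ψ x) := by
  have := lintegral_image_eq_lintegral_abs_det_fderiv_mul volume hΩ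
    (fun x _ => P.hasFDerivWithinAt Ω x) P.injective.injOn f
  rw [P.image_eq] at this
  simpa only [P.abs_det] using this

theorem integrableOn_iff {s : Set (Eu n)} (hs : MeasurableSet s) (f : Eu n → ℝ) :
    IntegrableOn f (ψ '' s) ↔ IntegrableOn (fun x => (jacobian ψ x).det * f (ψ x)) s := by
  simpa only [P.abs_det, smul_eq_mul] using
    integrableOn_image_iff_integrableOn_abs_det_fderiv_smul volume hs
      (fun x _ => P.hasFDerivWithinAt s x) P.injective.injOn f

theorem map_eq (hΩ : MeasurableSet Ω) : Measure.map χ (volume.restrict Ω) =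
    (volume.restrict Ω).withDensity fun x => ENNReal.ofReal (jacobian ψ x).det := by
  have h := map_withDensity_abs_det_fderiv_eq_addHaar volume hΩ.nullMeasurableSet
    (fun x _ => P.hasFDerivWithinAt Ω x) P.injective.injOn
  rw [P.image_eq] at h
  conv_lhs => rw [← h]
  rw [Measure.map_map P.contDiff_inv.continuous.measurable P.contDiff.continuous.measurable,
    show χ ∘ ψ = id from funext P.left_inv, Measure.map_id]
  simp only [P.abs_det]

theorem quasiMeasurePreserving_inv (hΩ : MeasurableSet Ω) :
    Measure.QuasiMeasurePreserving χ (volume.restrict Ω) (volume.restrict Ω) :=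
  ⟨P.contDiff_inv.continuous.measurable, by
    rw [P.map_eq hΩ]
    exact withDensity_absolutelyContinuous _ _⟩

theorem exists_abs_le {f : Matrix (Fin n) (Fin n) ℝ → ℝ} (hf : Continuous f) :
    ∃ C, ∀ x, |f (jacobian ψ x)| ≤ C := by
  obtain ⟨K, hK, -, hid⟩ := P.compact
  obtain ⟨C, hC⟩ := hK.exists_bound_of_continuousOn
    (hf.comp (continuous_jacobian (P.contDiff.of_le (by simp)))).continuousOn
  refine ⟨max C |f 1|, fun x => ?_⟩
  by_cases hx : x ∈ K
  · exact (hC x hx).trans (le_max_left _ _)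
  · have hnear : ψ =ᶠ[𝓝 x] fun y => y :=
      Filter.mem_of_superset (hK.isClosed.isOpen_compl.mem_nhds hx) hid
    have hone : jacobian ψ x = 1 := by
      rw [← jacobian_id x]
      simp only [jacobian, hnear.fderiv_eq]
    rw [hone]
    exact le_max_right _ _

theorem map_le (hΩ : MeasurableSet Ω) : ∃ C : ENNReal, C ≠ ⊤ ∧
    Measure.map χ (volume.restrict Ω) ≤ C • volume.restrict Ω := by
  obtain ⟨C, hC⟩ := P.exists_abs_le (f := Matrix.det) (by fun_prop)
  refine ⟨ENNReal.ofReal C, ENNReal.ofReal_ne_top, ?_⟩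
  rw [P.map_eq hΩ, ← withDensity_const]
  exact withDensity_mono <| .of_forall fun x =>
    ENNReal.ofReal_le_ofReal ((le_abs_self _).trans (hC x))

theorem memLp_comp (hΩ : MeasurableSet Ω) {E : Type*} [NormedAddCommGroup E] {f : Eu n → E}
    {p : ENNReal} (hf : MemLp f p (volume.restrict Ω)) :
    MemLp (fun y => f (χ y)) p (volume.restrict Ω) := by
  obtain ⟨C, hC, hle⟩ := P.map_le hΩ
  have hmap := hf.of_measure_le_smul hC hle
  exact (memLp_map_measure_iff hmap.aestronglyMeasurable
    P.contDiff_inv.continuous.aemeasurable).1 hmap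

theorem locallyIntegrableOn_comp (hΩ : IsOpen Ω) {f : Eu n → ℝ}
    (hf : LocallyIntegrableOn f Ω) : LocallyIntegrableOn (fun y => f (χ y)) Ω := by
  rw [locallyIntegrableOn_iff hΩ.isLocallyClosed] at hf ⊢
  intro K hKΩ hK
  have himage : IntegrableOn f (χ '' K) :=
    hf _ (Set.image_subset_iff.2 fun y hy => (P.symm.mem_iff y).2 (hKΩ hy))
      (hK.image P.contDiff_inv.continuous)
  have hinv : ContinuousOn (fun y => (jacobian χ y).det⁻¹) K := fun y _ =>
    ((contDiff_det_jacobian P.contDiff_inv).continuous.continuousAt.inv₀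
      (P.symm.det_pos y).ne').continuousWithinAt
  refine (((P.symm.integrableOn_iff hK.measurableSet f).1 himage).continuousOn_mul hinv hK).congr
    (.of_forall fun y => ?_)
  exact inv_mul_cancel_left₀ (P.symm.det_pos y).ne' _

theorem isTest_comp {F : Type*} [NormedAddCommGroup F] [NormedSpace ℝ F] {φ : Eu n → F}
    (hφ : IsTest Ω φ) : IsTest Ω (fun x => φ (ψ x)) := by
  have hK : IsCompact (χ '' tsupport φ) := hφ.2.1.image P.contDiff_inv.continuous
  have hs : Function.support (fun x => φ (ψ x)) ⊆ χ '' tsupport φ := fun x hx =>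
    ⟨ψ x, subset_tsupport _ hx, P.left_inv x⟩
  refine ⟨hφ.1.comp P.contDiff, HasCompactSupport.of_support_subset_isCompact hK hs,
    (closure_minimal hs hK.isClosed).trans ?_⟩
  rintro _ ⟨y, hy, rfl⟩
  exact (P.symm.mem_iff _).2 (hφ.2.2 hy)

theorem isTest_piola {φ : Eu n → ℝ} (hφ : IsTest Ω φ) (j k : Fin n) :
    IsTest Ω (fun x => (jacobian ψ x).det * jacobian χ (ψ x) k j * φ (ψ x)) :=
  (P.isTest_comp hφ).smul_contDiffAt fun _ _ => ((contDiff_det_jacobian P.contDiff).mul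
    ((contDiff_jacobian P.contDiff_inv k j).comp P.contDiff)).contDiffAt

-- The Piola identity in dual form: testing with `f` and changing variables reduces it to
-- integration by parts for the smooth function `f ∘ χ`.
theorem sum_pd_piola (hΩ : IsOpen Ω) {φ : Eu n → ℝ} (hφ : IsTest Ω φ) (j : Fin n) :
    ∀ᵐ x ∂(volume.restrict Ω),
      ∑ k, pd k (fun y => (jacobian ψ y).det * jacobian χ (ψ y) k j * φ (ψ y)) x =
        (jacobian ψ x).det * pd j φ (ψ x) := by
  have ha := P.isTest_piola hφ j
  have hlhs : Continuous fun x =>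
      ∑ k, pd k (fun y => (jacobian ψ y).det * jacobian χ (ψ y) k j * φ (ψ y)) x :=
    continuous_finsetSum _ fun k _ => ((ha k).partialDeriv k).1.continuous
  have hrhs : Continuous fun x => (jacobian ψ x).det * pd j φ (ψ x) :=
    (contDiff_det_jacobian P.contDiff).continuous.mul
      ((hφ.partialDeriv j).1.continuous.comp P.contDiff.continuous)
  refine ae_eq_of_integral_mul_isTest_eq hΩ (hlhs.locallyIntegrable.locallyIntegrableOn Ω)
    (hrhs.locallyIntegrable.locallyIntegrableOn Ω) fun f hf => ?_
  set a : Fin n → Eu n → ℝ := fun k x => (jacobian ψ x).det * jacobian χ (ψ x) k j * φ (ψ x)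
  have hfχ : IsTest Ω (fun y => f (χ y)) := P.symm.isTest_comp hf
  have hpointwise (x : Eu n) : (jacobian ψ x).det *
      (φ (ψ x) * pd j (fun y => f (χ y)) (ψ x)) = ∑ k, a k x * pd k f x := by
    rw [pd_comp (hf.differentiable _) (P.differentiable_inv _), Finset.mul_sum, Finset.mul_sum]
    exact Finset.sum_congr rfl fun k _ => by simp only [a, P.left_inv]; ring
  have hint {b c : Eu n → ℝ} (hb : IsTest Ω b) (hc : IsTest Ω c) :
      Integrable (fun x => b x * c x) (volume.restrict Ω) :=
    integrable_mul_isTest (hb.1.continuous.locallyIntegrable.locallyIntegrableOn Ω) hc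
  calc ∫ x in Ω, (∑ k, pd k (a k) x) * f x = ∑ k, ∫ x in Ω, pd k (a k) x * f x := by
        simp only [Finset.sum_mul]
        exact integral_finsetSum _ fun k _ => hint ((ha k).partialDeriv k) hf
    _ = -∑ k, ∫ x in Ω, a k x * pd k f x := by
        rw [← Finset.sum_neg_distrib]
        refine Finset.sum_congr rfl fun k _ => ?_
        rw [(hasWeakPd_pd ((ha k).1.of_le (by simp))).2.2 f hf, neg_neg]
    _ = -∫ x in Ω, (jacobian ψ x).det * (φ (ψ x) * pd j (fun y => f (χ y)) (ψ x)) := by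
        simp only [hpointwise]
        rw [integral_finsetSum _ fun k _ => hint (ha k) (hf.partialDeriv k)]
    _ = -∫ y in Ω, φ y * pd j (fun z => f (χ z)) y := by
        rw [P.integral_eq hΩ.measurableSet fun y => φ y * pd j (fun z => f (χ z)) y]
    _ = ∫ y in Ω, pd j φ y * f (χ y) := by
        rw [(hasWeakPd_pd (hφ.1.of_le (by simp))).2.2 _ hfχ, neg_neg]
    _ = ∫ x in Ω, (jacobian ψ x).det * pd j φ (ψ x) * f x := by
        rw [P.integral_eq hΩ.measurableSet]
        simp only [P.left_inv, mul_assoc]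

theorem hasWeakPd_comp (hΩ : IsOpen Ω) {f : Eu n → ℝ} {g : Fin n → Eu n → ℝ}
    (h : ∀ k, HasWeakPd Ω k f (g k)) (j : Fin n) :
    HasWeakPd Ω j (fun y => f (χ y)) (fun y => ∑ k, g k (χ y) * jacobian χ y k j) := by
  have hg : LocallyIntegrableOn (fun y => ∑ k, g k (χ y) * jacobian χ y k j) Ω := by
    refine (locallyIntegrableOn_iff hΩ.isLocallyClosed).2 fun K hKΩ hK =>
      integrable_finsetSum _ fun k _ => ?_
    exact ((P.locallyIntegrableOn_comp hΩ (h k).2.1).integrableOn_compact_subset hKΩ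
      hK).mul_continuousOn (contDiff_jacobian P.contDiff_inv k j).continuous.continuousOn hK
  refine ⟨P.locallyIntegrableOn_comp hΩ (h j).1, hg, fun φ hφ => ?_⟩
  have ha := P.isTest_piola hφ j
  set a : Fin n → Eu n → ℝ := fun k x => (jacobian ψ x).det * jacobian χ (ψ x) k j * φ (ψ x)
  calc ∫ y in Ω, f (χ y) * pd j φ y = ∫ x in Ω, f x * ∑ k, pd k (a k) x := by
        rw [P.integral_eq hΩ.measurableSet]
        refine integral_congr_ae <| (P.sum_pd_piola hΩ hφ j).mono fun x hx => ?_
        simp only [P.left_inv, a, hx]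
        ring
    _ = ∑ k, ∫ x in Ω, f x * pd k (a k) x := by
        simp only [Finset.mul_sum]
        exact integral_finsetSum _ fun k _ => integrable_mul_isTest (h j).1 ((ha k).partialDeriv k)
    _ = -∑ k, ∫ x in Ω, g k x * a k x := by
        rw [← Finset.sum_neg_distrib]
        exact Finset.sum_congr rfl fun k _ => (h k).2.2 _ (ha k)
    _ = -∫ x in Ω, ∑ k, g k x * a k x := by
        rw [integral_finsetSum _ fun k _ => integrable_mul_isTest (h k).2.1 (ha k)]
    _ = -∫ y in Ω, (∑ k, g k (χ y) * jacobian χ y k j) * φ y := by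
        rw [P.integral_eq hΩ.measurableSet (fun y => (∑ k, _) * _)]
        simp only [P.left_inv, Finset.sum_mul, Finset.mul_sum, a]
        refine congrArg Neg.neg <| integral_congr_ae <| .of_forall fun x => ?_
        exact Finset.sum_congr rfl fun k _ => by ring

theorem isWeakGrad_comp {m : ℕ} (hΩ : IsOpen Ω) {u : Eu n → Eu m}
    {F : Eu n → Matrix (Fin m) (Fin n) ℝ} (h : IsWeakGrad Ω u F) :
    IsWeakGrad Ω (fun y => u (χ y)) (fun y => F (χ y) * jacobian χ y) :=
  isWeakGrad_of_hasWeakPd (fun i => P.locallyIntegrableOn_comp hΩ (h.1 i)) fun i j =>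
    P.hasWeakPd_comp hΩ (h.hasWeakPd i) j

theorem memW12_comp {m : ℕ} (hΩ : IsOpen Ω) {u : Eu n → Eu m} (hu : MemW12 Ω u) :
    MemW12 Ω (fun y => u (χ y)) := by
  refine ⟨P.memLp_comp hΩ.measurableSet hu.1, _, P.isWeakGrad_comp hΩ hu.isWeakGrad,
    fun i j => ?_⟩
  simp only [Matrix.mul_apply]
  refine memLp_finsetSum _ fun k _ => ?_
  obtain ⟨C, hC⟩ := P.symm.exists_abs_le (f := fun A => A k j) (by fun_prop)
  have hbdd : MemLp (fun y => jacobian χ y k j) ⊤ (volume.restrict Ω) :=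
    memLp_top_of_bound (contDiff_jacobian P.contDiff_inv k j).continuous.aestronglyMeasurable C
      (.of_forall hC)
  exact hbdd.mul (P.memLp_comp hΩ.measurableSet (hu.memLp_weakGrad hΩ i k))

theorem weakGrad_comp_ae_eq {m : ℕ} (hΩ : IsOpen Ω) {u : Eu n → Eu m} (hu : MemW12 Ω u) :
    ∀ᵐ y ∂(volume.restrict Ω),
      weakGrad Ω (fun z => u (χ z)) y = weakGrad Ω u (χ y) * jacobian χ y :=
  (P.isWeakGrad_comp hΩ hu.isWeakGrad).weakGrad_ae_eq hΩ

end IsInnerDiffeo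

/-! ### Maps with vanishing trace -/

theorem frobSq_add_le {m n : ℕ} (A B : Matrix (Fin n) (Fin m) ℝ) :
    frobSq (A + B) ≤ 2 * frobSq A + 2 * frobSq B := by
  simp only [frobSq, Finset.mul_sum, ← Finset.sum_add_distrib]
  refine Finset.sum_le_sum fun i _ => Finset.sum_le_sum fun j _ => ?_
  rw [Matrix.add_apply]
  linarith [add_sq_le (a := A i j) (b := B i j)]

theorem frobSq_mul_le {l m n : ℕ} (A : Matrix (Fin n) (Fin m) ℝ) (B : Matrix (Fin m) (Fin l) ℝ) :
    frobSq (A * B) ≤ frobSq A * frobSq B := by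
  calc frobSq (A * B) ≤ ∑ i, ∑ k, (∑ j, A i j ^ 2) * ∑ j, B j k ^ 2 :=
        Finset.sum_le_sum fun i _ => Finset.sum_le_sum fun k _ => by
          rw [Matrix.mul_apply]
          exact Finset.sum_mul_sq_le_sq_mul_sq _ _ _
    _ = frobSq A * frobSq B := by
        simp only [← Finset.mul_sum]
        rw [← Finset.sum_mul, frobSq, frobSq, Finset.sum_comm (f := fun j k => B j k ^ 2)]

theorem frobSq_jacobian_sub_le {m n : ℕ} (f g : Eu m → Eu n) (x : Eu m) :
    frobSq (jacobian f x - jacobian g x) ≤ m * ‖fderiv ℝ f x - fderiv ℝ g x‖ ^ 2 := by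
  calc frobSq (jacobian f x - jacobian g x)
      = ∑ j : Fin m, ‖(fderiv ℝ f x - fderiv ℝ g x) (basisVec j)‖ ^ 2 := by
        rw [frobSq, Finset.sum_comm]
        exact Finset.sum_congr rfl fun j _ => (EuclideanSpace.real_norm_sq_eq
          ((fderiv ℝ f x - fderiv ℝ g x) (basisVec j))).symm
    _ ≤ ∑ _j : Fin m, ‖fderiv ℝ f x - fderiv ℝ g x‖ ^ 2 :=
        Finset.sum_le_sum fun j _ => pow_le_pow_left₀ (norm_nonneg _)
          (ContinuousLinearMap.unit_le_opNorm _ _ (by simp [basisVec])) 2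
    _ = m * ‖fderiv ℝ f x - fderiv ℝ g x‖ ^ 2 := by simp

section Mollification

variable {E F : Type*} [NormedAddCommGroup E] [NormedSpace ℝ E] [FiniteDimensional ℝ E]
  [NormedAddCommGroup F] [NormedSpace ℝ F]

theorem support_normed_convolution_subset [MeasurableSpace E] [BorelSpace E] (μ : Measure E)
    [IsLocallyFiniteMeasure μ] [μ.IsOpenPosMeasure] (b : ContDiffBump (0 : E)) (h : E → F) :
    Function.support (convolution (b.normed μ) h (ContinuousLinearMap.lsmul ℝ ℝ) μ) ⊆
      Metric.cthickening b.rOut (tsupport h) := by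
  refine (support_convolution_subset _).trans ?_
  rw [b.support_normed_eq]
  rintro _ ⟨y, hy, z, hz, rfl⟩
  refine Metric.mem_cthickening_of_dist_le _ z _ _ (subset_tsupport _ hz) ?_
  rw [dist_eq_norm, add_sub_cancel_right]
  exact (mem_ball_zero_iff.1 hy).le

theorem exists_isTest_approx [CompleteSpace F] {U : Set E} (hU : IsOpen U) {h : E → F}
    (hh : ContDiff ℝ 1 h) (hc : HasCompactSupport h) (hs : tsupport h ⊆ U) {ε : ℝ} (hε : 0 < ε) :
    ∃ φ, IsTest U φ ∧ ∀ x, ‖φ x - h x‖ ≤ ε ∧ ‖fderiv ℝ φ x - fderiv ℝ h x‖ ≤ ε := by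
  borelize E
  let μ : Measure E := Measure.addHaar
  have hderiv : Continuous (fderiv ℝ h) := hh.continuous_fderiv one_ne_zero
  obtain ⟨δ₀, hδ₀, hδ₀U⟩ := hc.isCompact.exists_cthickening_subset_open hU hs
  obtain ⟨δ₁, hδ₁, hclose⟩ := Metric.uniformContinuous_iff.1
    (hc.uniformContinuous_of_continuous hh.continuous) ε hε
  obtain ⟨δ₂, hδ₂, hclose'⟩ := Metric.uniformContinuous_iff.1
    ((hc.fderiv ℝ).uniformContinuous_of_continuous hderiv) ε hε
  let b : ContDiffBump (0 : E) := ⟨min δ₀ (min δ₁ δ₂) / 2, min δ₀ (min δ₁ δ₂),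
    by positivity, half_lt_self (by positivity)⟩
  have hb : LocallyIntegrable (b.normed μ) μ := b.continuous_normed.locallyIntegrable
  let φ := convolution (b.normed μ) h (ContinuousLinearMap.lsmul ℝ ℝ) μ
  have hK : IsCompact (Metric.cthickening δ₀ (tsupport h)) := hc.isCompact.cthickening
  have hsupport : Function.support φ ⊆ Metric.cthickening δ₀ (tsupport h) :=
    (support_normed_convolution_subset μ b h).trans
      (Metric.cthickening_mono (min_le_left _ _) _)
  refine ⟨φ, ⟨b.hasCompactSupport_normed.contDiff_convolution_left _ b.contDiff_normed
      hh.continuous.locallyIntegrable, HasCompactSupport.of_support_subset_isCompact hK hsupport,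
    (closure_minimal hsupport hK.isClosed).trans hδ₀U⟩, fun x => ⟨?_, ?_⟩⟩
  · rw [← dist_eq_norm]
    exact b.dist_normed_convolution_le hh.continuous.aestronglyMeasurable fun y hy =>
      (hclose (hy.trans_le ((min_le_right _ _).trans (min_le_left _ _)))).le
  · refine ContinuousLinearMap.opNorm_le_bound _ hε.le fun v => ?_
    have hφ : fderiv ℝ φ x v =
        convolution (b.normed μ) (fun y => fderiv ℝ h y v) (ContinuousLinearMap.lsmul ℝ ℝ) μ x :=
      (congrArg (· v) (hc.hasFDerivAt_convolution_right (ContinuousLinearMap.lsmul ℝ ℝ) hb hh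
        x).fderiv).trans (convolution_precompR_apply _ hb (hc.fderiv ℝ) hderiv x v)
    rw [sub_apply, hφ, ← dist_eq_norm]
    refine b.dist_normed_convolution_le
      (hderiv.clm_apply continuous_const).aestronglyMeasurable fun y hy => ?_
    rw [dist_eq_norm, ← sub_apply]
    refine ContinuousLinearMap.le_of_opNorm_le _ ?_ v
    exact dist_eq_norm (fderiv ℝ h y) _ ▸
      (hclose' (hy.trans_le ((min_le_right _ _).trans (min_le_right _ _)))).le

end Mollification

theorem isWeakGrad_jacobian {m n : ℕ} (U : Set (Eu m)) {h : Eu m → Eu n}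
    (hh : ContDiff ℝ 1 h) : IsWeakGrad U h (jacobian h) := by
  have hcoord (i : Fin n) : ContDiff ℝ 1 (fun x => h x i) := contDiff_euclidean.1 hh i
  refine isWeakGrad_of_hasWeakPd
    (fun i => (hcoord i).continuous.locallyIntegrable.locallyIntegrableOn U) fun i j => ?_
  simp only [jacobian_apply (hh.differentiable one_ne_zero _)]
  exact hasWeakPd_pd (hcoord i)

theorem memW12_of_contDiff {m n : ℕ} (U : Set (Eu m)) {h : Eu m → Eu n} (hh : ContDiff ℝ 1 h)
    (hc : HasCompactSupport h) : MemW12 U h := by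
  refine ⟨(hh.continuous.memLp_of_hasCompactSupport hc).restrict U, _, isWeakGrad_jacobian U hh,
    fun i j => ?_⟩
  have hsupp : HasCompactSupport fun x => jacobian h x i j :=
    (hc.fderiv_apply (𝕜 := ℝ) (basisVec j)).comp_left (g := fun w : Eu n => w i) rfl
  exact (((continuous_jacobian hh).matrix_elem i j).memLp_of_hasCompactSupport hsupp).restrict U

/-- The square of the `W^{1,2}(U)` distance from `u` to the smooth map `φ`. -/
def w12DistSq {m n : ℕ} (U : Set (Eu m)) (φ u : Eu m → Eu n) : ENNReal :=
  ∫⁻ x in U, ENNReal.ofReal (‖φ x - u x‖ ^ 2 + frobSq (jacobian φ x - weakGrad U u x))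

theorem tendsto_zero_of_le_const_mul {ι : Type*} {l : Filter ι} {C : ENNReal} (hC : C ≠ ⊤)
    {a b : ι → ENNReal} (ha : Tendsto a l (𝓝 0)) (hle : ∀ k, b k ≤ C * a k) :
    Tendsto b l (𝓝 0) := by
  have hCa := ENNReal.Tendsto.const_mul ha (Or.inr hC)
  rw [mul_zero] at hCa
  exact tendsto_of_tendsto_of_tendsto_of_le_of_le tendsto_const_nhds hCa (fun _ => zero_le) hle

section VanishingTrace

variable {m n : ℕ} {U : Set (Eu m)} {φ ψ u w : Eu m → Eu n}

theorem aemeasurable_w12DistSq (hU : IsOpen U) (hφ : ContDiff ℝ 1 φ) (hu : MemW12 U u) :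
    AEMeasurable (fun x => ENNReal.ofReal
      (‖φ x - u x‖ ^ 2 + frobSq (jacobian φ x - weakGrad U u x))) (volume.restrict U) := by
  have hnorm : AEMeasurable (fun x => ‖φ x - u x‖) (volume.restrict U) :=
    (hφ.continuous.aestronglyMeasurable.sub hu.1.aestronglyMeasurable).norm.aemeasurable
  have hentry (i : Fin n) (j : Fin m) :
      AEMeasurable (fun x => jacobian φ x i j - weakGrad U u x i j) (volume.restrict U) :=
    ((continuous_jacobian hφ).matrix_elem i j).aemeasurable.sub
      (hu.memLp_weakGrad hU i j).aestronglyMeasurable.aemeasurable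
  simp only [frobSq, Matrix.sub_apply]
  exact ((hnorm.pow_const 2).add <| Finset.aemeasurable_fun_sum _ fun i _ =>
    Finset.aemeasurable_fun_sum _ fun j _ => (hentry i j).pow_const 2).ennreal_ofReal

theorem memW120_iff : MemW120 U u ↔ MemW12 U u ∧ ∃ φ : ℕ → Eu m → Eu n,
    (∀ k, IsTest U (φ k)) ∧ Tendsto (fun k => w12DistSq U (φ k) u) atTop (𝓝 0) := by
  refine and_congr_right fun hu => exists_congr fun φ => and_congr_right fun hφ => ?_
  constructor
  · rintro ⟨h0, h1⟩
    have hsum := h0.add h1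
    rw [add_zero] at hsum
    refine hsum.congr fun k => ?_
    rw [w12DistSq, ← lintegral_add_left']
    · simp only [ENNReal.ofReal_add (sq_nonneg _) (frobSq_nonneg _)]
    · exact (((hφ k).1.continuous.aestronglyMeasurable.sub
        hu.1.aestronglyMeasurable).norm.aemeasurable.pow_const 2).ennreal_ofReal
  · intro h
    refine ⟨tendsto_of_tendsto_of_tendsto_of_le_of_le tendsto_const_nhds h (fun _ => zero_le)
        fun k => lintegral_mono fun x => ENNReal.ofReal_le_ofReal ?_,
      tendsto_of_tendsto_of_tendsto_of_le_of_le tendsto_const_nhds h (fun _ => zero_le)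
        fun k => lintegral_mono fun x => ENNReal.ofReal_le_ofReal ?_⟩
    · exact le_add_of_nonneg_right (frobSq_nonneg _)
    · exact le_add_of_nonneg_left (sq_nonneg _)

theorem w12DistSq_add_le (hU : IsOpen U) (hφ : IsTest U φ) (hψ : IsTest U ψ) (hu : MemW12 U u)
    (hw : MemW12 U w) : w12DistSq U (fun x => φ x + ψ x) (fun x => u x + w x) ≤
      2 * (w12DistSq U φ u + w12DistSq U ψ w) := by
  rw [w12DistSq, w12DistSq, w12DistSq,
    ← lintegral_add_left' (aemeasurable_w12DistSq hU (hφ.1.of_le (by simp)) hu),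
    ← lintegral_const_mul' _ _ (by simp)]
  refine lintegral_mono_ae ?_
  filter_upwards [(hu.isWeakGrad.add hw.isWeakGrad).weakGrad_ae_eq hU] with x hx
  have hnonneg {f v : Eu m → Eu n} :
      0 ≤ ‖f x - v x‖ ^ 2 + frobSq (jacobian f x - weakGrad U v x) :=
    add_nonneg (sq_nonneg _) (frobSq_nonneg _)
  have hjac : jacobian (fun y => φ y + ψ y) x = jacobian φ x + jacobian ψ x := by
    ext i j
    simp only [jacobian, Matrix.of_apply, Matrix.add_apply,
      fderiv_fun_add (hφ.differentiable x) (hψ.differentiable x)]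
    rfl
  have hnorm : ‖φ x + ψ x - (u x + w x)‖ ^ 2 ≤ 2 * ‖φ x - u x‖ ^ 2 + 2 * ‖ψ x - w x‖ ^ 2 := by
    rw [add_sub_add_comm]
    have hsq := pow_le_pow_left₀ (norm_nonneg _) (norm_add_le (φ x - u x) (ψ x - w x)) 2
    linarith [add_sq_le (a := ‖φ x - u x‖) (b := ‖ψ x - w x‖)]
  have hfrob := frobSq_add_le (jacobian φ x - weakGrad U u x) (jacobian ψ x - weakGrad U w x)
  have htwo (a : ℝ) : 2 * ENNReal.ofReal a = ENNReal.ofReal (2 * a) := by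
    rw [ENNReal.ofReal_mul zero_le_two, ENNReal.ofReal_ofNat]
  rw [← ENNReal.ofReal_add hnonneg hnonneg, htwo, hx, hjac, add_sub_add_comm (jacobian φ x)]
  exact ENNReal.ofReal_le_ofReal (by linarith)

theorem MemW120.add (hU : IsOpen U) (hu : MemW120 U u) (hw : MemW120 U w) :
    MemW120 U (fun x => u x + w x) := by
  obtain ⟨hu, φ, hφ, hφu⟩ := memW120_iff.1 hu
  obtain ⟨hw, ψ, hψ, hψw⟩ := memW120_iff.1 hw
  have hsum := hφu.add hψw
  rw [add_zero] at hsum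
  exact memW120_iff.2 ⟨hu.add hw, _, fun k => (hφ k).add (hψ k),
    tendsto_zero_of_le_const_mul ENNReal.ofNat_ne_top hsum
      fun k => w12DistSq_add_le hU (hφ k) (hψ k) hu hw⟩

theorem memW120_of_contDiff [IsFiniteMeasure (volume.restrict U)] (hU : IsOpen U)
    (hh : ContDiff ℝ 1 u) (hc : HasCompactSupport u) (hs : tsupport u ⊆ U) : MemW120 U u := by
  have hpos (k : ℕ) : (0 : ℝ) < 1 / ((k : ℝ) + 1) := by positivity
  choose φ hφ hclose using fun k => exists_isTest_approx hU hh hc hs (hpos k)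
  refine memW120_iff.2 ⟨memW12_of_contDiff U hh hc, φ, hφ, tendsto_zero_of_le_const_mul
    (C := ENNReal.ofReal (1 + m) * volume.restrict U Set.univ)
    (a := fun k : ℕ => ENNReal.ofReal ((1 / ((k : ℝ) + 1)) ^ 2))
    (ENNReal.mul_ne_top ENNReal.ofReal_ne_top (measure_ne_top _ _)) ?_ fun k => ?_⟩
  · have hlim := (tendsto_one_div_add_atTop_nhds_zero_nat (𝕜 := ℝ)).pow 2
    simpa using ENNReal.tendsto_ofReal hlim
  · calc w12DistSq U (φ k) u
        ≤ ∫⁻ _ in U, ENNReal.ofReal ((1 + m) * (1 / ((k : ℝ) + 1)) ^ 2) := by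
          refine lintegral_mono_ae (((isWeakGrad_jacobian U hh).weakGrad_ae_eq hU).mono
            fun x hx => ENNReal.ofReal_le_ofReal ?_)
          have hvalue := pow_le_pow_left₀ (norm_nonneg _) (hclose k x).1 2
          have hderiv := pow_le_pow_left₀ (norm_nonneg _) (hclose k x).2 2
          rw [hx, add_mul, one_mul]
          exact add_le_add hvalue ((frobSq_jacobian_sub_le _ _ x).trans
            (mul_le_mul_of_nonneg_left hderiv m.cast_nonneg))
      _ = _ := by
          rw [lintegral_const, ENNReal.ofReal_mul (by positivity)]
          ring

end VanishingTrace

namespace IsInnerDiffeo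

variable {m n : ℕ} {Ω : Set (Eu n)} {ψ χ : Eu n → Eu n} (P : IsInnerDiffeo Ω ψ χ)
include P

theorem lintegral_comp_le (hΩ : MeasurableSet Ω) : ∃ C : ENNReal, C ≠ ⊤ ∧
    ∀ f : Eu n → ENNReal, ∫⁻ y in Ω, f (χ y) ≤ C * ∫⁻ x in Ω, f x := by
  obtain ⟨C, hC⟩ := P.exists_abs_le (f := Matrix.det) (by fun_prop)
  refine ⟨ENNReal.ofReal C, ENNReal.ofReal_ne_top, fun f => ?_⟩
  rw [P.lintegral_eq hΩ, ← lintegral_const_mul' _ _ ENNReal.ofReal_ne_top]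
  simp only [P.left_inv]
  refine lintegral_mono fun x => ?_
  gcongr
  exact (le_abs_self _).trans (hC x)

theorem exists_w12DistSq_comp_le (hΩ : IsOpen Ω) {w : Eu n → Eu m} (hw : MemW12 Ω w) :
    ∃ C : ENNReal, C ≠ ⊤ ∧ ∀ φ : Eu n → Eu m, IsTest Ω φ →
      w12DistSq Ω (fun y => φ (χ y)) (fun y => w (χ y)) ≤ C * w12DistSq Ω φ w := by
  obtain ⟨C, hC, hle⟩ := P.lintegral_comp_le hΩ.measurableSet
  obtain ⟨B, hB⟩ := P.symm.exists_abs_le (f := frobSq) (by unfold frobSq; fun_prop)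
  refine ⟨ENNReal.ofReal (1 + B) * C, ENNReal.mul_ne_top ENNReal.ofReal_ne_top hC,
    fun φ hφ => ?_⟩
  have hB0 : 0 ≤ B := (abs_nonneg _).trans (hB 0)
  calc w12DistSq Ω (fun y => φ (χ y)) (fun y => w (χ y))
      ≤ ∫⁻ y in Ω, ENNReal.ofReal (1 + B) * ENNReal.ofReal (‖φ (χ y) - w (χ y)‖ ^ 2 +
          frobSq (jacobian φ (χ y) - weakGrad Ω w (χ y))) := by
        refine lintegral_mono_ae ((P.weakGrad_comp_ae_eq hΩ hw).mono fun y hy => ?_)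
        rw [hy, jacobian_comp (hφ.differentiable _) (P.differentiable_inv y), ← Matrix.sub_mul,
          ← ENNReal.ofReal_mul (by positivity)]
        refine ENNReal.ofReal_le_ofReal ?_
        have hfrob := frobSq_mul_le (jacobian φ (χ y) - weakGrad Ω w (χ y)) (jacobian χ y)
        have hbound := mul_le_mul_of_nonneg_left ((le_abs_self _).trans (hB y))
          (frobSq_nonneg (jacobian φ (χ y) - weakGrad Ω w (χ y)))
        nlinarith [frobSq_nonneg (jacobian φ (χ y) - weakGrad Ω w (χ y)),
          mul_nonneg hB0 (sq_nonneg ‖φ (χ y) - w (χ y)‖)]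
    _ ≤ ENNReal.ofReal (1 + B) * C * w12DistSq Ω φ w := by
        rw [lintegral_const_mul' _ _ ENNReal.ofReal_ne_top, mul_assoc]
        gcongr
        exact hle fun x =>
          ENNReal.ofReal (‖φ x - w x‖ ^ 2 + frobSq (jacobian φ x - weakGrad Ω w x))

theorem memW120_comp (hΩ : IsOpen Ω) {w : Eu n → Eu m} (hw : MemW120 Ω w) :
    MemW120 Ω (fun y => w (χ y)) := by
  obtain ⟨hw, φ, hφ, hφw⟩ := memW120_iff.1 hw
  obtain ⟨C, hC, hle⟩ := P.exists_w12DistSq_comp_le hΩ hw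
  exact memW120_iff.2 ⟨P.memW12_comp hΩ hw, _, fun k => P.symm.isTest_comp (hφ k),
    tendsto_zero_of_le_const_mul hC hφw fun k => hle _ (hφ k)⟩

theorem exists_isCompact_support_comp_sub (g : Eu n → Eu m) : ∃ K, IsCompact K ∧ K ⊆ Ω ∧
    Function.support (fun y => g (χ y) - g y) ⊆ K := by
  obtain ⟨K, hK, hKΩ, hid⟩ := P.symm.compact
  refine ⟨K, hK, hKΩ, fun y hy => by_contra fun hyK => hy ?_⟩
  simp only [hid y hyK, sub_self]

theorem contDiff_comp_sub (hΩ : IsOpen Ω) {g : Eu n → Eu m} (hg : ContDiffOn ℝ 1 g Ω) :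
    ContDiff ℝ 1 (fun y => g (χ y) - g y) := by
  obtain ⟨K, hK, hKΩ, hsupp⟩ := P.exists_isCompact_support_comp_sub g
  have hgx {x : Eu n} (hx : x ∈ Ω) : ContDiffAt ℝ 1 g x := hg.contDiffAt (hΩ.mem_nhds hx)
  refine contDiff_iff_contDiffAt.2 fun y => ?_
  by_cases hy : y ∈ Ω
  · exact ((hgx ((P.symm.mem_iff y).2 hy)).comp y
      (P.contDiff_inv.of_le (by simp)).contDiffAt).sub (hgx hy)
  · refine contDiffAt_const.congr_of_eventuallyEq (notMem_tsupport_iff_eventuallyEq.1 fun h => ?_)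
    exact hy (hKΩ (closure_minimal hsupp hK.isClosed h))

theorem memW120_comp_sub [IsFiniteMeasure (volume.restrict Ω)] (hΩ : IsOpen Ω)
    {u g : Eu n → Eu m} (hg : ContDiffOn ℝ 1 g Ω) (hu : MemW120 Ω (fun x => u x - g x)) :
    MemW120 Ω (fun y => u (χ y) - g y) := by
  obtain ⟨K, hK, hKΩ, hsupp⟩ := P.exists_isCompact_support_comp_sub g
  have hsub := memW120_of_contDiff hΩ (P.contDiff_comp_sub hΩ hg)
    (HasCompactSupport.of_support_subset_isCompact hK hsupp)
    ((closure_minimal hsupp hK.isClosed).trans hKΩ)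
  simpa only [sub_add_sub_cancel] using (P.memW120_comp hΩ hu).add hΩ hsub

end IsInnerDiffeo

/-! ### Admissibility of inner variations -/

theorem det_smul_cof_mul {n : ℕ} (F : Matrix (Fin n) (Fin n) ℝ) {A B : Matrix (Fin n) (Fin n) ℝ}
    (h : A * B = 1) : B.det • cof (F * A) = cof F * B.transpose := by
  have hdet : A.det * B.det = 1 := by rw [← Matrix.det_mul, h, Matrix.det_one]
  have hadj : B.det • A.adjugate = B := by
    calc B.det • A.adjugate = B.det • (A.adjugate * (A * B)) := by rw [h, Matrix.mul_one]
      _ = B := by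
        rw [← Matrix.mul_assoc, Matrix.adjugate_mul, Matrix.smul_mul, Matrix.one_mul, smul_smul,
          mul_comm B.det, hdet, one_smul]
  rw [cof, Matrix.adjugate_mul_distrib, Matrix.transpose_mul, cof, ← Matrix.mul_smul,
    ← Matrix.transpose_smul, hadj]

theorem det_mul_det_mul {n : ℕ} (F : Matrix (Fin n) (Fin n) ℝ) {A B : Matrix (Fin n) (Fin n) ℝ}
    (h : A * B = 1) : B.det * (F * A).det = F.det := by
  rw [mul_comm, ← Matrix.det_mul, Matrix.mul_assoc, h, Matrix.mul_one]

theorem fderiv_comp_prodMap_id {E F G H : Type*} [NormedAddCommGroup E] [NormedSpace ℝ E]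
    [NormedAddCommGroup F] [NormedSpace ℝ F] [NormedAddCommGroup G] [NormedSpace ℝ G]
    [NormedAddCommGroup H] [NormedSpace ℝ H] {ψ : E → F} {f : F × G → H} {x : E} {y : G}
    (hf : DifferentiableAt ℝ f (ψ x, y)) (hψ : DifferentiableAt ℝ ψ x) (a : E) (b : G) :
    fderiv ℝ (fun p : E × G => f (ψ p.1, p.2)) (x, y) (a, b) =
      fderiv ℝ f (ψ x, y) (fderiv ℝ ψ x a, b) := by
  have hmap : HasFDerivAt (fun p : E × G => (ψ p.1, p.2))
      (((fderiv ℝ ψ x).comp (ContinuousLinearMap.fst ℝ E G)).prod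
        (ContinuousLinearMap.snd ℝ E G)) (x, y) :=
    (hψ.hasFDerivAt.comp (x, y) hasFDerivAt_fst).prodMk hasFDerivAt_snd
  exact congrArg (· (a, b)) (hf.hasFDerivAt.comp (x, y) hmap).fderiv

theorem fderiv_apply_basisVec {m n : ℕ} (ψ : Eu m → Eu n) (x : Eu m) (k : Fin m) :
    fderiv ℝ ψ x (basisVec k) = ∑ j, jacobian ψ x j k • (basisVec j : Eu n) :=
  ((EuclideanSpace.basisFun (Fin n) ℝ).sum_repr (fderiv ℝ ψ x (basisVec k))).symm.trans <|
    Finset.sum_congr rfl fun j _ => by simp [basisVec, jacobian]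

theorem fderiv_comp_prodMap_id_basisVec {m n : ℕ} {G : Type*} [NormedAddCommGroup G]
    [NormedSpace ℝ G] {ψ : Eu m → Eu n} {f : Eu n × G → Eu n} {x : Eu m} {y : G}
    (hf : DifferentiableAt ℝ f (ψ x, y)) (hψ : DifferentiableAt ℝ ψ x) (k : Fin m) (i : Fin n) :
    fderiv ℝ (fun p : Eu m × G => f (ψ p.1, p.2)) (x, y) (basisVec k, 0) i =
      ∑ j, jacobian ψ x j k * fderiv ℝ f (ψ x, y) (basisVec j, 0) i := by
  have hbasis : (fderiv ℝ ψ x (basisVec k), (0 : G)) =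
      ∑ j, jacobian ψ x j k • ((basisVec j : Eu n), (0 : G)) := by
    rw [fderiv_apply_basisVec]
    ext1 <;> simp [Prod.fst_sum, Prod.snd_sum]
  rw [fderiv_comp_prodMap_id hf hψ, hbasis, map_sum]
  simp only [map_smul, WithLp.ofLp_sum, WithLp.ofLp_smul, Finset.sum_apply, Pi.smul_apply,
    smul_eq_mul]

/-- `χ` maps every circle about the `z` axis in `Ω` onto a circle about the `z` axis and preserves
the azimuth, so that composing an axisymmetric map with `χ` gives an axisymmetric map. -/
def PreservesAzimuth (Ω : Set (Eu 3)) (χ : Eu 3 → Eu 3) : Prop :=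
  ∀ X ∈ meridian Ω, ∃ Y : Eu 2, 0 < Y 0 ∧ ∀ θ, χ (cyl X θ) = cyl Y θ

namespace IsInnerDiffeo

theorem isTest_comp_prodMap_id {n : ℕ} {Ω : Set (Eu n)} {ψ χ : Eu n → Eu n}
    (P : IsInnerDiffeo Ω ψ χ) {E F : Type*} [NormedAddCommGroup E] [NormedSpace ℝ E]
    [NormedAddCommGroup F] [NormedSpace ℝ F] {φ : Eu n × E → F}
    (hφ : IsTest (Ω ×ˢ Set.univ) φ) : IsTest (Ω ×ˢ Set.univ) (fun p => φ (ψ p.1, p.2)) := by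
  have hK : IsCompact ((fun p : Eu n × E => (χ p.1, p.2)) '' tsupport φ) :=
    hφ.2.1.image ((P.contDiff_inv.continuous.comp continuous_fst).prodMk continuous_snd)
  have hs : Function.support (fun p : Eu n × E => φ (ψ p.1, p.2)) ⊆
      (fun p : Eu n × E => (χ p.1, p.2)) '' tsupport φ := fun p hp =>
    ⟨(ψ p.1, p.2), subset_tsupport _ hp, by simp only [P.left_inv]⟩
  refine ⟨hφ.1.comp ((P.contDiff.comp contDiff_fst).prodMk contDiff_snd),
    HasCompactSupport.of_support_subset_isCompact hK hs,
    (closure_minimal hs hK.isClosed).trans ?_⟩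
  rintro _ ⟨q, hq, rfl⟩
  exact ⟨(P.symm.mem_iff _).2 (hφ.2.2 hq).1, trivial⟩

variable {Ω : Set (Eu 3)} {ψ χ : Eu 3 → Eu 3} (P : IsInnerDiffeo Ω ψ χ)
include P

theorem injectiveAE_comp {u : Eu 3 → Eu 3} (hu : InjectiveAE Ω u) :
    InjectiveAE Ω (fun y => u (χ y)) := by
  obtain ⟨N, hN, hinj⟩ := hu
  refine ⟨ψ '' N, addHaar_image_eq_zero_of_differentiableOn_of_addHaar_eq_zero volume
    P.differentiable.differentiableOn hN, ?_⟩
  have hmem (y : Eu 3) (hy : y ∈ Ω \ ψ '' N) : χ y ∈ Ω \ N :=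
    ⟨(P.symm.mem_iff y).2 hy.1, fun h => hy.2 ⟨χ y, h, P.right_inv y⟩⟩
  exact fun y hy z hz h => P.symm.injective (hinj (hmem y hy) (hmem z hz) h)

theorem det_mul_surfaceIntegrand (F : Matrix (Fin 3) (Fin 3) ℝ) {f : Eu 3 × Eu 3 → Eu 3}
    (hf : Differentiable ℝ f) (x y : Eu 3) :
    (jacobian ψ x).det * ((∑ i, ∑ j, cof (F * jacobian χ (ψ x)) i j *
        fderiv ℝ f (ψ x, y) (basisVec j, 0) i) +
      (F * jacobian χ (ψ x)).det * ∑ i, fderiv ℝ f (ψ x, y) (0, basisVec i) i) =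
    (∑ i, ∑ j, cof F i j *
        fderiv ℝ (fun p : Eu 3 × Eu 3 => f (ψ p.1, p.2)) (x, y) (basisVec j, 0) i) +
      F.det * ∑ i, fderiv ℝ (fun p : Eu 3 × Eu 3 => f (ψ p.1, p.2)) (x, y) (0, basisVec i) i := by
  have hcof (i j : Fin 3) : (jacobian ψ x).det * cof (F * jacobian χ (ψ x)) i j =
      ∑ k, cof F i k * jacobian ψ x j k :=
    congrFun (congrFun (det_smul_cof_mul F (P.jacobian_mul x)) i) j
  simp only [fderiv_comp_prodMap_id_basisVec (hf _) (P.differentiable x),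
    fderiv_comp_prodMap_id (hf _) (P.differentiable x) 0, map_zero]
  rw [mul_add, ← mul_assoc, det_mul_det_mul F (P.jacobian_mul x)]
  congr 1
  simp only [Finset.mul_sum, ← mul_assoc, hcof, Finset.sum_mul]
  exact Finset.sum_congr rfl fun i _ => Finset.sum_comm

theorem surfaceFunctional_comp (hΩ : IsOpen Ω) {u : Eu 3 → Eu 3} (hu : MemW12 Ω u)
    {f : Eu 3 × Eu 3 → Eu 3} (hf : Differentiable ℝ f) :
    surfaceFunctional Ω (fun y => u (χ y)) f =
      surfaceFunctional Ω u (fun p => f (ψ p.1, p.2)) := by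
  calc surfaceFunctional Ω (fun y => u (χ y)) f
      = ∫ y in Ω, ((∑ i, ∑ j, cof (weakGrad Ω u (χ y) * jacobian χ y) i j *
          fderiv ℝ f (y, u (χ y)) (basisVec j, 0) i) +
        (weakGrad Ω u (χ y) * jacobian χ y).det *
          ∑ i, fderiv ℝ f (y, u (χ y)) (0, basisVec i) i) :=
        integral_congr_ae ((P.weakGrad_comp_ae_eq hΩ hu).mono fun y hy => by simp only [hy])
    _ = surfaceFunctional Ω u (fun p => f (ψ p.1, p.2)) := by
        rw [P.integral_eq hΩ.measurableSet]
        simp only [P.left_inv, P.det_mul_surfaceIntegrand _ hf]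
        rfl

theorem surfaceEnergy_comp_le (hΩ : IsOpen Ω) {u : Eu 3 → Eu 3} (hu : MemW12 Ω u) :
    surfaceEnergy Ω (fun y => u (χ y)) ≤ surfaceEnergy Ω u := by
  refine iSup_le fun f => ?_
  rw [P.surfaceFunctional_comp hΩ hu f.2.1.differentiable]
  exact le_iSup (fun f : {f : Eu 3 × Eu 3 → Eu 3 // IsTest (Ω ×ˢ Set.univ) f ∧ ∀ p, ‖f p‖ ≤ 1} =>
    (surfaceFunctional Ω u f.1 : EReal))
    ⟨fun p => f.1 (ψ p.1, p.2), P.isTest_comp_prodMap_id f.2.1, fun p => f.2.2 _⟩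

theorem surfaceEnergy_comp (hΩ : IsOpen Ω) {u : Eu 3 → Eu 3} (hu : MemW12 Ω u) :
    surfaceEnergy Ω (fun y => u (χ y)) = surfaceEnergy Ω u := by
  refine le_antisymm (P.surfaceEnergy_comp_le hΩ hu) ?_
  simpa only [P.left_inv] using P.symm.surfaceEnergy_comp_le hΩ (P.memW12_comp hΩ hu)

theorem isAxisymmetricMap_comp (D : IsAxiDomain Ω) (hχ : PreservesAzimuth Ω χ)
    {u : Eu 3 → Eu 3} (hu : IsAxisymmetricMap Ω u) : IsAxisymmetricMap Ω (fun y => u (χ y)) := by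
  obtain ⟨v, hv, hv0⟩ := hu
  choose! q hq0 hq using hχ
  let w : Eu 2 → Eu 2 := fun X => !₂[max (v X 0) 0, v X 1]
  have huw : ∀ᵐ x ∂(volume.restrict Ω), u x = axiLift w x := by
    filter_upwards [hv, D.quasiMeasurePreserving_cylProj.ae hv0] with x hx h0
    have hw : w (cylProj x) = v (cylProj x) := by
      ext i
      fin_cases i <;> simp [w, h0]
    rw [hx]
    ext i
    rw [axiLift_apply, axiLift_apply, hw]
  refine ⟨fun X => w (q X), ?_, .of_forall fun X => by simp [w]⟩
  filter_upwards [(P.quasiMeasurePreserving_inv D.isOpen.measurableSet).ae huw,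
    ae_restrict_mem D.isOpen.measurableSet] with x hx hxΩ
  obtain ⟨θ, hθ⟩ := exists_eq_cyl x
  have hX : cylProj x ∈ meridian Ω := D.cylProj_mem_iff.2 hxΩ
  rw [hx]
  ext i
  rw [hθ, hq _ hX, axiLift_cyl_apply w (hq0 _ hX), axiLift_cyl_apply _ hX.1]

theorem admissibleNcAxi_comp (D : IsAxiDomain Ω) (hχ : PreservesAzimuth Ω χ)
    {g : Eu 3 → Eu 3} (hg : ContDiffOn ℝ 1 g Ω) {M : ℝ} {u : Eu 3 → Eu 3}
    (hu : AdmissibleNcAxi Ω g M u) : AdmissibleNcAxi Ω g M (fun y => u (χ y)) := by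
  have := D.isFiniteMeasure_restrict
  have hq := P.quasiMeasurePreserving_inv D.isOpen.measurableSet
  have hgrad := P.weakGrad_comp_ae_eq D.isOpen hu.memW12
  refine ⟨⟨P.memW12_comp D.isOpen hu.memW12, P.memW120_comp_sub D.isOpen hg hu.trace_eq,
    hq.ae hu.bound, ?_, P.injectiveAE_comp hu.injective⟩, ?_,
    (P.surfaceEnergy_comp D.isOpen hu.memW12).trans hu.surfaceEnergy_eq_zero,
    P.isAxisymmetricMap_comp D hχ hu.axisymmetric⟩
  · filter_upwards [hgrad, hq.ae hu.det_pos] with y hy h0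
    rw [hy, Matrix.det_mul]
    exact mul_pos h0 (P.symm.det_pos y)
  · have hint := (P.integrableOn_iff D.isOpen.measurableSet
      fun y => (weakGrad Ω u (χ y) * jacobian χ y).det).2 (by
        simpa only [P.left_inv, det_mul_det_mul _ (P.jacobian_mul _)] using hu.det_integrable)
    rw [P.image_eq] at hint
    exact hint.congr (hgrad.mono fun y hy => by simp only [hy])

end IsInnerDiffeo

/-! ### Perturbations of the identity -/

theorem isCompact_setOf_abs_entry_le (m n : ℕ) (C : ℝ) :
    IsCompact {A : Matrix (Fin m) (Fin n) ℝ | ∀ i j, |A i j| ≤ C} := by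
  have h : IsCompact (Set.univ.pi fun _ : Fin m => Set.univ.pi fun _ : Fin n => Set.Icc (-C) C) :=
    isCompact_univ_pi fun _ => isCompact_univ_pi fun _ => isCompact_Icc
  refine (congrArg IsCompact (Set.ext fun A => ?_)).mp h
  exact ⟨fun hA i j => abs_le.2 (hA i trivial j trivial),
    fun hA i _ j _ => abs_le.1 (hA i j)⟩

theorem eventually_det_one_add_smul_mem_Ioo (n : ℕ) (C : ℝ) : ∀ᶠ t in 𝓝 (0 : ℝ),
    ∀ A : Matrix (Fin n) (Fin n) ℝ, (∀ i j, |A i j| ≤ C) →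
      (1 + t • A).det ∈ Set.Ioo (1 / 2 : ℝ) 2 := by
  refine (isCompact_setOf_abs_entry_le n n C).eventually_forall_of_forall_eventually fun A _ => ?_
  have hc : Continuous fun z : ℝ × Matrix (Fin n) (Fin n) ℝ => (1 + z.1 • z.2).det := by fun_prop
  refine hc.continuousAt.eventually (Ioo_mem_nhds ?_ ?_) <;> norm_num

theorem IsTest.exists_abs_jacobian_le {m n : ℕ} {U : Set (Eu m)} {X : Eu m → Eu n}
    (hX : IsTest U X) : ∃ C : ℝ, ∀ x i j, |jacobian X x i j| ≤ C := by
  choose c hc using fun j : Fin m => (hX.fderiv_apply (basisVec j)).exists_norm_le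
  refine ⟨∑ j, |c j|, fun x i j => ?_⟩
  calc |jacobian X x i j| ≤ ‖fderiv ℝ X x (basisVec j)‖ :=
        PiLp.norm_apply_le (fderiv ℝ X x (basisVec j)) i
    _ ≤ |c j| := (hc j x).trans (le_abs_self _)
    _ ≤ ∑ j, |c j| := Finset.single_le_sum (fun j _ => abs_nonneg (c j)) (Finset.mem_univ j)

theorem jacobian_id_add_smul {n : ℕ} {X : Eu n → Eu n} {x : Eu n} (hX : DifferentiableAt ℝ X x)
    (t : ℝ) : jacobian (fun x => x + t • X x) x = 1 + t • jacobian X x := by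
  have hderiv : fderiv ℝ (fun x => x + t • X x) x =
      ContinuousLinearMap.id ℝ (Eu n) + t • fderiv ℝ X x :=
    ((hasFDerivAt_id x).add (hX.hasFDerivAt.const_smul t)).fderiv
  ext i j
  simp [jacobian, hderiv, basisVec, Matrix.one_apply]

theorem exists_homeomorph_id_add_smul {E : Type*} [NormedAddCommGroup E] [NormedSpace ℝ E]
    [CompleteSpace E] {X : E → E} {L : NNReal} (hL : LipschitzWith L X) {t : ℝ}
    (ht : |t| * L < 1 / 2) : ∃ Ψ : E ≃ₜ E, ∀ x, Ψ x = x + t • X x := by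
  have happrox : ApproximatesLinearOn (fun x => x + t • X x)
      ((ContinuousLinearEquiv.refl ℝ E : E ≃L[ℝ] E) : E →L[ℝ] E) Set.univ (1 / 2) := by
    intro x _ y _
    calc ‖x + t • X x - (y + t • X y) - (x - y)‖ = |t| * ‖X x - X y‖ := by
          rw [add_sub_add_comm, add_sub_cancel_left, ← smul_sub, norm_smul, Real.norm_eq_abs]
      _ ≤ |t| * (L * ‖x - y‖) := by
          gcongr
          exact hL.norm_sub_le x y
      _ = |t| * L * ‖x - y‖ := by ring
      _ ≤ (1 / 2 : NNReal) * ‖x - y‖ := by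
          push_cast
          gcongr
  have hsmall : Subsingleton E ∨ (1 / 2 : NNReal) <
      ‖((ContinuousLinearEquiv.refl ℝ E).symm : E →L[ℝ] E)‖₊⁻¹ := by
    refine (subsingleton_or_nontrivial E).imp_right fun hE => ?_
    have : NontrivialTopology E := EMetric.nontrivial_iff_nontrivialTopology.1 hE
    have hnorm : ‖((ContinuousLinearEquiv.refl ℝ E).symm : E →L[ℝ] E)‖₊ = 1 :=
      ContinuousLinearMap.nnnorm_id (𝕜 := ℝ) (E := E)
    rw [hnorm, inv_one]
    exact NNReal.half_lt_self one_ne_zero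
  exact ⟨happrox.toHomeomorph _ hsmall, fun _ => rfl⟩

theorem IsTest.eventually_isInnerDiffeo {n : ℕ} {Ω : Set (Eu n)} {X : Eu n → Eu n}
    (hX : IsTest Ω X) : ∀ᶠ t in 𝓝 (0 : ℝ), ∃ χ, IsInnerDiffeo Ω (fun x => x + t • X x) χ := by
  obtain ⟨L, hL⟩ := ContDiff.lipschitzWith_of_hasCompactSupport hX.2.1 hX.1 (by simp)
  obtain ⟨C, hC⟩ := hX.exists_abs_jacobian_le
  have hsmall : ∀ᶠ t in 𝓝 (0 : ℝ), |t| * (L : ℝ) < 1 / 2 :=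
    (continuous_abs.mul continuous_const).continuousAt.eventually (gt_mem_nhds (by simp))
  filter_upwards [hsmall, eventually_det_one_add_smul_mem_Ioo n C] with t ht hdet
  have hsmooth : ContDiff ℝ ∞ (fun x => x + t • X x) := contDiff_id.add (hX.1.const_smul t)
  obtain ⟨Ψ, hΨ⟩ := exists_homeomorph_id_add_smul hL ht
  have hpos (x : Eu n) : 0 < (jacobian (fun x => x + t • X x) x).det := by
    rw [jacobian_id_add_smul (hX.differentiable x)]
    linarith [(hdet _ (hC x)).1]
  have hne (x : Eu n) : (fderiv ℝ (fun x => x + t • X x) x).det ≠ 0 := by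
    rw [det_fderiv]
    exact (hpos x).ne'
  have hinv : ContDiff ℝ ∞ Ψ.symm := by
    refine Ψ.contDiff_symm (f₀' := fun x =>
      (fderiv ℝ (fun x => x + t • X x) x).toContinuousLinearEquivOfDetNeZero (hne x))
      (fun x => ?_) (funext hΨ ▸ hsmooth)
    rw [ContinuousLinearMap.coe_toContinuousLinearEquivOfDetNeZero, funext hΨ]
    exact (hsmooth.differentiable (by simp) x).hasFDerivAt
  refine ⟨Ψ.symm, hsmooth, hinv, fun x => ?_, fun y => ?_,
    ⟨tsupport X, hX.2.1, hX.2.2, fun x hx => ?_⟩, hpos⟩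
  · rw [← hΨ, Ψ.symm_apply_apply]
  · rw [← hΨ, Ψ.apply_symm_apply]
  · rw [image_eq_zero_of_notMem_tsupport hx, smul_zero, add_zero]

theorem cyl_add_smul_axiLift (ξ : Eu 2 → Eu 2) (t : ℝ) {Y : Eu 2} (hY : 0 < Y 0) (θ : ℝ) :
    cyl Y θ + t • axiLift ξ (cyl Y θ) = cyl (Y + t • ξ Y) θ := by
  ext i
  rw [PiLp.add_apply, PiLp.smul_apply, axiLift_cyl_apply ξ hY]
  fin_cases i <;> simp [frame, cyl] <;> ring

theorem IsAxiDomain.eventually_preservesAzimuth_inv {Ω : Set (Eu 3)} (D : IsAxiDomain Ω)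
    {ξ : Eu 2 → Eu 2} (hξ : IsTest (meridian Ω) ξ) : ∀ᶠ t in 𝓝 (0 : ℝ), ∀ χ : Eu 3 → Eu 3,
      IsInnerDiffeo Ω (fun x => x + t • axiLift ξ x) χ → PreservesAzimuth Ω χ := by
  obtain ⟨r₀, hr₀, hr⟩ := D.exists_radius_le
  obtain ⟨C, hC⟩ := hξ.exists_norm_le
  have hsmall : ∀ᶠ t in 𝓝 (0 : ℝ), |t| * C < r₀ :=
    (continuous_abs.mul continuous_const).continuousAt.eventually (gt_mem_nhds (by simpa using hr₀))
  filter_upwards [hsmall] with t ht χ P X hX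
  have hY : cylProj (χ (cyl X 0)) ∈ meridian Ω :=
    D.cylProj_mem_iff.2 ((P.symm.mem_iff _).2 (D.cyl_mem hX 0))
  obtain ⟨η, hη⟩ := exists_eq_cyl (χ (cyl X 0))
  generalize cylProj (χ (cyl X 0)) = Y at hY hη
  have hpos : 0 < (Y + t • ξ Y) 0 := by
    have hdisp : |t * ξ Y 0| ≤ |t| * C := by
      rw [abs_mul]
      gcongr
      exact (PiLp.norm_apply_le (ξ Y) 0).trans (hC Y)
    simp only [PiLp.add_apply, PiLp.smul_apply, smul_eq_mul]
    linarith [hr Y hY, neg_abs_le (t * ξ Y 0)]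
  have hXY : Y + t • ξ Y = X := by
    have hinv := P.right_inv (cyl X 0)
    beta_reduce at hinv
    rw [hη, cyl_add_smul_axiLift ξ t hY.1] at hinv
    rw [← cylProj_cyl hpos.le η, hinv, cylProj_cyl hX.1.le]
  refine ⟨Y, hY.1, fun θ => ?_⟩
  simpa only [cyl_add_smul_axiLift ξ t hY.1, hXY] using P.left_inv (cyl Y θ)

/-! ### The energy density along inner variations -/

section Linearization

variable {n : ℕ} (A : Matrix (Fin n) (Fin n) ℝ)

theorem hasDerivAt_det_one_add_smul : HasDerivAt (fun t : ℝ => (1 + t • A).det) A.trace 0 := by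
  rw [funext fun t : ℝ => Matrix.det_one_add_smul t A]
  have hlin : HasDerivAt (fun t : ℝ => 1 + A.trace * t) A.trace 0 := by
    simpa using ((hasDerivAt_id (0 : ℝ)).const_mul A.trace).const_add 1
  have hquad := ((1 + (Polynomial.X : Polynomial ℝ) • A.map Polynomial.C).det.divX.divX.hasDerivAt
    (0 : ℝ)).fun_mul ((hasDerivAt_id (0 : ℝ)).fun_pow 2)
  exact (hlin.fun_add hquad).congr_deriv (by simp)

theorem continuousAt_inv_of_det_ne_zero {A : Matrix (Fin n) (Fin n) ℝ} (hA : A.det ≠ 0) :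
    ContinuousAt Inv.inv A :=
  continuousAt_matrix_inv A <| by
    rw [Ring.inverse_eq_inv']
    exact continuousAt_inv₀ hA

theorem continuousAt_inv_one_add_smul :
    ContinuousAt (fun z : ℝ × Matrix (Fin n) (Fin n) ℝ => (1 + z.1 • z.2)⁻¹) (0, A) := by
  have hc : Continuous fun z : ℝ × Matrix (Fin n) (Fin n) ℝ => 1 + z.1 • z.2 :=
    continuous_const.add (continuous_fst.smul continuous_snd)
  have hinv : ContinuousAt Inv.inv (1 + (0 : ℝ) • A) := continuousAt_inv_of_det_ne_zero (by simp)
  exact ContinuousAt.comp_of_eq hinv hc.continuousAt rfl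

theorem hasDerivAt_inv_one_add_smul (i j : Fin n) :
    HasDerivAt (fun t : ℝ => (1 + t • A)⁻¹ i j) (-A i j) 0 := by
  have hcont : ContinuousAt (fun t : ℝ => (1 + t • A)⁻¹) 0 :=
    (continuousAt_inv_one_add_smul A).comp (f := fun t : ℝ => (t, A))
      (Continuous.prodMk_left A).continuousAt
  have hlim : Tendsto (fun t : ℝ => -(A * (1 + t • A)⁻¹) i j) (𝓝[≠] 0) (𝓝 (-A i j)) := by
    have hentry : ContinuousAt (fun t : ℝ => -(A * (1 + t • A)⁻¹) i j) 0 :=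
      ((continuous_const.matrix_mul continuous_id).matrix_elem i j).neg.continuousAt.comp hcont
    simpa using hentry.tendsto.mono_left nhdsWithin_le_nhds
  refine hasDerivAt_iff_tendsto_slope_zero.2 (hlim.congr' ?_)
  have hdet : ∀ᶠ t in 𝓝 (0 : ℝ), (1 + t • A).det ≠ 0 :=
    (hasDerivAt_det_one_add_smul A).continuousAt.eventually_ne (by simp)
  filter_upwards [nhdsWithin_le_nhds hdet, self_mem_nhdsWithin] with t ht ht0
  have hinv : (1 + t • A)⁻¹ = 1 - t • (A * (1 + t • A)⁻¹) := by
    rw [eq_sub_iff_add_eq, ← Matrix.smul_mul, ← one_add_mul]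
    exact Matrix.mul_nonsing_inv _ (isUnit_iff_ne_zero.2 ht)
  simp only [zero_add, zero_smul, add_zero, inv_one, smul_eq_mul]
  rw [congrFun₂ hinv i j, Matrix.sub_apply, Matrix.smul_apply, smul_eq_mul, sub_sub_cancel_left,
    mul_neg, inv_mul_cancel_left₀ ht0]

end Linearization

section Density

variable {n : ℕ}

/-- The integrand `|F|² + H (det F)` of the energy, as a function of the gradient `F`. -/
def storedDensity (H : ℝ → ℝ) (F : Matrix (Fin n) (Fin n) ℝ) : ℝ :=
  frobSq F + H F.det

/-- The energy-momentum tensor as a function of the gradient `F`. -/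
def momentumTensor (H : ℝ → ℝ) (F : Matrix (Fin n) (Fin n) ℝ) : Matrix (Fin n) (Fin n) ℝ :=
  (2 : ℝ) • (F.transpose * F) + (deriv H F.det * F.det - frobSq F - H F.det) • 1

/-- The energy density of an inner variation, pulled back to the reference configuration: if `F` is
the gradient of `u` and `A` that of `X`, both at `x`, this is the density of the composition of `u`
with the inverse of `ψ := id + t X`, at `ψ x` and with respect to `dx`. -/
def variedDensity (H : ℝ → ℝ) (F A : Matrix (Fin n) (Fin n) ℝ) (t : ℝ) : ℝ :=
  (1 + t • A).det * storedDensity H (F * (1 + t • A)⁻¹)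

variable {H : ℝ → ℝ} {F A : Matrix (Fin n) (Fin n) ℝ}

theorem variedDensity_zero : variedDensity H F A 0 = storedDensity H F := by
  simp [variedDensity]

theorem variedDensity_add {t : ℝ} (ht : (1 + t • A).det ≠ 0) (s : ℝ) :
    variedDensity H F A (t + s) = (1 + t • A).det *
      variedDensity H (F * (1 + t • A)⁻¹) (A * (1 + t • A)⁻¹) s := by
  have hfactor : 1 + (t + s) • A = (1 + s • (A * (1 + t • A)⁻¹)) * (1 + t • A) := by
    rw [add_mul, one_mul, Matrix.smul_mul, Matrix.mul_assoc,
      Matrix.nonsing_inv_mul _ (isUnit_iff_ne_zero.2 ht), Matrix.mul_one, add_smul, add_assoc]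
  rw [variedDensity, variedDensity, hfactor, Matrix.det_mul, Matrix.mul_inv_rev, Matrix.mul_assoc]
  ring

theorem hasDerivAt_frobSq_mul_inv_one_add_smul (F A : Matrix (Fin n) (Fin n) ℝ) :
    HasDerivAt (fun t : ℝ => frobSq (F * (1 + t • A)⁻¹))
      (-(2 * ∑ i, ∑ j, (F.transpose * F) i j * A i j)) 0 := by
  have hentry (i j : Fin n) :
      HasDerivAt (fun t : ℝ => (F * (1 + t • A)⁻¹) i j) (-(F * A) i j) 0 := by
    simpa only [Matrix.mul_apply, mul_neg, Finset.sum_neg_distrib] using HasDerivAt.fun_sum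
      fun k _ => (hasDerivAt_inv_one_add_smul A k j).const_mul (F i k)
  have hderiv := HasDerivAt.fun_sum fun i (_ : i ∈ Finset.univ) =>
    HasDerivAt.fun_sum fun j (_ : j ∈ Finset.univ) => (hentry i j).pow 2
  refine hderiv.congr_deriv ?_
  have hpair : ∑ i, ∑ j, F i j * (F * A) i j = ∑ i, ∑ j, (F.transpose * F) i j * A i j := by
    simp only [← Matrix.hadamard_apply, Matrix.sum_hadamard_eq, Matrix.transpose_mul]
    rw [Matrix.trace_mul_comm, Matrix.mul_assoc, Matrix.trace_mul_comm]
  rw [← hpair]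
  simp [Finset.mul_sum, mul_assoc]

theorem hasDerivAt_variedDensity_zero (hH : DifferentiableAt ℝ H F.det) :
    HasDerivAt (variedDensity H F A) (-∑ i, ∑ j, momentumTensor H F i j * A i j) 0 := by
  have hdet := hasDerivAt_det_one_add_smul A
  have hdet_inv : HasDerivAt (fun t : ℝ => (F * (1 + t • A)⁻¹).det) (-(F.det * A.trace)) 0 := by
    simpa [div_eq_mul_inv] using (hdet.inv (by simp)).const_mul F.det
  have hcomp : HasDerivAt (fun t : ℝ => H (F * (1 + t • A)⁻¹).det)
      (deriv H F.det * -(F.det * A.trace)) 0 :=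
    HasDerivAt.comp_of_eq (0 : ℝ) hH.hasDerivAt hdet_inv (by simp)
  refine (hdet.mul ((hasDerivAt_frobSq_mul_inv_one_add_smul F A).add hcomp)).congr_deriv ?_
  have hpair : ∑ i, ∑ j, momentumTensor H F i j * A i j =
      2 * ∑ i, ∑ j, (F.transpose * F) i j * A i j +
        (deriv H F.det * F.det - frobSq F - H F.det) * A.trace := by
    simp [momentumTensor, add_mul, Finset.sum_add_distrib, Finset.mul_sum, mul_assoc,
      Matrix.one_apply, Matrix.trace]
  rw [hpair]
  simp only [zero_smul, add_zero, inv_one, Matrix.mul_one, Matrix.det_one, one_mul, Pi.add_apply]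
  ring

theorem hasDerivAt_variedDensity {t : ℝ} (ht : (1 + t • A).det ≠ 0)
    (hH : DifferentiableAt ℝ H (F * (1 + t • A)⁻¹).det) :
    HasDerivAt (variedDensity H F A) (-((1 + t • A).det * ∑ i, ∑ j,
      momentumTensor H (F * (1 + t • A)⁻¹) i j * (A * (1 + t • A)⁻¹) i j)) t := by
  have hzero := (hasDerivAt_variedDensity_zero (A := A * (1 + t • A)⁻¹) hH).const_mul
    (1 + t • A).det
  rw [mul_neg, ← sub_self t] at hzero
  refine (hzero.comp_sub_const t t).congr_of_eventuallyEq (.of_forall fun s => ?_)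
  simp only [← variedDensity_add ht, add_sub_cancel]

end Density

/-! ### Uniform bounds along inner variations -/

theorem eventually_inv_one_add_smul_bound (n : ℕ) (C : ℝ) : ∀ᶠ t in 𝓝 (0 : ℝ),
    ∀ A : Matrix (Fin n) (Fin n) ℝ, (∀ i j, |A i j| ≤ C) →
      frobSq (1 + t • A)⁻¹ < n + 1 ∧ ∀ i j, |(A * (1 + t • A)⁻¹) i j| < C + 1 := by
  refine (isCompact_setOf_abs_entry_le n n C).eventually_forall_of_forall_eventually fun A hA => ?_
  have hinv := continuousAt_inv_one_add_smul A
  have hfrob : ContinuousAt (fun z : ℝ × Matrix (Fin n) (Fin n) ℝ => frobSq (1 + z.1 • z.2)⁻¹)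
      (0, A) :=
    tendsto_finsetSum _ fun i _ => tendsto_finsetSum _ fun j _ =>
      ((continuous_id.matrix_elem i j).continuousAt.comp hinv).pow 2
  have hmul (i j : Fin n) :
      ContinuousAt (fun z : ℝ × Matrix (Fin n) (Fin n) ℝ => |(z.2 * (1 + z.1 • z.2)⁻¹) i j|)
        (0, A) := by
    simp only [Matrix.mul_apply]
    exact (tendsto_finsetSum _ fun k _ => (continuous_snd.matrix_elem i k).continuousAt.mul
      ((continuous_id.matrix_elem k j).continuousAt.comp hinv)).abs
  refine (hfrob.eventually (gt_mem_nhds ?_)).and <| eventually_all.2 fun i => eventually_all.2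
    fun j => (hmul i j).eventually (gt_mem_nhds ?_)
  · simp [frobSq, Matrix.one_apply]
  · simpa using (hA i j).trans_lt (lt_add_one C)

theorem abs_transpose_mul_self_apply_le {m n : ℕ} (F : Matrix (Fin n) (Fin m) ℝ) (i j : Fin m) :
    |(F.transpose * F) i j| ≤ frobSq F := by
  have hcol (j : Fin m) : ∑ k, F k j ^ 2 ≤ frobSq F := Finset.sum_le_sum fun k _ =>
    Finset.single_le_sum (f := fun j => F k j ^ 2) (fun _ _ => sq_nonneg _) (Finset.mem_univ j)
  have hamgm : |∑ k, F k i * F k j| ≤ ∑ k, (F k i ^ 2 + F k j ^ 2) / 2 :=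
    (Finset.abs_sum_le_sum_abs _ _).trans <| Finset.sum_le_sum fun k _ => by
      rw [abs_mul, ← sq_abs (F k i), ← sq_abs (F k j)]
      linarith [two_mul_le_add_sq |F k i| |F k j|]
  rw [← Finset.sum_div, Finset.sum_add_distrib] at hamgm
  simp only [Matrix.mul_apply, Matrix.transpose_apply]
  linarith [hcol i, hcol j]

theorem abs_momentumTensor_apply_le {n : ℕ} (H : ℝ → ℝ) {F : Matrix (Fin n) (Fin n) ℝ}
    (hF : 0 < F.det) (i j : Fin n) :
    |momentumTensor H F i j| ≤ 3 * frobSq F + |deriv H F.det| * F.det + |H F.det| := by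
  have hscalar : |(deriv H F.det * F.det - frobSq F - H F.det) * (1 : Matrix _ _ ℝ) i j| ≤
      |deriv H F.det| * F.det + frobSq F + |H F.det| := by
    have hone : |(1 : Matrix (Fin n) (Fin n) ℝ) i j| ≤ 1 := by
      rw [Matrix.one_apply]
      split_ifs <;> simp
    calc _ ≤ |deriv H F.det * F.det - frobSq F - H F.det| :=
          (abs_mul _ _).trans_le (mul_le_of_le_one_right (abs_nonneg _) hone)
      _ ≤ |deriv H F.det * F.det| + |frobSq F| + |H F.det| :=
          (abs_sub _ _).trans (add_le_add_left (abs_sub _ _) _)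
      _ = _ := by rw [abs_mul, abs_of_pos hF, abs_of_nonneg (frobSq_nonneg F)]
  have hquad : |2 * (F.transpose * F) i j| ≤ 2 * frobSq F := by
    rw [abs_mul, abs_two]
    gcongr
    exact abs_transpose_mul_self_apply_le F i j
  simp only [momentumTensor, Matrix.add_apply, Matrix.smul_apply, smul_eq_mul]
  linarith [abs_add_le (2 * (F.transpose * F) i j)
    ((deriv H F.det * F.det - frobSq F - H F.det) * (1 : Matrix _ _ ℝ) i j)]

theorem abs_sum_sum_mul_le {m n : ℕ} {M N : Matrix (Fin m) (Fin n) ℝ} {a b : ℝ}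
    (hM : ∀ i j, |M i j| ≤ a) (hN : ∀ i j, |N i j| ≤ b) :
    |∑ i, ∑ j, M i j * N i j| ≤ m * (n * (a * b)) := by
  have hterm (i : Fin m) (j : Fin n) : |M i j * N i j| ≤ a * b := by
    rw [abs_mul]
    exact mul_le_mul (hM i j) (hN i j) (abs_nonneg _) ((abs_nonneg _).trans (hM i j))
  calc |∑ i, ∑ j, M i j * N i j| ≤ ∑ i, ∑ j, |M i j * N i j| :=
        (Finset.abs_sum_le_sum_abs _ _).trans <|
          Finset.sum_le_sum fun _ _ => Finset.abs_sum_le_sum_abs _ _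
    _ ≤ ∑ _ : Fin m, ∑ _ : Fin n, a * b :=
        Finset.sum_le_sum fun i _ => Finset.sum_le_sum fun j _ => hterm i j
    _ = m * (n * (a * b)) := by simp

theorem det_inv_mem_Ioo {n : ℕ} {B : Matrix (Fin n) (Fin n) ℝ}
    (hB : B.det ∈ Set.Ioo (1 / 2 : ℝ) 2) : B⁻¹.det ∈ Set.Ioo (1 / 2 : ℝ) 2 := by
  have hpos : 0 < B.det := by linarith [hB.1]
  rw [Matrix.det_nonsing_inv, Ring.inverse_eq_inv', one_div, Set.mem_Ioo,
    inv_lt_inv₀ two_pos hpos, inv_lt_comm₀ hpos two_pos, ← one_div]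
  exact hB.symm

namespace HasControlledGrowth

variable {H : ℝ → ℝ} (hH : HasControlledGrowth H)
include hH

theorem exists_density_mul_bound (n : ℕ) : ∃ K, 0 ≤ K ∧ ∀ F B : Matrix (Fin n) (Fin n) ℝ,
    0 < F.det → B.det ∈ Set.Ioo (1 / 2 : ℝ) 2 → frobSq B < n + 1 →
      |storedDensity H (F * B)| ≤ K * (1 + storedDensity H F) ∧
        ∀ i j, |momentumTensor H (F * B) i j| ≤ K * (1 + storedDensity H F) := by
  obtain ⟨C, hC, hcomp⟩ := hH.exists_comparable_bound
  refine ⟨3 * (n + 1) + 2 * C, by positivity, fun F B hF hB hfrob => ?_⟩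
  have hdet : (F * B).det = F.det * B.det := Matrix.det_mul F B
  have hlower : F.det / 2 ≤ (F * B).det := by
    rw [hdet]
    linarith [mul_le_mul_of_nonneg_left hB.1.le hF.le]
  have hupper : (F * B).det ≤ 2 * F.det := by
    rw [hdet]
    linarith [mul_le_mul_of_nonneg_left hB.2.le hF.le]
  obtain ⟨hH', hHdet⟩ := hcomp F.det (F * B).det hF hlower hupper
  have hG : frobSq (F * B) ≤ (n + 1) * frobSq F := by
    rw [mul_comm]
    exact (frobSq_mul_le F B).trans (mul_le_mul_of_nonneg_left hfrob.le (frobSq_nonneg F))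
  have hsum : 3 * ((n + 1) * frobSq F) + 2 * (C * (1 + H F.det)) ≤
      (3 * (n + 1) + 2 * C) * (1 + storedDensity H F) := by
    have hrest : 0 ≤ 3 * (n + 1) * (1 + H F.det) + 2 * C * frobSq F := by
      have := hH.nonneg _ hF
      have := frobSq_nonneg F
      positivity
    rw [storedDensity]
    linarith
  have hpos : 0 < (F * B).det := by linarith
  refine ⟨?_, fun i j => ?_⟩
  · have habs : |storedDensity H (F * B)| ≤ frobSq (F * B) + |H (F * B).det| :=
      (abs_add_le _ _).trans_eq (by rw [abs_of_nonneg (frobSq_nonneg _)])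
    linarith [frobSq_nonneg (F * B), (abs_nonneg _).trans hHdet]
  · linarith [abs_momentumTensor_apply_le H hpos i j]

theorem exists_variedDensity_bound (n : ℕ) (C : ℝ) : ∃ K, ∀ᶠ t in 𝓝 (0 : ℝ),
    ∀ F A : Matrix (Fin n) (Fin n) ℝ, 0 < F.det → (∀ i j, |A i j| ≤ C) →
      DifferentiableAt ℝ (variedDensity H F A) t ∧
        |variedDensity H F A t| ≤ K * (1 + storedDensity H F) ∧
        |deriv (variedDensity H F A) t| ≤ K * (1 + storedDensity H F) := by
  obtain ⟨K, hK, hbound⟩ := hH.exists_density_mul_bound n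
  refine ⟨2 * K + 2 * (n * (n * (K * (|C| + 1)))), ?_⟩
  filter_upwards [eventually_det_one_add_smul_mem_Ioo n C, eventually_inv_one_add_smul_bound n C]
    with t hdet hinv F A hF hA
  obtain ⟨hfrob, hAB⟩ := hinv A hA
  have hd : 0 < (1 + t • A).det := by linarith [(hdet A hA).1]
  have hB := det_inv_mem_Ioo (hdet A hA)
  have hFB : 0 < (F * (1 + t • A)⁻¹).det := by
    rw [Matrix.det_mul]
    exact mul_pos hF (by linarith [hB.1])
  have hderiv := hasDerivAt_variedDensity (A := A) hd.ne' (hH.differentiableAt hFB)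
  obtain ⟨hstored, hmomentum⟩ := hbound F _ hF hB hfrob
  have hsum := abs_sum_sum_mul_le hmomentum fun i j =>
    (hAB i j).le.trans (add_le_add_left (le_abs_self C) 1)
  have hS : 0 ≤ 1 + storedDensity H F := by
    linarith [storedDensity.eq_def H F, frobSq_nonneg F, hH.nonneg _ hF]
  have hnonneg : 0 ≤ K * (1 + storedDensity H F) := by positivity
  have hscale {x y : ℝ} (hx : |x| ≤ y) : |(1 + t • A).det * x| ≤ 2 * y := by
    rw [abs_mul, abs_of_pos hd]
    exact mul_le_mul (hdet A hA).2.le hx (abs_nonneg x) two_pos.le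
  have hrest : 0 ≤ n * (n * (K * (1 + storedDensity H F) * (|C| + 1))) := by positivity
  refine ⟨hderiv.differentiableAt, ?_, ?_⟩
  · rw [variedDensity]
    linarith [hscale hstored]
  · rw [hderiv.deriv, abs_neg]
    linarith [hscale hsum]

end HasControlledGrowth

/-! ### Stationarity of minimizers -/

namespace HasControlledGrowth

variable {H : ℝ → ℝ} (hH : HasControlledGrowth H)
include hH

theorem aestronglyMeasurable_variedDensity {α : Type*} [TopologicalSpace α] [MeasurableSpace α]
    [OpensMeasurableSpace α] {μ : Measure α} {n : ℕ} {F A : α → Matrix (Fin n) (Fin n) ℝ} {t : ℝ}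
    (hF : ∀ i j, AEStronglyMeasurable (fun x => F x i j) μ) (hFdet : ∀ᵐ x ∂μ, 0 < (F x).det)
    (hA : Continuous A) (hAdet : ∀ x, 0 < (1 + t • A x).det) :
    AEStronglyMeasurable (fun x => variedDensity H (F x) (A x) t) μ := by
  have hψ : Continuous fun x => 1 + t • A x := continuous_const.add (hA.const_smul t)
  have hinv : Continuous fun x => (1 + t • A x)⁻¹ := continuous_iff_continuousAt.2 fun x =>
    ContinuousAt.comp_of_eq (continuousAt_inv_of_det_ne_zero (hAdet x).ne') hψ.continuousAt rfl
  have hmul (i j : Fin n) : AEStronglyMeasurable (fun x => (F x * (1 + t • A x)⁻¹) i j) μ := by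
    simp only [Matrix.mul_apply]
    exact Finset.aestronglyMeasurable_fun_sum _ fun k _ =>
      (hF i k).mul (hinv.matrix_elem k j).aestronglyMeasurable
  have hpos : ∀ᵐ x ∂μ, 0 < (F x * (1 + t • A x)⁻¹).det := hFdet.mono fun x hx => by
    rw [Matrix.det_mul, Matrix.det_nonsing_inv, Ring.inverse_eq_inv']
    exact mul_pos hx (inv_pos.2 (hAdet x))
  have hfrob : AEStronglyMeasurable (fun x => frobSq (F x * (1 + t • A x)⁻¹)) μ :=
    Finset.aestronglyMeasurable_fun_sum _ fun i _ => Finset.aestronglyMeasurable_fun_sum _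
      fun j _ => (hmul i j).pow 2
  exact hψ.matrix_det.aestronglyMeasurable.mul
    (hfrob.add (hH.aestronglyMeasurable_comp (aestronglyMeasurable_det hmul) hpos))

theorem variedDensity_nonneg {n : ℕ} {F A : Matrix (Fin n) (Fin n) ℝ} {t : ℝ} (hF : 0 < F.det)
    (hA : 0 < (1 + t • A).det) : 0 ≤ variedDensity H F A t := by
  have hdet : 0 < (F * (1 + t • A)⁻¹).det := by
    rw [Matrix.det_mul, Matrix.det_nonsing_inv, Ring.inverse_eq_inv']
    exact mul_pos hF (inv_pos.2 hA)
  exact mul_nonneg hA.le (add_nonneg (frobSq_nonneg _) (hH.nonneg _ hdet))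

section FirstVariation

variable {Ω : Set (Eu 3)} {u X : Eu 3 → Eu 3} [IsFiniteMeasure (volume.restrict Ω)]
  (hΩ : IsOpen Ω) (hu : MemW12 Ω u) (hdet : ∀ᵐ x ∂(volume.restrict Ω), 0 < (weakGrad Ω u x).det)
  (hE : energy H Ω u < ⊤)
include hΩ hu hdet hE

theorem integrable_one_add_storedDensity (K : ℝ) :
    Integrable (fun x => K * (1 + storedDensity H (weakGrad Ω u x))) (volume.restrict Ω) :=
  ((integrable_const 1).add ((integrableOn_frobSq_weakGrad hΩ hu).add
    (hH.integrableOn_storedEnergy hΩ hu hdet hE))).const_mul K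

theorem eventually_integrable_variedDensity (hX : IsTest Ω X) : ∀ᶠ t in 𝓝 (0 : ℝ),
    Integrable (fun x => variedDensity H (weakGrad Ω u x) (jacobian X x) t)
      (volume.restrict Ω) := by
  obtain ⟨C, hC⟩ := hX.exists_abs_jacobian_le
  obtain ⟨K, hK⟩ := hH.exists_variedDensity_bound 3 C
  filter_upwards [hK, eventually_det_one_add_smul_mem_Ioo 3 C] with t hbound hpos
  refine (hH.integrable_one_add_storedDensity hΩ hu hdet hE K).mono'
    (hH.aestronglyMeasurable_variedDensity (fun i j => (hu.memLp_weakGrad hΩ i j).1) hdet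
      (continuous_jacobian (hX.1.of_le (by simp))) fun x => ?_)
    (hdet.mono fun x hx => (hbound _ _ hx (hC x)).2.1)
  linarith [(hpos _ (hC x)).1]

theorem hasDerivAt_integral_variedDensity (hX : IsTest Ω X) :
    HasDerivAt (fun t => ∫ x in Ω, variedDensity H (weakGrad Ω u x) (jacobian X x) t)
      (-∫ x in Ω, ∑ i, ∑ j, energyMomentum H Ω u x i j * jacobian X x i j) 0 := by
  obtain ⟨C, hC⟩ := hX.exists_abs_jacobian_le
  obtain ⟨K, hK⟩ := hH.exists_variedDensity_bound 3 C
  have hint := hH.eventually_integrable_variedDensity hΩ hu hdet hE hX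
  have hzero : (fun x => -∑ i, ∑ j, energyMomentum H Ω u x i j * jacobian X x i j)
      =ᵐ[volume.restrict Ω]
        fun x => deriv (variedDensity H (weakGrad Ω u x) (jacobian X x)) 0 :=
    hdet.mono fun x hx => (hasDerivAt_variedDensity_zero (hH.differentiableAt hx)).deriv.symm
  have hmeas : AEStronglyMeasurable
      (fun x => -∑ i, ∑ j, energyMomentum H Ω u x i j * jacobian X x i j) (volume.restrict Ω) :=
    (Finset.aestronglyMeasurable_fun_sum _ fun i _ => Finset.aestronglyMeasurable_fun_sum _
      fun j _ => (hH.integrableOn_energyMomentum hΩ hu hdet hE i j).1.mul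
        (contDiff_jacobian hX.1 i j).continuous.aestronglyMeasurable).neg
  have hderiv := (hasDerivAt_integral_of_dominated_loc_of_deriv_le hK
    (hint.mono fun _ ht => ht.1) hint.self_of_nhds (hmeas.congr hzero)
    (hdet.mono fun x hx t ht => (ht _ _ hx (hC x)).2.2)
    (hH.integrable_one_add_storedDensity hΩ hu hdet hE K)
    (hdet.mono fun x hx t ht => (ht _ _ hx (hC x)).1.hasDerivAt)).2
  rwa [← integral_congr_ae hzero, integral_neg] at hderiv

end FirstVariation

end HasControlledGrowth

theorem IsInnerDiffeo.energy_comp {Ω : Set (Eu 3)} {X χ : Eu 3 → Eu 3} {t : ℝ}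
    (P : IsInnerDiffeo Ω (fun x => x + t • X x) χ) (hX : Differentiable ℝ X) (hΩ : IsOpen Ω)
    {u : Eu 3 → Eu 3} (hu : MemW12 Ω u) (H : ℝ → ℝ) : energy H Ω (fun y => u (χ y)) =
      ∫⁻ x in Ω, ENNReal.ofReal (variedDensity H (weakGrad Ω u x) (jacobian X x) t) := by
  have hgrad : energy H Ω (fun y => u (χ y)) = ∫⁻ y in Ω, ENNReal.ofReal
      (storedDensity H (weakGrad Ω u (χ y) * jacobian χ y)) :=
    lintegral_congr_ae <| (P.weakGrad_comp_ae_eq hΩ hu).mono fun y hy => by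
      simp only [hy, storedDensity]
  rw [hgrad, P.lintegral_eq hΩ.measurableSet]
  refine lintegral_congr fun x => ?_
  have hinv := Matrix.inv_eq_left_inv (P.jacobian_mul x)
  have hdet := P.det_pos x
  rw [jacobian_id_add_smul (hX x)] at hinv hdet ⊢
  rw [← ENNReal.ofReal_mul hdet.le, variedDensity, hinv]
  simp only [P.left_inv]

theorem IsMinimizer.isLocalMin_integral_variedDensity {H : ℝ → ℝ} (hH : HasControlledGrowth H)
    {Ω : Set (Eu 3)} (D : IsAxiDomain Ω) {g : Eu 3 → Eu 3} (hg : ContDiffOn ℝ 1 g Ω) {M : ℝ}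
    {u : Eu 3 → Eu 3} (hu : IsMinimizer H Ω g M u) {ξ : Eu 2 → Eu 2} (hξ : IsTest (meridian Ω) ξ) :
    IsLocalMin (fun t => ∫ x in Ω, variedDensity H (weakGrad Ω u x) (jacobian (axiLift ξ) x) t)
      0 := by
  have := D.isFiniteMeasure_restrict
  have hX : IsTest Ω (axiLift ξ) := D.isTest_axiLift hξ
  obtain ⟨C, hC⟩ := hX.exists_abs_jacobian_le
  have hint := hH.eventually_integrable_variedDensity D.isOpen hu.mem.memW12 hu.mem.det_pos
    hu.energy_lt_top hX
  have hnonneg : ∀ᶠ t in 𝓝 (0 : ℝ), 0 ≤ᵐ[volume.restrict Ω]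
      fun x => variedDensity H (weakGrad Ω u x) (jacobian (axiLift ξ) x) t := by
    filter_upwards [eventually_det_one_add_smul_mem_Ioo 3 C] with t hdet
    filter_upwards [hu.mem.det_pos] with x hx
    exact hH.variedDensity_nonneg hx (by linarith [(hdet _ (hC x)).1])
  have henergy : energy H Ω u = ∫⁻ x in Ω, ENNReal.ofReal
      (variedDensity H (weakGrad Ω u x) (jacobian (axiLift ξ) x) 0) := by
    simp only [variedDensity_zero]
    rfl
  filter_upwards [hint, hnonneg, hX.eventually_isInnerDiffeo,
    D.eventually_preservesAzimuth_inv hξ] with t hint_t hnonneg_t ⟨χ, P⟩ hazimuth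
  have hle := hu.le _ (P.admissibleNcAxi_comp D (hazimuth χ P) hg hu.mem)
  rw [P.energy_comp hX.differentiable D.isOpen hu.mem.memW12, henergy,
    ← ofReal_integral_eq_lintegral_ofReal hint.self_of_nhds hnonneg.self_of_nhds,
    ← ofReal_integral_eq_lintegral_ofReal hint_t hnonneg_t] at hle
  exact (ENNReal.ofReal_le_ofReal_iff (integral_nonneg_of_ae hnonneg_t)).1 hle

theorem IsMinimizer.isAxiStationary {H : ℝ → ℝ} (hH : HasControlledGrowth H) {Ω : Set (Eu 3)}
    (D : IsAxiDomain Ω) {g : Eu 3 → Eu 3} (hg : ContDiffOn ℝ 1 g Ω) {M : ℝ} {u : Eu 3 → Eu 3}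
    (hu : IsMinimizer H Ω g M u) : IsAxiStationary Ω (energyMomentum H Ω u) := by
  intro ξ hξ
  have := D.isFiniteMeasure_restrict
  exact neg_eq_zero.1 <| (hu.isLocalMin_integral_variedDensity hH D hg hξ).hasDerivAt_eq_zero <|
    hH.hasDerivAt_integral_variedDensity D.isOpen hu.mem.memW12 hu.mem.det_pos hu.energy_lt_top
      (D.isTest_axiLift hξ)

end NeoHookean

end

theorem mainTheorem2_general {H : ℝ → ℝ} (hH : HasControlledGrowth H) {Ω : Set (Eu 3)}
    (D : IsAxiDomain Ω) {g : Eu 3 → Eu 3} (hg : ContDiffOn ℝ 1 g Ω) (M : ℝ) :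
    (∀ u v, IsMinimizer H Ω g M u → IsProfile Ω u v →
      MemW12 (meridian Ω) v ∧ ReducedEquations H Ω v ∧
        DistribDivFree Ω (energyMomentum H Ω u)) ∧
    (∀ u v, MemW12 Ω u → (∀ᵐ x ∂(volume.restrict Ω), 0 < (weakGrad Ω u x).det) →
      energy H Ω u < ⊤ → IsProfile Ω u v →
        (ReducedEquations H Ω v ↔ DistribDivFree Ω (energyMomentum H Ω u))) := by
  refine ⟨fun u v hu hv => ?_, fun u v hw hdet hE hv =>
    (reducedEquations_tfae hH D hw hdet hE hv).out 0 1⟩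
  have htfae := reducedEquations_tfae hH D hu.mem.memW12 hu.mem.det_pos hu.energy_lt_top hv
  have hstat := hu.isAxiStationary hH D hg
  exact ⟨hv.memW12 D hu.mem.memW12, (htfae.out 0 2).2 hstat, (htfae.out 1 2).2 hstat⟩

theorem mainTheorem2 (H : ℝ → ℝ) (hH : IsStoredEnergy H)
    (Ω Ω' : Set (Eu 3))
    (hΩ : IsSmoothBoundedDomain Ω) (hΩaxi : IsAxisymmetricSet Ω)
    (hΩ' : IsSmoothBoundedDomain Ω') (hΩ'axi : IsAxisymmetricSet Ω')
    (hΩaxis : ∃ r₀ : ℝ, 0 < r₀ ∧ ∀ x ∈ Ω, r₀ ≤ cylRadius x)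
    (g : Eu 3 → Eu 3) (hg : IsC1DiffeoClosure Ω Ω' g) (hgaxi : IsAxisymmetricMap Ω g)
    (M : ℝ) (hM : 0 < M) :
    (∀ u v, IsMinimizer H Ω g M u → IsProfile Ω u v →
      MemW12 (meridian Ω) v ∧ ReducedEquations H Ω v ∧
        DistribDivFree Ω (energyMomentum H Ω u)) ∧
    (∀ u v, AdmissibleNcAxi Ω g M u → energy H Ω u < ⊤ → IsProfile Ω u v →
      (ReducedEquations H Ω v ↔ DistribDivFree Ω (energyMomentum H Ω u))) := by
  have h := mainTheorem2_general hH.hasControlledGrowth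
    ⟨hΩ.isOpen, hΩ.isBounded, hΩaxi, hΩaxis⟩ (hg.1.mono subset_closure) M
  exact ⟨h.1, fun u v hu => h.2 u v hu.memW12 hu.det_pos⟩
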